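/- Let $n\ge 1$, $1<\alpha<2$, and put $$\kappa_{n,\alpha}=\pi^{\frac{n-1}{2}}\,\frac{\Gamma(\frac{1+\alpha}{2})}{\Gamma(\frac{n+\alpha}{2})}\,\frac{B\left(\frac{1+\alpha}{2},\frac{2-\alpha}{2}\right)-2^{\alpha}}{\alpha 2^{\alpha}},\qquad \lambda_{n,\alpha}=\frac{\pi^{\frac{n-1}{2}}\,\Gamma(\frac{\alpha}{2})\,(4-2^{3-\alpha})}{\alpha\,\Gamma(\frac{n+\alpha-1}{2})},$$ where $B$ is the Euler beta function. For a bounded open set $\Omega\subset\mathbb{R}^n$, $x\in\Omega$ and $w\in S^{n-1}$ let $$d_{w,\Omega}(x)=\min\{|t|: x+tw\notin\Omega\},\qquad \delta_{w,\Omega}(x)=\sup\{|t|: x+tw\in\Omega\},$$ and for $\beta>0$ let $M_\beta(x)>0$ be defined by $$\frac{1}{M_\beta(x)^\beta}=\frac{\int_{S^{n-1}}\left[\frac{1}{d_{w,\Omega}(x)}+\frac{1}{\delta_{w,\Omega}(x)}\right]^\beta dw}{\int_{S^{n-1}}|w_n|^\beta\,dw}.$$ Let $C_c(\Omega)$ be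 the class of continuous functions $u:\Omega\to\mathbb{R}$ with compact support in $\Omega$. (i) Let $\Omega\subset\mathbb{R}^n$ be a bounded domain (nonempty, open, connected). For every $u\in C_c(\Omega)$, $$\frac12\int_{\Omega\times\Omega}\frac{(u(x)-u(y))^2}{|x-y|^{n+\alpha}}\,dx\,dy\ \ge\ \kappa_{n,\alpha}\int_\Omega\frac{u^2(x)}{M_\alpha(x)^\alpha}\,dx+\frac{\lambda_{n,\alpha}}{\operatorname{diam}\Omega}\int_\Omega\frac{u^2(x)}{M_{\alpha-1}(x)^{\alpha-1}}\,dx. \tag{1}$$ (ii) If $\Omega$ is a bounded convex domain, then for every $u\in C_c(\Omega)$, $$\frac12\int_{\Omega\times\Omega}\frac{(u(x)-u(y))^2}{|x-y|^{n+\alpha}}\,dx\,dy\ \ge\ \kappa_{n,\alpha}\int_\Omega\frac{u^2(x)}{\operatorname{dist}(x,\Omega^c)^\alpha}\,dx+\frac{\lambda_{n,\alpha}}{\operatorname{diam}\Omega}\int_\Omega\frac{u^2(x)}{\operatorname{dist}(x,\Omega^c)^{\alpha-1}}\,dx. \tag{2}$$ (The left-hand sides may be $+\infty$.) (iii) The constant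 $\kappa_{n,\alpha}$ in (1) and in (2) may not be replaced by a bigger constant: for every bounded convex domain $\Omega\subset\mathbb{R}^n$ and every $C>\kappa_{n,\alpha}$, inequality (1) with $C$ in place of $\kappa_{n,\alpha}$ fails for some $u\in C_c(\Omega)$, and inequality (2) with $C$ in place of $\kappa_{n,\alpha}$ fails for some $u\in C_c(\Omega)$. -/

import Mathlib

open MeasureTheory Set
open scoped ENNReal

noncomputable section

/-- The constant
`κ_{n,α} = π^((n-1)/2) · Γ((1+α)/2) / Γ((n+α)/2) · (B((1+α)/2, (2-α)/2) - 2^α) / (α 2^α)`,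
where `B` is the Euler beta function. -/
def hardyKappa (n : ℕ) (α : ℝ) : ℝ :=
  Real.pi ^ (((n : ℝ) - 1) / 2) * (Real.Gamma ((1 + α) / 2) / Real.Gamma (((n : ℝ) + α) / 2)) *
    ((ProbabilityTheory.beta ((1 + α) / 2) ((2 - α) / 2) - (2 : ℝ) ^ α) / (α * (2 : ℝ) ^ α))

/-- The constant `π^((n-1)/2) Γ(α/2) (4 - 2^(3-α)) / (α Γ((n+α-1)/2))` of the lower-order term. -/
def hardyLambda (n : ℕ) (α : ℝ) : ℝ :=
  Real.pi ^ (((n : ℝ) - 1) / 2) * Real.Gamma (α / 2) * (4 - (2 : ℝ) ^ (3 - α)) /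
    (α * Real.Gamma (((n : ℝ) + α - 1) / 2))

/-- `d_{w,Ω}(x) = min {|t| : x + t w ∉ Ω}`. -/
def dirDist {n : ℕ} (Ω : Set (EuclideanSpace ℝ (Fin n))) (w x : EuclideanSpace ℝ (Fin n)) : ℝ :=
  sInf {r : ℝ | ∃ t : ℝ, r = |t| ∧ x + t • w ∉ Ω}

/-- `δ_{w,Ω}(x) = sup {|t| : x + t w ∈ Ω}`. -/
def dirReach {n : ℕ} (Ω : Set (EuclideanSpace ℝ (Fin n))) (w x : EuclideanSpace ℝ (Fin n)) : ℝ :=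
  sSup {r : ℝ | ∃ t : ℝ, r = |t| ∧ x + t • w ∈ Ω}

/-- The Loss–Sloane directional mean distance `M_β`, determined (for `β > 0`) by
`1 / M_β(x)^β = ∫_{S^{n-1}} (1 / d_{w,Ω}(x) + 1 / δ_{w,Ω}(x))^β dw / ∫_{S^{n-1}} |w_n|^β dw`,
where `dw` is the surface measure and `w_n` the last coordinate of `w`. -/
def lossSloaneM {n : ℕ} [NeZero n] (Ω : Set (EuclideanSpace ℝ (Fin n))) (β : ℝ)
    (x : EuclideanSpace ℝ (Fin n)) : ℝ≥0∞ :=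
  ((∫⁻ w : Metric.sphere (0 : EuclideanSpace ℝ (Fin n)) 1,
        ENNReal.ofReal (|w.1 ⟨n - 1, Nat.sub_one_lt (NeZero.ne n)⟩| ^ β)
          ∂(volume : Measure (EuclideanSpace ℝ (Fin n))).toSphere) /
    (∫⁻ w : Metric.sphere (0 : EuclideanSpace ℝ (Fin n)) 1,
        ENNReal.ofReal ((1 / dirDist Ω w.1 x + 1 / dirReach Ω w.1 x) ^ β)
          ∂(volume : Measure (EuclideanSpace ℝ (Fin n))).toSphere)) ^ (1 / β)

/-- `dist(x, Ωᶜ)`, as an extended nonnegative real. -/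
def distCompl {n : ℕ} (Ω : Set (EuclideanSpace ℝ (Fin n))) (x : EuclideanSpace ℝ (Fin n)) :
    ℝ≥0∞ :=
  Metric.infEDist x Ωᶜ

/-- `u ∈ C_c(Ω)`: `u` (extended by zero outside the open set `Ω`) is continuous with compact
support contained in `Ω`. -/
structure IsCc {n : ℕ} (Ω : Set (EuclideanSpace ℝ (Fin n))) (u : EuclideanSpace ℝ (Fin n) → ℝ) :
    Prop where
  continuous : Continuous u
  hasCompactSupport : HasCompactSupport u
  tsupport_subset : tsupport u ⊆ Ω

/-- The regional fractional form
`(1/2) ∫_Ω ∫_Ω (u(x) - u(y))² / |x - y|^(n+α) dx dy ∈ [0, ∞]`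
(it may be infinite for a merely continuous `u`). -/
def regionalForm {n : ℕ} (Ω : Set (EuclideanSpace ℝ (Fin n))) (α : ℝ)
    (u : EuclideanSpace ℝ (Fin n) → ℝ) : ℝ≥0∞ :=
  (1 / 2) * ∫⁻ x in Ω, ∫⁻ y in Ω, ENNReal.ofReal ((u x - u y) ^ 2 / ‖x - y‖ ^ ((n : ℝ) + α))

/-- The weighted integral `∫_Ω u(x)² / ρ(x)^β dx`. -/
def weightedInt {n : ℕ} (Ω : Set (EuclideanSpace ℝ (Fin n))) (ρ : EuclideanSpace ℝ (Fin n) → ℝ≥0∞)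
    (β : ℝ) (u : EuclideanSpace ℝ (Fin n) → ℝ) : ℝ≥0∞ :=
  ∫⁻ x in Ω, ENNReal.ofReal (u x ^ 2) / ρ x ^ β

end

/-! ### Convexity inequalities for real powers -/

section RealAnalysis

open Filter Topology

/-! Everything is reduced to lines. From `x ∈ Ω` in a unit direction `w`, let `1/A` and `1/B` be the
exit times forwards and backwards. On this chord, with end points `a < b`, the function `((b - t)(t
- a))^((α-1)/2)` plays the ground state. If `ρ` is the quotient of its values at `y` and at `x`,
then `(u(x) - u(y))² = u(x)² + u(y)² - ρ u(x)² - ρ⁻¹ u(y)² + ρ⁻¹ (ρ u(x) - u(y))²`. Dropping the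
last square bounds the form below by a potential times `u²` (`ground_state_identity`,
`truncated_energy_identity`).

The two parts of that potential diverge at the diagonal, so pairs are truncated by `v ≤ V`, where
`v` is the hyperbolic cotangent of half the Hilbert distance of `x` and `y` in their chord. This is
symmetric in `x` and `y`, and with `t = 1/r` both parts become explicit integrals. After averaging
over `w` and `-w`, with `q = A + B` and `ξ = (A - B)/q`, the potential is `(q/2)^α / α` times
`(V+ξ)^α + (V-ξ)^α - 2α ∫_1^V (v²-1)^((α-1)/2) dv - (1+ξ)^α - (1-ξ)^α`. As `V → ∞`, `2V^α` minus the
integral term tends to the beta value (`tendsto_two_rpow_sub_truncInt`). Convexity handles the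
powers of `V ± ξ`, and `(1+ξ)^α + (1-ξ)^α ≤ 2 + (2^α-2)ξ²` leaves the sharp constant plus a multiple
of `1 - ξ² = 4AB/q² ≥ 4/(q diam Ω)`, which is the remainder (`ray_lower_bound`). Integration over
the sphere gives (1), since `A + B ≥ 1/d_w + 1/δ_w`; for convex `Ω` a supporting hyperplane at the
nearest boundary point gives `M_β ≤ dist`, hence (2).

For sharpness, a half-space has `A = 0` or `B = 0` on every ray, so `ξ = ±1` unless the ray is
parallel to the boundary, and the only loss surviving `V → ∞` is the discarded square. It integrates
to a weighted energy of `f`, where `u = h^((α-1)/2) f` and `h` is the height. For a cutoff `f` that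
is logarithmic in `h` over a range of length `L`, this energy is `o(1)` times the Hardy integral as
`L → ∞` (`groundEnergy_le`, `lintegral_cutoffRegion_le_cutoffMass`). A bounded convex domain lies in
a half-space whose boundary touches a ball inside the domain (`exists_touching_ball`); `u` is
supported in that ball, and shrinking the half-space to `Ω` only lowers the form and raises the
weight. -/

theorem two_mul_rpow_le_add_sub {α V x : ℝ} (hα : 1 ≤ α) (hx : |x| ≤ V) :
    2 * V ^ α ≤ (V + x) ^ α + (V - x) ^ α := by
  obtain ⟨h1, h2⟩ := abs_le.1 hx
  have h := (convexOn_rpow hα).2 (show V + x ∈ Ici 0 by simp; linarith)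
    (show V - x ∈ Ici 0 by simp; linarith) (show (0 : ℝ) ≤ 1 / 2 by norm_num)
    (show (0 : ℝ) ≤ 1 / 2 by norm_num) (by norm_num)
  simp only [smul_eq_mul] at h
  rw [show 1 / 2 * (V + x) + 1 / 2 * (V - x) = V by ring] at h
  linarith

/-- Two applications of the mean value theorem write the second difference as `α(α-1)` times a value
of `s^(α-2)` at some `s ≥ V - 1`. That power decreases because `α < 2`, which is also why the
difference vanishes at infinity. -/
theorem rpow_second_difference_le {α V : ℝ} (hα1 : 1 < α) (hα2 : α < 2) (hV : 1 < V) :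
    (V + 1) ^ α + (V - 1) ^ α - 2 * V ^ α ≤ α * (α - 1) * (V - 1) ^ (α - 2) := by
  have hd : ∀ β t c : ℝ, 0 < c + t → HasDerivAt (fun t : ℝ => (c + t) ^ β) (β * (c + t) ^ (β - 1)) t := by
    intro β t c h
    have := (((hasDerivAt_id t).const_add c).rpow_const (p := β) (Or.inl (by simpa using h.ne')))
    simpa using this
  obtain ⟨θ, hθ, h1⟩ := exists_hasDerivAt_eq_slope (fun t : ℝ => (V + t) ^ α - (V - 1 + t) ^ α)
    (fun t => α * (V + t) ^ (α - 1) - α * (V - 1 + t) ^ (α - 1)) (zero_lt_one)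
    (fun t ht => ((hd α t V (by linarith [ht.1])).sub
      (hd α t (V - 1) (by linarith [ht.1]))).continuousAt.continuousWithinAt)
    (fun t ht => (hd α t V (by linarith [ht.1])).sub (hd α t (V - 1) (by linarith [ht.1])))
  obtain ⟨ξ, hξ, h2⟩ := exists_hasDerivAt_eq_slope (fun t : ℝ => (V - 1 + θ + t) ^ (α - 1))
    (fun t => (α - 1) * (V - 1 + θ + t) ^ (α - 1 - 1)) (zero_lt_one)
    (fun t ht => (hd (α - 1) t (V - 1 + θ)
      (by linarith [ht.1, hθ.1])).continuousAt.continuousWithinAt)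
    (fun t ht => hd (α - 1) t (V - 1 + θ) (by linarith [ht.1, hθ.1]))
  have h3 : (V - 1 + θ + ξ) ^ (α - 1 - 1) ≤ (V - 1) ^ (α - 2) := by
    rw [show α - 1 - 1 = α - 2 by ring]
    exact Real.rpow_le_rpow_of_nonpos (by linarith) (by linarith [hθ.1, hξ.1]) (by linarith)
  simp only [add_zero, sub_zero, div_one] at h1 h2
  rw [show V - 1 + θ + 1 = V + θ by ring] at h2
  rw [show V - 1 + 1 = V by ring] at h1
  have h4 : (V + 1) ^ α + (V - 1) ^ α - 2 * V ^ α
      = α * ((α - 1) * (V - 1 + θ + ξ) ^ (α - 1 - 1)) := by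
    rw [h2, mul_sub, h1]; ring
  rw [h4, mul_assoc]
  exact mul_le_mul_of_nonneg_left (mul_le_mul_of_nonneg_left h3 (by linarith)) (by linarith)

theorem tendsto_rpow_second_difference {α : ℝ} (hα1 : 1 < α) (hα2 : α < 2) :
    Tendsto (fun V : ℝ => (V + 1) ^ α + (V - 1) ^ α - 2 * V ^ α) atTop (𝓝 0) := by
  have h : Tendsto (fun V : ℝ => α * (α - 1) * (V - 1) ^ (α - 2)) atTop (𝓝 0) := by
    have h1 := (tendsto_rpow_neg_atTop (y := 2 - α) (by linarith)).comp
      (tendsto_atTop_add_const_right atTop (-1 : ℝ) tendsto_id)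
    have h2 := h1.const_mul (α * (α - 1))
    rw [mul_zero] at h2
    refine h2.congr fun V => ?_
    simp [sub_eq_add_neg, add_comm]
  refine squeeze_zero' ?_ ?_ h
  · filter_upwards [eventually_gt_atTop 1] with V hV
    have := two_mul_rpow_le_add_sub (α := α) (V := V) (x := 1) hα1.le (by simpa using hV.le)
    linarith
  · filter_upwards [eventually_gt_atTop 1] with V hV
    exact rpow_second_difference_le hα1 hα2 hV

/-- The function `s ↦ (1+s)^β - (1-s)^β` is convex on `[0,1)` and vanishes at `0`. -/
theorem rpow_sub_rpow_le_mul {β x t : ℝ} (hβ0 : 0 < β) (hβ1 : β < 1) (hx0 : 0 ≤ x) (hx1 : x ≤ 1)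
    (ht0 : 0 ≤ t) (ht1 : t < 1) :
    (1 + x * t) ^ β - (1 - x * t) ^ β ≤ x * ((1 + t) ^ β - (1 - t) ^ β) := by
  have hd1 : ∀ s : ℝ, 0 ≤ s → HasDerivAt (fun s : ℝ => (1 + s) ^ β) (β * (1 + s) ^ (β - 1)) s := by
    intro s hs
    have := (((hasDerivAt_id s).const_add 1).rpow_const (p := β)
      (Or.inl (by simp only [id]; linarith)))
    simpa using this
  have hd2 : ∀ s : ℝ, s < 1 →
      HasDerivAt (fun s : ℝ => (1 - s) ^ β) (-(β * (1 - s) ^ (β - 1))) s := by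
    intro s hs
    have := (((hasDerivAt_id s).const_sub 1).rpow_const (p := β)
      (Or.inl (by simp only [id]; linarith)))
    simpa using this
  set N' : ℝ → ℝ := fun s => β * (1 + s) ^ (β - 1) + β * (1 - s) ^ (β - 1)
  have hN : ∀ s ∈ Ico (0 : ℝ) 1,
      HasDerivAt (fun s : ℝ => (1 + s) ^ β - (1 - s) ^ β) (N' s) s := by
    intro s hs
    refine ((hd1 s hs.1).sub (hd2 s hs.2)).congr_deriv ?_
    simp only [N', sub_neg_eq_add]
  have hmono : ConvexOn ℝ (Ico (0 : ℝ) 1) (fun s : ℝ => (1 + s) ^ β - (1 - s) ^ β) := by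
    refine MonotoneOn.convexOn_of_deriv (convex_Ico 0 1)
      (fun s hs => (hN s hs).continuousAt.continuousWithinAt) ?_ ?_
    · rw [interior_Ico]
      exact fun s hs => (hN s ⟨hs.1.le, hs.2⟩).differentiableAt.differentiableWithinAt
    · rw [interior_Ico]
      have key : MonotoneOn N' (Ioo 0 1) := by
        have h2d : ∀ s ∈ Ioo (0 : ℝ) 1, HasDerivAt N'
            (β * ((β - 1) * (1 + s) ^ (β - 1 - 1)) - β * ((β - 1) * (1 - s) ^ (β - 1 - 1))) s := by
          intro s hs
          have e1 := ((((hasDerivAt_id s).const_add 1).rpow_const (p := β - 1)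
            (Or.inl (by simp only [id]; linarith [hs.1])))).const_mul β
          have e2 := ((((hasDerivAt_id s).const_sub 1).rpow_const (p := β - 1)
            (Or.inl (by simp only [id]; linarith [hs.2])))).const_mul β
          refine (e1.add e2).congr_deriv ?_
          simp only [id]; ring
        refine monotoneOn_of_deriv_nonneg (convex_Ioo 0 1)
          (fun s hs => (h2d s hs).continuousAt.continuousWithinAt) ?_ ?_
        · rw [interior_Ioo]
          exact fun s hs => (h2d s hs).differentiableAt.differentiableWithinAt
        · rw [interior_Ioo]
          intro s hs
          rw [(h2d s hs).deriv]
          have : (1 + s) ^ (β - 1 - 1) ≤ (1 - s) ^ (β - 1 - 1) :=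
            Real.rpow_le_rpow_of_nonpos (by linarith [hs.2]) (by linarith [hs.1]) (by linarith)
          have : 0 ≤ β * ((1 - β) * ((1 - s) ^ (β - 1 - 1) - (1 + s) ^ (β - 1 - 1))) :=
            mul_nonneg hβ0.le (mul_nonneg (by linarith) (by linarith))
          linarith
      intro a ha b hb hab
      rw [(hN a ⟨ha.1.le, ha.2⟩).deriv, (hN b ⟨hb.1.le, hb.2⟩).deriv]
      exact key ha hb hab
  have := hmono.2 (show t ∈ Ico (0 : ℝ) 1 from ⟨ht0, ht1⟩)
    (show (0 : ℝ) ∈ Ico (0 : ℝ) 1 from ⟨le_rfl, one_pos⟩) hx0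
    (show 0 ≤ 1 - x by linarith) (by ring)
  simpa using this

/-- Compare `s = 0` and `s = 1` in `x²((1+s)^α + (1-s)^α) - ((1+xs)^α + (1-xs)^α)`. It increases in
`s`, its derivative being `αx` times the gap in `rpow_sub_rpow_le_mul` for the exponent `α - 1`. -/
theorem one_add_rpow_add_one_sub_rpow_le_of_nonneg {α x : ℝ} (hα1 : 1 < α) (hα2 : α < 2)
    (hx0 : 0 ≤ x) (hx1 : x ≤ 1) :
    (1 + x) ^ α + (1 - x) ^ α ≤ 2 + (2 ^ α - 2) * x ^ 2 := by
  have hg : ∀ c s : ℝ, HasDerivAt (fun s : ℝ => (1 + c * s) ^ α + (1 - c * s) ^ α)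
      (α * c * ((1 + c * s) ^ (α - 1) - (1 - c * s) ^ (α - 1))) s := by
    intro c s
    have e1 := (((hasDerivAt_id s).const_mul c).const_add 1).rpow_const (p := α) (Or.inr hα1.le)
    have e2 := (((hasDerivAt_id s).const_mul c).const_sub 1).rpow_const (p := α) (Or.inr hα1.le)
    refine (e1.add e2).congr_deriv ?_
    simp only [id]; ring
  have hφ : ∀ s : ℝ, HasDerivAt (fun s : ℝ => x ^ 2 * ((1 + 1 * s) ^ α + (1 - 1 * s) ^ α)
      - ((1 + x * s) ^ α + (1 - x * s) ^ α))
      (α * x * (x * ((1 + s) ^ (α - 1) - (1 - s) ^ (α - 1))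
        - ((1 + x * s) ^ (α - 1) - (1 - x * s) ^ (α - 1)))) s := by
    intro s
    refine (((hg 1 s).const_mul (x ^ 2)).sub (hg x s)).congr_deriv ?_
    simp only [one_mul]; ring
  have hm : MonotoneOn (fun s : ℝ => x ^ 2 * ((1 + 1 * s) ^ α + (1 - 1 * s) ^ α)
      - ((1 + x * s) ^ α + (1 - x * s) ^ α)) (Icc 0 1) := by
    refine monotoneOn_of_deriv_nonneg (convex_Icc 0 1)
      (fun s hs => (hφ s).continuousAt.continuousWithinAt)
      (fun s hs => (hφ s).differentiableAt.differentiableWithinAt) ?_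
    rw [interior_Icc]
    intro s hs
    rw [(hφ s).deriv]
    refine mul_nonneg (mul_nonneg (by linarith) hx0) ?_
    have := rpow_sub_rpow_le_mul (β := α - 1) (by linarith) (by linarith) hx0 hx1 hs.1.le hs.2
    linarith
  have h := hm (left_mem_Icc.2 zero_le_one) (right_mem_Icc.2 zero_le_one) zero_le_one
  simp only [mul_zero, add_zero, sub_zero, Real.one_rpow, mul_one, sub_self] at h
  rw [Real.zero_rpow (by linarith)] at h
  norm_num at h
  linarith

theorem one_add_rpow_add_one_sub_rpow_le {α x : ℝ} (hα1 : 1 < α) (hα2 : α < 2) (hx : |x| ≤ 1) :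
    (1 + x) ^ α + (1 - x) ^ α ≤ 2 + (2 ^ α - 2) * x ^ 2 := by
  rcases le_total 0 x with h | h
  · exact one_add_rpow_add_one_sub_rpow_le_of_nonneg hα1 hα2 h (abs_le.1 hx).2
  · have := one_add_rpow_add_one_sub_rpow_le_of_nonneg hα1 hα2 (x := -x) (by linarith)
      (by linarith [(abs_le.1 hx).1])
    simp only [sub_neg_eq_add, even_two.neg_pow] at this
    rw [← sub_eq_add_neg] at this
    linarith

end RealAnalysis

/-! ### The beta constant as a renormalised integral, and bounds on a single ray -/

noncomputable section BetaLimit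

open Filter Topology

/-- The truncated integral `∫_1^V (v² - 1)^p dv`. -/
def truncInt (p V : ℝ) : ℝ := ∫ v in (1 : ℝ)..V, (v ^ 2 - 1) ^ p

theorem continuous_sq_sub_one_rpow {p : ℝ} (hp : 0 ≤ p) :
    Continuous fun v : ℝ => (v ^ 2 - 1) ^ p :=
  (by fun_prop : Continuous fun v : ℝ => v ^ 2 - 1).rpow_const fun _ => Or.inr hp

theorem truncInt_nonneg {p V : ℝ} (hV : 1 ≤ V) : 0 ≤ truncInt p V :=
  intervalIntegral.integral_nonneg hV fun v hv => Real.rpow_nonneg (by nlinarith [hv.1]) _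

/-- Integrate the derivative of `(v²-1)^(p+1)/v`. This trades the divergent `truncInt` for an
explicit boundary term and an integral that converges as `V → ∞` when `p < 1/2`, that is, when `α <
2`. -/
theorem truncInt_add_integral {p V : ℝ} (hp : 0 < p) (hV : 1 ≤ V) :
    (2 * p + 1) * truncInt p V + ∫ v in (1 : ℝ)..V, (v ^ 2 - 1) ^ p * v⁻¹ ^ 2 =
      (V ^ 2 - 1) ^ (p + 1) / V := by
  have hc := continuous_sq_sub_one_rpow hp.le
  have hpos : ∀ v ∈ uIcc 1 V, 0 < v := fun v hv => by
    rw [uIcc_of_le hV] at hv; linarith [hv.1]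
  have hi2 : IntervalIntegrable (fun v : ℝ => (v ^ 2 - 1) ^ p * v⁻¹ ^ 2) volume 1 V := by
    refine ContinuousOn.intervalIntegrable (hc.continuousOn.mul ?_)
    exact (continuousOn_id.inv₀ fun v hv => (hpos v hv).ne').pow 2
  have hd : ∀ v ∈ uIcc 1 V, HasDerivAt (fun v : ℝ => (v ^ 2 - 1) ^ (p + 1) * v⁻¹)
      ((2 * p + 1) * (v ^ 2 - 1) ^ p + (v ^ 2 - 1) ^ p * v⁻¹ ^ 2) v := by
    intro v hv
    have hv0 := hpos v hv
    have hv1 : 1 ≤ v := by rw [uIcc_of_le hV] at hv; exact hv.1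
    have e1 := (((hasDerivAt_pow 2 v).sub_const 1).rpow_const (p := p + 1) (Or.inr (by linarith)))
    refine (e1.mul (hasDerivAt_inv hv0.ne')).congr_deriv ?_
    have : (v ^ 2 - 1) ^ (p + 1) = (v ^ 2 - 1) ^ p * (v ^ 2 - 1) := by
      rw [Real.rpow_add_one' (by nlinarith) (by linarith)]
    simp only [this, add_sub_cancel_right]
    field_simp
    push_cast
    ring
  have := intervalIntegral.integral_eq_sub_of_hasDerivAt hd
    (((hc.intervalIntegrable _ _).const_mul _).add hi2)
  rw [intervalIntegral.integral_add ((hc.intervalIntegrable _ _).const_mul _) hi2,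
    intervalIntegral.integral_const_mul] at this
  rw [truncInt, this]
  simp [Real.zero_rpow (by linarith : p + 1 ≠ 0), div_eq_mul_inv]

/-- Substitute `t = 1 - v⁻²`. The powers of `v⁻²` multiply to `v`, which cancels one factor of the
Jacobian `2v⁻³`. -/
theorem integral_eq_half_incomplete_beta {p V : ℝ} (hp : 0 < p) (hV : 1 ≤ V) :
    ∫ v in (1 : ℝ)..V, (v ^ 2 - 1) ^ p * v⁻¹ ^ 2 =
      (1 / 2) * ∫ t in (0 : ℝ)..1 - V⁻¹ ^ 2, t ^ p * (1 - t) ^ (-(p + 1 / 2)) := by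
  have hpos : ∀ v ∈ uIcc 1 V, 0 < v := fun v hv => by
    rw [uIcc_of_le hV] at hv; linarith [hv.1]
  have hsub := intervalIntegral.integral_comp_mul_deriv'' (a := 1) (b := V)
    (f := fun v : ℝ => 1 - v⁻¹ ^ 2) (f' := fun v => 2 * v⁻¹ ^ 3)
    (g := fun t : ℝ => t ^ p * (1 - t) ^ (-(p + 1 / 2))) ?_ ?_ ?_ ?_
  · simp only [inv_one, one_pow, sub_self] at hsub
    rw [← hsub, ← intervalIntegral.integral_const_mul]
    refine intervalIntegral.integral_congr fun v hv => ?_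
    have hv0 := hpos v hv
    have hv1 : 1 ≤ v := by rw [uIcc_of_le hV] at hv; exact hv.1
    have e1 : (1 : ℝ) - v⁻¹ ^ 2 = (v ^ 2 - 1) * v⁻¹ ^ 2 := by field_simp
    have e2 : (v⁻¹ ^ 2 : ℝ) ^ p * (v⁻¹ ^ 2) ^ (-(p + 1 / 2)) = v := by
      rw [← Real.rpow_add (by positivity), ← Real.rpow_natCast, ← Real.rpow_mul (by positivity)]
      rw [show ((2 : ℕ) : ℝ) * (p + -(p + 1 / 2)) = -1 by push_cast; ring, Real.rpow_neg_one, inv_inv]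
    simp only [Function.comp, sub_sub_cancel]
    rw [e1, Real.mul_rpow (by nlinarith) (by positivity)]
    calc (v ^ 2 - 1) ^ p * v⁻¹ ^ 2 = (v ^ 2 - 1) ^ p * (v * v⁻¹ ^ 3) := by field_simp
      _ = (v ^ 2 - 1) ^ p * (((v⁻¹ ^ 2 : ℝ) ^ p * (v⁻¹ ^ 2) ^ (-(p + 1 / 2))) * v⁻¹ ^ 3) := by
        rw [e2]
      _ = _ := by ring
  · exact continuousOn_const.sub ((continuousOn_id.inv₀ fun v hv => (hpos v hv).ne').pow 2)
  · intro v hv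
    have hv0 : 0 < v := by
      rw [min_eq_left hV] at hv; linarith [hv.1]
    refine (((hasDerivAt_inv hv0.ne').pow 2).const_sub 1).hasDerivWithinAt.congr_deriv ?_
    norm_num
    field_simp
  · exact continuousOn_const.mul ((continuousOn_id.inv₀ fun v hv => (hpos v hv).ne').pow 3)
  · rintro _ ⟨v, hv, rfl⟩
    have hv0 := hpos v hv
    refine ContinuousAt.continuousWithinAt (ContinuousAt.mul ?_ ?_)
    · exact Real.continuousAt_rpow_const _ _ (Or.inr hp.le)
    · refine ContinuousAt.rpow_const (by fun_prop) (Or.inl ?_)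
      simp only [sub_sub_cancel]
      positivity

theorem beta_eq_integral {a b : ℝ} (ha : 0 < a) (hb : 0 < b) :
    IntervalIntegrable (fun t : ℝ => t ^ (a - 1) * (1 - t) ^ (b - 1)) volume 0 1 ∧
      ProbabilityTheory.beta a b = ∫ t in (0 : ℝ)..1, t ^ (a - 1) * (1 - t) ^ (b - 1) := by
  have hc := Complex.betaIntegral_convergent (u := a) (v := b) (by simpa) (by simpa)
  have hre : ∀ x ∈ Ioc (0 : ℝ) 1, ((x : ℂ) ^ ((a : ℂ) - 1) * (1 - (x : ℂ)) ^ ((b : ℂ) - 1)).re =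
      x ^ (a - 1) * (1 - x) ^ (b - 1) := by
    intro x hx
    norm_cast
    rw [← Complex.ofReal_cpow hx.1.le, ← Complex.ofReal_cpow (by linarith [hx.2]),
      Complex.re_mul_ofReal, Complex.ofReal_re]
  rw [intervalIntegrable_iff_integrableOn_Ioc_of_le zero_le_one] at hc
  constructor
  · rw [intervalIntegrable_iff_integrableOn_Ioc_of_le zero_le_one]
    exact (integrableOn_congr_fun hre measurableSet_Ioc).1 hc.re
  · rw [ProbabilityTheory.beta_eq_betaIntegralReal a b ha hb, Complex.betaIntegral,
      intervalIntegral.integral_of_le zero_le_one, intervalIntegral.integral_of_le zero_le_one,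
      ← RCLike.re_to_complex, ← integral_re hc]
    exact setIntegral_congr_fun measurableSet_Ioc hre

theorem tendsto_incomplete_beta {a b : ℝ} (ha : 0 < a) (hb : 0 < b) :
    Tendsto (fun V : ℝ => ∫ t in (0 : ℝ)..1 - V⁻¹ ^ 2, t ^ (a - 1) * (1 - t) ^ (b - 1)) atTop
      (𝓝 (ProbabilityTheory.beta a b)) := by
  obtain ⟨hi, he⟩ := beta_eq_integral ha hb
  rw [he]
  have hc := intervalIntegral.continuousOn_primitive_interval' hi left_mem_uIcc
  rw [uIcc_of_le zero_le_one] at hc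
  have h1 := hc 1 (right_mem_Icc.2 zero_le_one)
  refine h1.tendsto.comp (tendsto_nhdsWithin_iff.2 ⟨?_, ?_⟩)
  · have := ((tendsto_inv_atTop_zero (𝕜 := ℝ)).pow 2).const_sub 1
    simpa using this
  · filter_upwards [eventually_ge_atTop 1] with V hV
    have : V⁻¹ ≤ 1 := inv_le_one_of_one_le₀ hV
    have h0 : 0 ≤ V⁻¹ := by positivity
    constructor
    · nlinarith
    · nlinarith

/-- The difference is `V^α (1 - (1 - V⁻²)^((α+1)/2))`, at most `((α+1)/2) V^(α-2)` by Bernoulli's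
inequality. -/
theorem tendsto_rpow_sub_sq_sub_one {α : ℝ} (hα1 : 1 < α) (hα2 : α < 2) :
    Tendsto (fun V : ℝ => V ^ α - (V ^ 2 - 1) ^ ((α - 1) / 2 + 1) / V) atTop (𝓝 0) := by
  have h : Tendsto (fun V : ℝ => ((α - 1) / 2 + 1) * V ^ (-(2 - α))) atTop (𝓝 0) := by
    simpa using (tendsto_rpow_neg_atTop (y := 2 - α) (by linarith)).const_mul ((α - 1) / 2 + 1)
  have key : ∀ V : ℝ, 1 ≤ V → (V ^ 2 - 1) ^ ((α - 1) / 2 + 1) / V =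
      V ^ α * (1 + -(V⁻¹ ^ 2)) ^ ((α - 1) / 2 + 1) := by
    intro V hV
    have hV0 : 0 < V := by linarith
    have e1 : V ^ 2 - 1 = V ^ 2 * (1 + -(V⁻¹ ^ 2)) := by field_simp; ring
    have e2 : (0 : ℝ) ≤ 1 + -(V⁻¹ ^ 2) := by
      have : V⁻¹ ≤ 1 := inv_le_one_of_one_le₀ hV
      have h0 : 0 ≤ V⁻¹ := by positivity
      nlinarith
    rw [e1, Real.mul_rpow (by positivity) e2, ← Real.rpow_natCast V 2, ← Real.rpow_mul hV0.le,
      show ((2 : ℕ) : ℝ) * ((α - 1) / 2 + 1) = α + 1 by push_cast; ring, Real.rpow_add_one hV0.ne']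
    field_simp
  refine squeeze_zero' ?_ ?_ h
  · filter_upwards [eventually_ge_atTop 1] with V hV
    have h0 : 0 ≤ V⁻¹ := by positivity
    have : V⁻¹ ≤ 1 := inv_le_one_of_one_le₀ hV
    rw [key V hV]
    have h1 : (1 + -(V⁻¹ ^ 2)) ^ ((α - 1) / 2 + 1) ≤ 1 :=
      Real.rpow_le_one (by nlinarith) (by nlinarith) (by linarith)
    nlinarith [Real.rpow_nonneg (by linarith : 0 ≤ V) α]
  · filter_upwards [eventually_ge_atTop 1] with V hV
    have hV0 : 0 < V := by linarith
    have h0 : 0 ≤ V⁻¹ := by positivity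
    have : V⁻¹ ≤ 1 := inv_le_one_of_one_le₀ hV
    rw [key V hV]
    have h1 := one_add_mul_self_le_rpow_one_add (s := -(V⁻¹ ^ 2)) (by nlinarith)
      (p := (α - 1) / 2 + 1) (by linarith)
    have h2 : V ^ (-(2 - α)) = V ^ α * V⁻¹ ^ 2 := by
      rw [show -(2 - α) = α - (2 : ℕ) by push_cast; ring, Real.rpow_sub_natCast hV0.ne', inv_pow,
        div_eq_mul_inv]
    rw [h2]
    nlinarith [mul_le_mul_of_nonneg_left h1 (Real.rpow_nonneg hV0.le α)]

/-- The constant `B((1+α)/2, (2-α)/2)` is the renormalised integral of `(v² - 1)^((α-1)/2)`. -/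
theorem tendsto_two_rpow_sub_truncInt {α : ℝ} (hα1 : 1 < α) (hα2 : α < 2) :
    Tendsto (fun V : ℝ => 2 * V ^ α - 2 * α * truncInt ((α - 1) / 2) V) atTop
      (𝓝 (ProbabilityTheory.beta ((1 + α) / 2) ((2 - α) / 2))) := by
  have h1 := (tendsto_rpow_sub_sq_sub_one hα1 hα2).const_mul 2
  have h2 := tendsto_incomplete_beta (a := (1 + α) / 2) (b := (2 - α) / 2) (by linarith)
    (by linarith)
  have h3 := h1.add h2
  rw [mul_zero, zero_add] at h3
  refine h3.congr' ?_
  filter_upwards [eventually_ge_atTop 1] with V hV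
  have e1 := truncInt_add_integral (p := (α - 1) / 2) (V := V) (by linarith) hV
  rw [integral_eq_half_incomplete_beta (by linarith) hV] at e1
  rw [show (1 + α) / 2 - 1 = (α - 1) / 2 by ring,
    show (2 - α) / 2 - 1 = -((α - 1) / 2 + 1 / 2) by ring, ← e1]
  ring

/-- The integral of `t^(α-1)` over `A < t ≤ (V (A + B) + A - B) / 2`. -/
def rayMass (α V A B : ℝ) : ℝ := (((V * (A + B) + A - B) / 2) ^ α - A ^ α) / α

/-- The integral of `((t - A) (t + B))^((α-1)/2)` over `A < t ≤ (V (A + B) + A - B) / 2`. -/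
def rayGround (α V A B : ℝ) : ℝ := ((A + B) / 2) ^ α * truncInt ((α - 1) / 2) V

/-- The one-dimensional sharp constant. -/
def lineKappa (α : ℝ) : ℝ :=
  (ProbabilityTheory.beta ((1 + α) / 2) ((2 - α) / 2) - (2 : ℝ) ^ α) / (α * (2 : ℝ) ^ α)

/-- The one-dimensional remainder constant. -/
def lineLambda (α : ℝ) : ℝ := (4 - (2 : ℝ) ^ (3 - α)) / α

/-- Opposite directions exchange `A` and `B`, so only this symmetrised mass matters after
integration over the sphere. The coordinates `q = A + B` and `x = (A - B)/q` separate its scale from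
its shape. -/
theorem rayMass_add_swap {α V q x : ℝ} (hV : 1 ≤ V) (hq : 0 ≤ q) (hx : |x| ≤ 1) :
    rayMass α V (q / 2 * (1 + x)) (q / 2 * (1 - x)) +
        rayMass α V (q / 2 * (1 - x)) (q / 2 * (1 + x)) =
      (q / 2) ^ α * (((V + x) ^ α + (V - x) ^ α - ((1 + x) ^ α + (1 - x) ^ α)) / α) := by
  obtain ⟨h1, h2⟩ := abs_le.1 hx
  unfold rayMass
  rw [show (V * (q / 2 * (1 + x) + q / 2 * (1 - x)) + q / 2 * (1 + x) - q / 2 * (1 - x)) / 2 =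
      q / 2 * (V + x) by ring,
    show (V * (q / 2 * (1 - x) + q / 2 * (1 + x)) + q / 2 * (1 - x) - q / 2 * (1 + x)) / 2 =
      q / 2 * (V - x) by ring,
    Real.mul_rpow (by linarith) (by linarith), Real.mul_rpow (by linarith) (by linarith),
    Real.mul_rpow (by linarith) (by linarith), Real.mul_rpow (by linarith) (by linarith)]
  ring

/-- By the arithmetic-geometric mean inequality `2(v²-1)^((α-1)/2) ≤ (v+1)^(α-1) + (v-1)^(α-1)`.
Integrating over `[1,V]` gives the bound up to the second difference of `V^α`, which tends to `0`.
-/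
theorem two_rpow_le_beta {α : ℝ} (hα1 : 1 < α) (hα2 : α < 2) :
    (2 : ℝ) ^ α ≤ ProbabilityTheory.beta ((1 + α) / 2) ((2 - α) / 2) := by
  have h1 := (tendsto_two_rpow_sub_truncInt hα1 hα2).add (tendsto_rpow_second_difference hα1 hα2)
  rw [add_zero] at h1
  refine ge_of_tendsto h1 ?_
  filter_upwards [eventually_ge_atTop 1] with V hV
  have hint : ∀ c : ℝ, IntervalIntegrable (fun v : ℝ => (v + c) ^ (α - 1)) volume 1 V := fun c =>
    ((continuous_id.add continuous_const).rpow_const fun _ =>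
      Or.inr (by linarith)).intervalIntegrable _ _
  have h2 : 2 * truncInt ((α - 1) / 2) V ≤
      ∫ v in (1 : ℝ)..V, ((v + 1) ^ (α - 1) + (v + -1) ^ (α - 1)) := by
    rw [truncInt, ← intervalIntegral.integral_const_mul]
    refine intervalIntegral.integral_mono_on hV
      (((continuous_sq_sub_one_rpow (by linarith)).intervalIntegrable _ _).const_mul _)
      ((hint 1).add (hint (-1))) fun v hv => ?_
    have e1 : (v ^ 2 - 1) ^ ((α - 1) / 2) = (v + 1) ^ ((α - 1) / 2) * (v + -1) ^ ((α - 1) / 2) := by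
      rw [← Real.mul_rpow (by linarith [hv.1]) (by linarith [hv.1])]
      ring_nf
    have e2 : ∀ y : ℝ, 0 ≤ y → y ^ (α - 1) = (y ^ ((α - 1) / 2)) ^ 2 := by
      intro y hy
      rw [← Real.rpow_natCast, ← Real.rpow_mul hy]
      congr 1; push_cast; ring
    rw [e1, e2 _ (by linarith [hv.1]), e2 _ (by linarith [hv.1])]
    nlinarith [sq_nonneg ((v + 1) ^ ((α - 1) / 2) - (v + -1) ^ ((α - 1) / 2))]
  have h3 : ∀ c : ℝ, -1 ≤ c → ∫ v in (1 : ℝ)..V, (v + c) ^ (α - 1) =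
      ((V + c) ^ α - (1 + c) ^ α) / α := by
    intro c hc
    rw [intervalIntegral.integral_comp_add_right (fun v => v ^ (α - 1)) c,
      integral_rpow (Or.inl (by linarith)), sub_add_cancel]
  rw [intervalIntegral.integral_add (hint 1) (hint (-1)), h3 1 (by norm_num), h3 (-1) le_rfl,
    add_neg_cancel, Real.zero_rpow (by linarith), ← add_div, le_div_iff₀ (by linarith)] at h2
  norm_num at h2
  rw [← sub_eq_add_neg] at h2
  linarith

theorem lineKappa_nonneg {α : ℝ} (hα1 : 1 < α) (hα2 : α < 2) : 0 ≤ lineKappa α := by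
  have := two_rpow_le_beta hα1 hα2
  exact div_nonneg (by linarith) (by positivity)

theorem two_lt_two_rpow {α : ℝ} (hα1 : 1 < α) : (2 : ℝ) < 2 ^ α := by
  simpa using Real.rpow_lt_rpow_of_exponent_lt (one_lt_two) hα1

theorem lineLambda_eq {α : ℝ} : lineLambda α = 4 * (2 ^ α - 2) / (α * 2 ^ α) := by
  unfold lineLambda
  rw [Real.rpow_sub two_pos]
  have : (2 : ℝ) ^ α ≠ 0 := by positivity
  norm_num
  field_simp
  ring

theorem lineLambda_nonneg {α : ℝ} (hα1 : 1 < α) : 0 ≤ lineLambda α := by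
  rw [lineLambda_eq]
  have := two_lt_two_rpow hα1
  exact div_nonneg (by linarith) (by positivity)

/-- The one-dimensional core of the inequality, with `1/D` standing for `1/diam Ω`. The beta
constant is only reached as `V → ∞`, hence the slack `δ`; it is proportional to `(A + B)^α`, so one
`V` serves all `A`, `B`, `D`. -/
theorem ray_lower_bound {α : ℝ} (hα1 : 1 < α) (hα2 : α < 2) {δ : ℝ} (hδ : 0 < δ) :
    ∃ V : ℝ, 1 ≤ V ∧ ∀ D A B : ℝ, 0 < A → 0 < B → 1 / A + 1 / B ≤ D →
      2 * rayGround α V A B + (lineKappa α * (A + B) ^ α +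
          lineLambda α * (1 / D) * (A + B) ^ (α - 1)) ≤
        rayMass α V A B + rayMass α V B A + δ * (A + B) ^ α := by
  have h2p : (0 : ℝ) < 2 ^ α := by positivity
  have hα0 : 0 < α := by linarith
  -- The slack is scaled by `α * 2 ^ α`, the denominator of `lineKappa`, so that it ends up as `δ *
  -- (A + B) ^ α`.
  have hev := (tendsto_two_rpow_sub_truncInt hα1 hα2).eventually
    (eventually_ge_nhds (sub_lt_self _ (show 0 < δ * (α * 2 ^ α) by positivity)))
  obtain ⟨V, hV1, hV⟩ := ((eventually_ge_atTop (1 : ℝ)).and hev).exists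
  refine ⟨V, hV1, fun D A B hA hB hD => ?_⟩
  set q := A + B with hq
  have hq0 : 0 < q := by positivity
  set x := (A - B) / q with hx
  have hxq : q * x = A - B := by rw [hx]; field_simp
  have hx1 : |x| ≤ 1 := by
    rw [hx, abs_div, abs_of_pos hq0, div_le_one hq0, abs_le]
    constructor <;> linarith
  have hA' : A = q / 2 * (1 + x) := by linarith
  have hB' : B = q / 2 * (1 - x) := by linarith
  have hsum := rayMass_add_swap (α := α) hV1 hq0.le hx1
  rw [← hA', ← hB'] at hsum
  rw [hsum]
  have i1 := two_mul_rpow_le_add_sub (α := α) hα1.le (hx1.trans hV1)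
  have i2 := one_add_rpow_add_one_sub_rpow_le hα1 hα2 hx1
  have hqa : (q / 2) ^ α = q ^ α / 2 ^ α := Real.div_rpow hq0.le two_pos.le _
  have hqm : q ^ (α - 1) = q ^ α / q := Real.rpow_sub_one hq0.ne' _
  have hD0 : 0 < D := lt_of_lt_of_le (by positivity) hD
  -- Here `1 - x² = 4AB/q²`, and `q/(AB) = 1/A + 1/B ≤ D`.
  have i3 : 4 * (1 / D) / q ≤ 1 - x ^ 2 := by
    have e : 1 - x ^ 2 = 4 * A * B / q ^ 2 := by
      rw [hA', hB']; field_simp; ring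
    rw [e]
    have : q / (A * B) ≤ D := by
      refine le_trans (le_of_eq ?_) hD
      rw [hq]; field_simp; ring
    rw [div_le_iff₀ (by positivity)] at this
    rw [mul_one_div, div_div, div_le_div_iff₀ (by positivity) (by positivity)]
    nlinarith [mul_le_mul_of_nonneg_left this (show 0 ≤ 4 * q by positivity)]
  have hqp : 0 < q ^ α := by positivity
  have hs := two_lt_two_rpow hα1
  have key : 2 * α * truncInt ((α - 1) / 2) V +
      (ProbabilityTheory.beta ((1 + α) / 2) ((2 - α) / 2) - 2 ^ α) +
      (2 ^ α - 2) * (4 * (1 / D) / q) ≤ (V + x) ^ α + (V - x) ^ α - ((1 + x) ^ α + (1 - x) ^ α) +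
        δ * (α * 2 ^ α) := by
    have := mul_le_mul_of_nonneg_left i3 (show (0 : ℝ) ≤ 2 ^ α - 2 by linarith)
    linarith
  have key2 := mul_le_mul_of_nonneg_left key (show 0 ≤ q ^ α / (2 ^ α * α) by positivity)
  rw [rayGround, ← hq, hqa, lineLambda_eq, lineKappa, hqm]
  refine le_trans (le_of_eq ?_) (key2.trans (le_of_eq ?_))
  · field_simp
    ring
  · field_simp

/-- With one exit time infinite, `x = 1` and `(1+x)^α + (1-x)^α = 2^α` exactly. The only losses are
the second difference of `V^α` and the convergence to the beta value, and both vanish. -/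
theorem ray_upper_bound {α : ℝ} (hα1 : 1 < α) (hα2 : α < 2) {δ : ℝ} (hδ : 0 < δ) :
    ∀ᶠ V : ℝ in atTop, ∀ q : ℝ, 0 ≤ q →
      rayMass α V q 0 + rayMass α V 0 q ≤
        2 * rayGround α V q 0 + (lineKappa α + δ) * q ^ α := by
  have h2p : (0 : ℝ) < 2 ^ α := by positivity
  have hα0 : 0 < α := by linarith
  have h1 := (tendsto_two_rpow_sub_truncInt hα1 hα2).add (tendsto_rpow_second_difference hα1 hα2)
  rw [add_zero] at h1
  filter_upwards [eventually_ge_atTop (1 : ℝ), h1.eventually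
    (eventually_le_nhds (lt_add_of_pos_right _ (show 0 < δ * (α * 2 ^ α) by positivity)))]
    with V hV1 hV q hq
  have hsum := rayMass_add_swap (α := α) (x := 1) hV1 hq (by simp)
  have e : q / 2 * (1 + 1) = q := by ring
  rw [e, sub_self, mul_zero, Real.zero_rpow hα0.ne', add_zero] at hsum
  norm_num at hsum
  rw [hsum, rayGround, add_zero, lineKappa, Real.div_rpow hq two_pos.le]
  have hqp : 0 ≤ q ^ α := by positivity
  have key2 := mul_le_mul_of_nonneg_left hV (show 0 ≤ q ^ α / (2 ^ α * α) by positivity)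
  refine le_trans (le_of_eq ?_) ((add_le_add_left key2
    (q ^ α / (2 ^ α * α) * (2 * α * truncInt ((α - 1) / 2) V - 2 ^ α))).trans (le_of_eq ?_))
  · field_simp
    ring
  · field_simp
    ring

end BetaLimit

/-! ### Polar coordinates -/

section Polar

open Metric

variable {E : Type*} [NormedAddCommGroup E] [NormedSpace ℝ E] [MeasurableSpace E] [BorelSpace E]
  [FiniteDimensional ℝ E] [Nontrivial E]

/-- Polar coordinates for the lower integral. -/
theorem lintegral_eq_lintegral_sphere (μ : Measure E) [μ.IsAddHaarMeasure] {F : E → ℝ≥0∞}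
    (hF : Measurable F) :
    ∫⁻ y, F y ∂μ = ∫⁻ w : sphere (0 : E) 1, (∫⁻ r in Ioi (0 : ℝ),
      ENNReal.ofReal (r ^ (Module.finrank ℝ E - 1)) * F (r • w.1)) ∂μ.toSphere := by
  calc ∫⁻ y, F y ∂μ = ∫⁻ y : ({(0 : E)}ᶜ : Set E), F y ∂(μ.comap (↑)) := by
        rw [lintegral_subtype_comap (measurableSet_singleton _).compl, restrict_compl_singleton]
    _ = ∫⁻ x : sphere (0 : E) 1 × Ioi (0 : ℝ), F (x.2.1 • x.1.1)
          ∂μ.toSphere.prod (.volumeIoiPow (Module.finrank ℝ E - 1)) := by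
        rw [← μ.measurePreserving_homeomorphUnitSphereProd.lintegral_comp_emb
          (Homeomorph.measurableEmbedding _)]
        refine lintegral_congr fun y => ?_
        have : ‖y.1‖ ≠ 0 := norm_ne_zero_iff.2 y.2
        simp [smul_smul, mul_inv_cancel₀ this]
    _ = ∫⁻ w : sphere (0 : E) 1, ∫⁻ r : Ioi (0 : ℝ), F (r.1 • w.1)
          ∂(.volumeIoiPow (Module.finrank ℝ E - 1)) ∂μ.toSphere :=
        lintegral_prod _ (by fun_prop)
    _ = _ := by
        refine lintegral_congr fun w => ?_
        rw [Measure.volumeIoiPow, lintegral_withDensity_eq_lintegral_mul _ (by fun_prop)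
          (by fun_prop)]
        exact lintegral_subtype_comap measurableSet_Ioi
          (fun r : ℝ => ENNReal.ofReal (r ^ (Module.finrank ℝ E - 1)) * F (r • w.1))

/-- Extending `G` from the sphere to the unit ball, constant along rays, expresses spherical
integrals by Lebesgue integrals. Invariance of Lebesgue measure then passes to the sphere. -/
theorem lintegral_ball_radial (μ : Measure E) [μ.IsAddHaarMeasure] {G : E → ℝ≥0∞}
    (hG : Measurable G) :
    ∫⁻ y, (Iio (1 : ℝ)).indicator 1 ‖y‖ * G (‖y‖⁻¹ • y) ∂μ =
      (∫⁻ r in Ioi (0 : ℝ), ENNReal.ofReal (r ^ (Module.finrank ℝ E - 1)) *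
        (Iio (1 : ℝ)).indicator 1 r) * ∫⁻ w : sphere (0 : E) 1, G w ∂μ.toSphere := by
  have hm : Measurable ((Iio (1 : ℝ)).indicator (1 : ℝ → ℝ≥0∞)) :=
    measurable_one.indicator measurableSet_Iio
  rw [lintegral_eq_lintegral_sphere μ (by fun_prop),
    ← lintegral_const_mul _ (by fun_prop : Measurable fun w : sphere (0 : E) 1 => G w)]
  refine lintegral_congr fun w => ?_
  rw [← lintegral_mul_const _ (by fun_prop)]
  refine setLIntegral_congr_fun measurableSet_Ioi fun r (hr : 0 < r) => ?_
  have h1 : ‖r • w.1‖ = r := by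
    rw [norm_smul, Real.norm_of_nonneg hr.le, norm_eq_of_mem_sphere, mul_one]
  simp only [h1, smul_smul, inv_mul_cancel₀ hr.ne', one_smul]
  ring

theorem radial_mass_ne_zero (k : ℕ) : ∫⁻ r in Ioi (0 : ℝ), ENNReal.ofReal (r ^ k) *
    (Iio (1 : ℝ)).indicator 1 r ≠ 0 := by
  have hm : Measurable ((Iio (1 : ℝ)).indicator (1 : ℝ → ℝ≥0∞)) :=
    measurable_one.indicator measurableSet_Iio
  rw [← pos_iff_ne_zero, setLIntegral_pos_iff (by fun_prop)]
  refine lt_of_lt_of_le ?_ (measure_mono (show Ioo (0 : ℝ) 1 ⊆ _ from fun r hr => ⟨?_, hr.1⟩))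
  · simp
  · have : 0 < r ^ k := pow_pos hr.1 k
    simp [hr.2, this]

theorem radial_mass_ne_top (k : ℕ) : ∫⁻ r in Ioi (0 : ℝ), ENNReal.ofReal (r ^ k) *
    (Iio (1 : ℝ)).indicator 1 r ≠ ∞ := by
  refine ne_top_of_le_ne_top (b := volume (Ioo (0 : ℝ) 1)) (by simp) ?_
  rw [← lintegral_indicator_one measurableSet_Ioo, ← lintegral_indicator measurableSet_Ioi]
  refine lintegral_mono fun r => ?_
  by_cases h0 : 0 < r
  · by_cases h1 : r < 1
    · simp [h0, h1, pow_le_one₀ h0.le h1.le]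
    · simp [h0, h1]
  · simp [h0]

end Polar

/-! ### Invariance of the surface measure under linear isometries -/

section SphereSymmetry

open Metric

variable {E : Type*} [NormedAddCommGroup E] [InnerProductSpace ℝ E] [MeasurableSpace E]
  [BorelSpace E] [FiniteDimensional ℝ E] [Nontrivial E]

theorem lintegral_sphere_isometry (Φ : E ≃ₗᵢ[ℝ] E) {G : E → ℝ≥0∞} (hG : Measurable G) :
    ∫⁻ w : sphere (0 : E) 1, G (Φ w) ∂(volume : Measure E).toSphere =
      ∫⁻ w : sphere (0 : E) 1, G w ∂(volume : Measure E).toSphere := by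
  have hm : Measurable ((Iio (1 : ℝ)).indicator (1 : ℝ → ℝ≥0∞)) :=
    measurable_one.indicator measurableSet_Iio
  have hΦ : Measurable Φ := Φ.continuous.measurable
  have h1 := lintegral_ball_radial (volume : Measure E) hG
  have h2 := lintegral_ball_radial (volume : Measure E) (hG.comp hΦ)
  rw [← Φ.measurePreserving.lintegral_comp (by fun_prop)] at h1
  simp only [LinearIsometryEquiv.norm_map, ← map_smul] at h1
  exact (ENNReal.mul_right_inj (radial_mass_ne_zero _) (radial_mass_ne_top _)).1 (h2.symm.trans h1)

theorem lintegral_sphere_neg {G : E → ℝ≥0∞} (hG : Measurable G) :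
    ∫⁻ w : sphere (0 : E) 1, G (-w.1) ∂(volume : Measure E).toSphere =
      ∫⁻ w : sphere (0 : E) 1, G w ∂(volume : Measure E).toSphere :=
  lintegral_sphere_isometry (LinearIsometryEquiv.neg ℝ) hG

end SphereSymmetry

/-! ### Moments of a coordinate on the sphere -/

section SphereMoment

open Metric

theorem exists_isometry_map_eq {F : Type*} [NormedAddCommGroup F] [InnerProductSpace ℝ F]
    [FiniteDimensional ℝ F] {v w : F} (h : ‖v‖ = ‖w‖) : ∃ Φ : F ≃ₗᵢ[ℝ] F, Φ v = w :=
  ⟨_, Submodule.reflection_sub h⟩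

variable {n : ℕ}

theorem lintegral_sphere_inner [NeZero n] {e : EuclideanSpace ℝ (Fin n)} (he : ‖e‖ = 1)
    (i : Fin n) (β : ℝ) :
    ∫⁻ w : sphere (0 : EuclideanSpace ℝ (Fin n)) 1, ENNReal.ofReal (|inner ℝ e w.1| ^ β)
        ∂(volume : Measure (EuclideanSpace ℝ (Fin n))).toSphere =
      ∫⁻ w : sphere (0 : EuclideanSpace ℝ (Fin n)) 1, ENNReal.ofReal (|w.1 i| ^ β)
        ∂(volume : Measure (EuclideanSpace ℝ (Fin n))).toSphere := by
  obtain ⟨Φ, hΦ⟩ := exists_isometry_map_eq (v := EuclideanSpace.single i (1 : ℝ)) (w := e)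
    (by simp [he])
  rw [← lintegral_sphere_isometry Φ (G := fun w => ENNReal.ofReal (|inner ℝ e w| ^ β))
    (by fun_prop)]
  refine lintegral_congr fun w => ?_
  rw [← hΦ, LinearIsometryEquiv.inner_map_map, EuclideanSpace.inner_single_left]
  simp

theorem integral_abs_rpow_mul_exp_neg_sq {β : ℝ} (hβ : 0 < β) :
    Integrable (fun t : ℝ => |t| ^ β * Real.exp (-t ^ 2)) ∧
      ∫ t : ℝ, |t| ^ β * Real.exp (-t ^ 2) = Real.Gamma ((β + 1) / 2) := by
  have h1 := integrableOn_rpow_mul_exp_neg_rpow (p := 2) (s := β) (by linarith) two_pos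
  have h2 := integral_comp_abs (f := fun t : ℝ => t ^ β * Real.exp (-t ^ 2))
  simp only [sq_abs] at h2
  constructor
  · have h3 : IntegrableOn (fun t : ℝ => |t| ^ β * Real.exp (-t ^ 2)) (Ioi 0) :=
      h1.congr_fun (fun t (ht : 0 < t) => by simp [abs_of_pos ht]) measurableSet_Ioi
    have h4 : IntegrableOn (fun t : ℝ => |t| ^ β * Real.exp (-t ^ 2)) (Iic 0) := by
      have := ((Measure.measurePreserving_neg (volume : Measure ℝ)).integrableOn_comp_preimage
        (Homeomorph.neg ℝ).measurableEmbedding).2 h3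
      rw [integrableOn_Iic_iff_integrableOn_Iio]
      simpa [Function.comp_def] using this
    rw [← integrableOn_univ, ← Iic_union_Ioi (a := (0 : ℝ))]
    exact h4.union h3
  · rw [h2]
    have h3 := integral_rpow_mul_exp_neg_rpow (p := 2) (q := β) two_pos (by linarith)
    simp only [Real.rpow_two] at h3
    rw [h3]; ring

theorem lintegral_abs_rpow_mul_exp_neg_norm_sq {β : ℝ} (hβ : 0 < β) (i : Fin n) :
    ∫⁻ y : EuclideanSpace ℝ (Fin n), ENNReal.ofReal (|y i| ^ β * Real.exp (-‖y‖ ^ 2)) =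
      ENNReal.ofReal (Real.pi ^ (((n : ℝ) - 1) / 2) * Real.Gamma ((β + 1) / 2)) := by
  obtain ⟨hi, he⟩ := integral_abs_rpow_mul_exp_neg_sq hβ
  have hg : Integrable (fun t : ℝ => Real.exp (-t ^ 2)) := by
    simpa using integrable_exp_neg_mul_sq one_pos
  have hge : ∫ t : ℝ, Real.exp (-t ^ 2) = Real.sqrt Real.pi := by
    simpa using integral_gaussian 1
  set f : Fin n → ℝ → ℝ := fun j t => (if j = i then |t| ^ β else 1) * Real.exp (-t ^ 2) with hf
  have hfi : ∀ j, Integrable (f j) := by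
    intro j
    by_cases h : j = i
    · simpa [hf, h] using hi
    · simpa [hf, h] using hg
  have hprod : ∀ x : Fin n → ℝ, ∏ j, f j (x j) = |x i| ^ β * Real.exp (-∑ j, x j ^ 2) := by
    intro x
    simp only [hf, Finset.prod_mul_distrib, ← Real.exp_sum, Finset.sum_neg_distrib]
    congr 1
    rw [Finset.prod_eq_single i (by intro j _ h; simp [h]) (by simp)]
    simp
  have hval : ∫ x : Fin n → ℝ, ∏ j, f j (x j) =
      Real.pi ^ (((n : ℝ) - 1) / 2) * Real.Gamma ((β + 1) / 2) := by
    rw [integral_fintype_prod_volume_eq_prod]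
    have e1 : ∀ j, ∫ t, f j t = if j = i then Real.Gamma ((β + 1) / 2) else Real.sqrt Real.pi := by
      intro j
      by_cases h : j = i
      · simpa [hf, h] using he
      · simpa [hf, h] using hge
    simp only [e1]
    rw [Finset.prod_ite, Finset.filter_eq' Finset.univ i]
    simp only [Finset.mem_univ, if_true, Finset.prod_const, Finset.card_singleton, pow_one]
    rw [Finset.filter_ne' Finset.univ i, Finset.card_erase_of_mem (Finset.mem_univ i),
      Finset.card_univ, Fintype.card_fin, mul_comm, Real.sqrt_eq_rpow, ← Real.rpow_natCast,
      ← Real.rpow_mul Real.pi_pos.le, Nat.cast_sub (Fin.pos i)]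
    congr 2
    push_cast; ring
  rw [← hval, ofReal_integral_eq_lintegral_ofReal]
  · rw [← (EuclideanSpace.volume_preserving_symm_measurableEquiv_toLp (Fin n)).lintegral_comp_emb
      (MeasurableEquiv.measurableEmbedding _)]
    refine lintegral_congr fun y => ?_
    rw [hprod, EuclideanSpace.norm_eq, Real.sq_sqrt (by positivity)]
    simp
  · exact Integrable.fintype_prod hfi
  · refine Filter.Eventually.of_forall fun x => ?_
    simp only [Pi.zero_apply, hprod]
    positivity

/-- The integral of `|y_i|^β exp(-|y|²)` is computed twice: as a product over coordinates, and in
polar coordinates, where the radial factor is `Γ((n+β)/2)/2`. The quotient is the moment. -/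
theorem lintegral_sphere_abs_rpow [NeZero n] {β : ℝ} (hβ : 0 < β) (i : Fin n) :
    ∫⁻ w : sphere (0 : EuclideanSpace ℝ (Fin n)) 1, ENNReal.ofReal (|w.1 i| ^ β)
        ∂(volume : Measure (EuclideanSpace ℝ (Fin n))).toSphere =
      ENNReal.ofReal (2 * Real.pi ^ (((n : ℝ) - 1) / 2) * Real.Gamma ((1 + β) / 2) /
        Real.Gamma (((n : ℝ) + β) / 2)) := by
  have hn : 1 ≤ n := Nat.one_le_iff_ne_zero.2 (NeZero.ne n)
  have hn' : (1 : ℝ) ≤ n := by exact_mod_cast hn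
  have h1 := lintegral_abs_rpow_mul_exp_neg_norm_sq hβ i
  rw [lintegral_eq_lintegral_sphere _ (by fun_prop), finrank_euclideanSpace_fin] at h1
  have hrad : ∫⁻ r in Ioi (0 : ℝ), ENNReal.ofReal (r ^ ((n : ℝ) - 1 + β) * Real.exp (-r ^ (2 : ℝ)))
      = ENNReal.ofReal (Real.Gamma (((n : ℝ) + β) / 2) / 2) := by
    rw [← ofReal_integral_eq_lintegral_ofReal
      (integrableOn_rpow_mul_exp_neg_rpow (by linarith) two_pos),
      integral_rpow_mul_exp_neg_rpow two_pos (by linarith)]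
    · congr 1
      rw [show (n : ℝ) - 1 + β + 1 = n + β by ring]; ring
    · filter_upwards [ae_restrict_mem measurableSet_Ioi] with r hr
      have : (0 : ℝ) < r := hr
      simp only [Pi.zero_apply]
      positivity
  have h2 : ∀ w : sphere (0 : EuclideanSpace ℝ (Fin n)) 1, ∫⁻ r in Ioi (0 : ℝ),
      ENNReal.ofReal (r ^ (n - 1)) *
        ENNReal.ofReal (|(r • w.1) i| ^ β * Real.exp (-‖r • w.1‖ ^ 2)) =
      ENNReal.ofReal (|w.1 i| ^ β) * ENNReal.ofReal (Real.Gamma (((n : ℝ) + β) / 2) / 2) := by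
    intro w
    rw [← hrad, ← lintegral_const_mul _ (by fun_prop)]
    refine setLIntegral_congr_fun measurableSet_Ioi fun r (hr : 0 < r) => ?_
    rw [← ENNReal.ofReal_mul (by positivity), ← ENNReal.ofReal_mul (by positivity)]
    congr 1
    rw [norm_smul, norm_eq_of_mem_sphere, Real.norm_of_nonneg hr.le, mul_one, PiLp.smul_apply,
      smul_eq_mul, abs_mul, abs_of_pos hr, Real.mul_rpow hr.le (abs_nonneg _), Real.rpow_add hr,
      Real.rpow_two, show (n : ℝ) - 1 = ((n - 1 : ℕ) : ℝ) by push_cast [Nat.cast_sub hn]; ring,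
      Real.rpow_natCast]
    ring
  simp only [h2] at h1
  have hG : 0 < Real.Gamma (((n : ℝ) + β) / 2) := Real.Gamma_pos_of_pos (by linarith)
  rw [lintegral_mul_const _ (by fun_prop)] at h1
  rw [ENNReal.eq_div_iff (by simpa using hG) ENNReal.ofReal_ne_top |>.2 ((mul_comm _ _).trans h1),
    ← ENNReal.ofReal_div_of_pos (by positivity)]
  congr 1
  rw [show (1 + β) / 2 = (β + 1) / 2 by ring]
  field_simp

end SphereMoment

/-! ### Integrals along a ray in the inverse radius -/

noncomputable section Ray

theorem lintegral_Ioi_comp_inv (F : ℝ → ℝ≥0∞) :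
    ∫⁻ r in Ioi (0 : ℝ), F r = ∫⁻ t in Ioi (0 : ℝ), ENNReal.ofReal ((t ^ 2)⁻¹) * F t⁻¹ := by
  have himg : (fun t : ℝ => t⁻¹) '' Ioi 0 = Ioi 0 := by
    ext r
    constructor
    · rintro ⟨t, ht, rfl⟩
      exact mem_Ioi.2 (inv_pos.2 (mem_Ioi.1 ht))
    · exact fun hr => ⟨r⁻¹, mem_Ioi.2 (inv_pos.2 (mem_Ioi.1 hr)), inv_inv r⟩
  have h := lintegral_image_eq_lintegral_abs_deriv_mul (s := Ioi (0 : ℝ)) (f := fun t : ℝ => t⁻¹)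
    (f' := fun t => -(t ^ 2)⁻¹) measurableSet_Ioi
    (fun t ht => (hasDerivAt_inv (ne_of_gt ht)).hasDerivWithinAt)
    (inv_injective.injOn) F
  rw [himg] at h
  rw [h]
  refine lintegral_congr fun t => ?_
  rw [abs_neg, abs_of_nonneg (by positivity)]

/-- The radii `r` selected by the symmetric truncation at level `V` on a ray whose exit times
forwards and backwards are `1 / A` and `1 / B`. -/
def raySet (V A B : ℝ) : Set ℝ := {r | r * A < 1 ∧ 2 + r * B - r * A ≤ V * (r * A + r * B)}

theorem mem_raySet_inv {V A B t : ℝ} (ht : 0 < t) :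
    t⁻¹ ∈ raySet V A B ↔ t ∈ Ioc A ((V * (A + B) + A - B) / 2) := by
  unfold raySet
  rw [mem_ofPred_eq, mem_Ioc, ← mul_lt_mul_iff_of_pos_left ht,
    ← mul_le_mul_iff_of_pos_left ht (a := t) (b := 2 + t⁻¹ * B - t⁻¹ * A)]
  have e1 : t * (t⁻¹ * A) = A := by field_simp
  have e2 : t * (2 + t⁻¹ * B - t⁻¹ * A) = 2 * t + B - A := by field_simp
  have e3 : t * (V * (t⁻¹ * A + t⁻¹ * B)) = V * (A + B) := by field_simp
  rw [e1, e2, e3, mul_one]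
  constructor <;> rintro ⟨h1, h2⟩ <;> constructor <;> linarith

/-- With `t = 1/r` the kernel `r^(-1-α) dr` becomes `t^(α-1) dt`, and the truncation becomes an
interval starting at `A`. -/
theorem lintegral_raySet {α V A B : ℝ} (hA : 0 ≤ A) (h : ℝ → ℝ≥0∞) :
    ∫⁻ r in Ioi (0 : ℝ), ENNReal.ofReal (r ^ (-1 - α)) * (raySet V A B).indicator h r =
      ∫⁻ t in Ioc A ((V * (A + B) + A - B) / 2), ENNReal.ofReal (t ^ (α - 1)) * h t⁻¹ := by
  rw [lintegral_Ioi_comp_inv, ← lintegral_indicator measurableSet_Ioi,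
    ← lintegral_indicator measurableSet_Ioc]
  refine lintegral_congr fun t => ?_
  by_cases ht : 0 < t
  · rw [indicator_of_mem (show t ∈ Ioi 0 from ht)]
    by_cases hm : t ∈ Ioc A ((V * (A + B) + A - B) / 2)
    · rw [indicator_of_mem hm, indicator_of_mem ((mem_raySet_inv ht).2 hm), ← mul_assoc,
        ← ENNReal.ofReal_mul (by positivity)]
      congr 2
      rw [Real.inv_rpow ht.le, ← Real.rpow_neg ht.le, ← Real.rpow_natCast, ← Real.rpow_neg ht.le,
        ← Real.rpow_add ht]
      congr 1
      push_cast; ring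
    · rw [indicator_of_notMem hm, indicator_of_notMem (fun h => hm ((mem_raySet_inv ht).1 h))]
      simp
  · rw [indicator_of_notMem (show t ∉ Ioi 0 from ht),
      indicator_of_notMem (fun hm => ht (lt_of_le_of_lt hA hm.1))]

theorem le_truncation {V A B : ℝ} (hV : 1 ≤ V) (hA : 0 ≤ A) (hB : 0 ≤ B) :
    A ≤ (V * (A + B) + A - B) / 2 := by
  nlinarith [mul_le_mul_of_nonneg_right hV (add_nonneg hA hB)]

theorem ofReal_intervalIntegral {f : ℝ → ℝ} {a b : ℝ} (hab : a ≤ b) (hf : Continuous f)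
    (h0 : ∀ t ∈ Ioc a b, 0 ≤ f t) :
    ∫⁻ t in Ioc a b, ENNReal.ofReal (f t) = ENNReal.ofReal (∫ t in a..b, f t) := by
  rw [intervalIntegral.integral_of_le hab, ofReal_integral_eq_lintegral_ofReal]
  · exact (intervalIntegrable_iff_integrableOn_Ioc_of_le hab).1 (hf.intervalIntegrable _ _)
  · filter_upwards [ae_restrict_mem measurableSet_Ioc] with t ht using h0 t ht

theorem lintegral_rayMass {α V A B : ℝ} (hα : 1 < α) (hV : 1 ≤ V) (hA : 0 ≤ A) (hB : 0 ≤ B) :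
    ∫⁻ r in Ioi (0 : ℝ), ENNReal.ofReal (r ^ (-1 - α)) * (raySet V A B).indicator 1 r =
      ENNReal.ofReal (rayMass α V A B) := by
  rw [lintegral_raySet hA]
  simp only [Pi.one_apply, mul_one]
  rw [ofReal_intervalIntegral (le_truncation hV hA hB)
    (Real.continuous_rpow_const (by linarith))
    (fun t ht => Real.rpow_nonneg (hA.trans ht.1.le) _), integral_rpow (Or.inl (by linarith)),
    sub_add_cancel, rayMass]

/-- The affine change `t = (A+B)v/2 + (A-B)/2` turns `(t-A)(t+B)` into `((A+B)/2)² (v²-1)` and the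
interval into `[1,V]`. -/
theorem integral_rayGround {α V A B : ℝ} (hα : 1 < α) (hV : 1 ≤ V) (hA : 0 ≤ A) (hB : 0 ≤ B) :
    ∫ t in A..(V * (A + B) + A - B) / 2, ((t - A) * (t + B)) ^ ((α - 1) / 2) =
      rayGround α V A B := by
  -- If `A = B = 0` the affine change degenerates. This happens for lines that never leave the set,
  -- such as those parallel to the boundary of a half-space.
  rcases (add_nonneg hA hB).eq_or_lt with hq | hq
  · have hA0 : A = 0 := by linarith
    have hB0 : B = 0 := by linarith
    subst hA0 hB0
    simp [rayGround, Real.zero_rpow (by linarith : α ≠ 0)]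
  · have hc : (A + B) / 2 ≠ 0 := by positivity
    have h := intervalIntegral.integral_comp_mul_add (a := 1) (b := V)
      (fun t : ℝ => ((t - A) * (t + B)) ^ ((α - 1) / 2)) hc ((A - B) / 2)
    rw [show (A + B) / 2 * 1 + (A - B) / 2 = A by ring,
      show (A + B) / 2 * V + (A - B) / 2 = (V * (A + B) + A - B) / 2 by ring,
      eq_inv_smul_iff₀ hc] at h
    rw [← h, rayGround, truncInt, smul_eq_mul]
    have hq2 : (0 : ℝ) ≤ (A + B) / 2 := by positivity
    have e : ∀ v ∈ uIcc 1 V, ((((A + B) / 2 * v + (A - B) / 2) - A) *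
        (((A + B) / 2 * v + (A - B) / 2) + B)) ^ ((α - 1) / 2) =
        ((A + B) / 2) ^ (α - 1) * (v ^ 2 - 1) ^ ((α - 1) / 2) := by
      intro v hv
      rw [uIcc_of_le hV] at hv
      rw [show (((A + B) / 2 * v + (A - B) / 2) - A) * (((A + B) / 2 * v + (A - B) / 2) + B) =
        ((A + B) / 2) ^ 2 * (v ^ 2 - 1) by ring,
        Real.mul_rpow (show 0 ≤ ((A + B) / 2) ^ 2 by positivity)
          (show 0 ≤ v ^ 2 - 1 by nlinarith [hv.1]), ← Real.rpow_natCast, ← Real.rpow_mul hq2]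
      congr 2
      push_cast; ring
    rw [intervalIntegral.integral_congr e, intervalIntegral.integral_const_mul, ← mul_assoc,
      ← Real.rpow_one_add' hq2 (by linarith), add_sub_cancel]

/-- The factor `t^(α-1) = (t²)^((α-1)/2)` clears the denominators: `t²(1 - A/t)(1 + B/t) =
(t-A)(t+B)`. -/
theorem lintegral_rayGround {α V A B : ℝ} (hα : 1 < α) (hV : 1 ≤ V) (hA : 0 ≤ A) (hB : 0 ≤ B) :
    ∫⁻ r in Ioi (0 : ℝ), ENNReal.ofReal (r ^ (-1 - α)) * (raySet V A B).indicator
        (fun r => ENNReal.ofReal (((1 - r * A) * (1 + r * B)) ^ ((α - 1) / 2))) r =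
      ENNReal.ofReal (rayGround α V A B) := by
  rw [lintegral_raySet hA, ← integral_rayGround hα hV hA hB, ← ofReal_intervalIntegral
    (le_truncation hV hA hB) ((by fun_prop : Continuous fun t : ℝ =>
      (t - A) * (t + B)).rpow_const fun _ => Or.inr (by linarith))
    (fun t ht => Real.rpow_nonneg (mul_nonneg (by linarith [ht.1]) (by linarith [ht.1])) _)]
  refine setLIntegral_congr_fun measurableSet_Ioc fun t ht => ?_
  have ht0 : 0 < t := lt_of_le_of_lt hA ht.1
  rw [← ENNReal.ofReal_mul (by positivity)]
  congr 1
  have e1 : t ^ (α - 1) = (t ^ 2) ^ ((α - 1) / 2) := by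
    rw [← Real.rpow_natCast, ← Real.rpow_mul ht0.le]
    congr 1
    push_cast; ring
  have h1 : 0 ≤ 1 - t⁻¹ * A := by
    have : t⁻¹ * A ≤ 1 := by rw [inv_mul_le_iff₀ ht0]; linarith [ht.1]
    linarith
  rw [e1, ← Real.mul_rpow (by positivity) (by positivity)]
  congr 1
  field_simp

end Ray

/-! ### Exit gauges, the symmetric truncation and the ground state quotient -/

section Gauge

variable {E : Type*} [NormedAddCommGroup E] [NormedSpace ℝ E] [MeasurableSpace E]

/-- `σ x z` is the reciprocal of the first time at which the ray `x + t z`, `t ≥ 0`, leaves `Ω`. -/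
structure IsGauge (Ω : Set E) (σ : E → E → ℝ) : Prop where
  nonneg : ∀ x z, 0 ≤ σ x z
  measurable : Measurable fun q : E × E => σ q.1 q.2
  lt_iff : ∀ x ∈ Ω, ∀ z, ∀ t : ℝ, 0 < t → (t * σ x z < 1 ↔ ∀ s ∈ Icc 0 t, x + s • z ∈ Ω)

theorem eq_of_forall_mul_lt_one_iff {a b : ℝ} (ha : 0 ≤ a) (hb : 0 ≤ b)
    (h : ∀ t : ℝ, 0 < t → (t * a < 1 ↔ t * b < 1)) : a = b := by
  have aux : ∀ {a b : ℝ}, 0 ≤ a → 0 ≤ b → (∀ t : ℝ, 0 < t → (t * a < 1 ↔ t * b < 1)) →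
      ¬ a < b := by
    intro a b ha hb h hab
    have hb0 : 0 < b := lt_of_le_of_lt ha hab
    have h1 : b⁻¹ * a < 1 := by rw [inv_mul_lt_iff₀ hb0]; linarith
    have h2 := (h b⁻¹ (inv_pos.2 hb0)).1 h1
    rw [inv_mul_cancel₀ hb0.ne'] at h2
    exact lt_irrefl _ h2
  exact le_antisymm (not_lt.1 (aux hb ha fun t ht => (h t ht).symm)) (not_lt.1 (aux ha hb h))

namespace IsGauge

variable {Ω : Set E} {σ : E → E → ℝ} {x z : E}

theorem smul (h : IsGauge Ω σ) (hx : x ∈ Ω) {r : ℝ} (hr : 0 < r) : σ x (r • z) = r * σ x z := by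
  refine eq_of_forall_mul_lt_one_iff (h.nonneg _ _) (mul_nonneg hr.le (h.nonneg _ _)) fun t ht => ?_
  rw [h.lt_iff x hx _ t ht, ← mul_assoc, h.lt_iff x hx z _ (mul_pos ht hr)]
  constructor
  · intro H s hs
    have := H (s / r) ⟨div_nonneg hs.1 hr.le, (div_le_iff₀ hr).2 hs.2⟩
    rwa [smul_smul, div_mul_cancel₀ _ hr.ne'] at this
  · intro H s hs
    rw [smul_smul]
    exact H _ ⟨mul_nonneg hs.1 hr.le, mul_le_mul_of_nonneg_right hs.2 hr.le⟩

theorem segment_mem (h : IsGauge Ω σ) (hx : x ∈ Ω) (hz : σ x z < 1) {s : ℝ}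
    (hs : s ∈ Icc (0 : ℝ) 1) : x + s • z ∈ Ω :=
  (h.lt_iff x hx z 1 one_pos).1 (by simpa using hz) s hs

theorem add_mem (h : IsGauge Ω σ) (hx : x ∈ Ω) (hz : σ x z < 1) : x + z ∈ Ω := by
  simpa using h.segment_mem hx hz (right_mem_Icc.2 zero_le_one)

/-- Moving the base point from `x` to `x + z` shortens the exit time `1/σ` in direction `z` by `1`.
In the opposite direction it grows by `1`, which is `add_left_neg`. -/
theorem add_left (h : IsGauge Ω σ) (hx : x ∈ Ω) (hz : σ x z < 1) :
    σ (x + z) z = σ x z / (1 - σ x z) := by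
  have h1 : 0 < 1 - σ x z := by linarith
  refine eq_of_forall_mul_lt_one_iff (h.nonneg _ _) (div_nonneg (h.nonneg _ _) h1.le)
    fun t ht => ?_
  rw [h.lt_iff _ (h.add_mem hx hz) _ t ht, mul_div_assoc', div_lt_one h1,
    show t * σ x z < 1 - σ x z ↔ (t + 1) * σ x z < 1 by constructor <;> intro <;> linarith,
    h.lt_iff x hx z _ (by linarith)]
  constructor
  · intro H s hs
    by_cases hs1 : s ≤ 1
    · exact h.segment_mem hx hz ⟨hs.1, hs1⟩
    · have := H (s - 1) ⟨by linarith, by linarith [hs.2]⟩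
      rwa [add_assoc, sub_smul, one_smul, add_sub_cancel] at this
  · intro H s hs
    have := H (s + 1) ⟨by linarith [hs.1], by linarith [hs.2]⟩
    rwa [add_smul, one_smul, add_comm (s • z), ← add_assoc] at this

theorem add_left_neg (h : IsGauge Ω σ) (hx : x ∈ Ω) (hz : σ x z < 1) :
    σ (x + z) (-z) = σ x (-z) / (1 + σ x (-z)) := by
  have h0 := h.nonneg x (-z)
  have h1 : 0 < 1 + σ x (-z) := by linarith
  refine eq_of_forall_mul_lt_one_iff (h.nonneg _ _) (div_nonneg h0 h1.le) fun t ht => ?_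
  rw [h.lt_iff _ (h.add_mem hx hz) _ t ht, mul_div_assoc', div_lt_one h1]
  have e : ∀ s : ℝ, x + z + s • -z = x + (1 - s) • z := by
    intro s; rw [sub_smul, one_smul, smul_neg]; abel
  by_cases ht1 : t ≤ 1
  · refine iff_of_true (fun s hs => ?_) (by nlinarith)
    rw [e]
    exact h.segment_mem hx hz ⟨by linarith [hs.2], by linarith [hs.1]⟩
  · rw [show t * σ x (-z) < 1 + σ x (-z) ↔ (t - 1) * σ x (-z) < 1 by
      constructor <;> intro <;> linarith, h.lt_iff x hx _ _ (by linarith)]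
    constructor
    · intro H s hs
      have := H (s + 1) ⟨by linarith [hs.1], by linarith [hs.2]⟩
      rw [e] at this
      convert this using 2
      rw [smul_neg, ← neg_smul]
      congr 1; ring
    · intro H s hs
      by_cases hs1 : s ≤ 1
      · rw [e]
        exact h.segment_mem hx hz ⟨by linarith, by linarith [hs.1]⟩
      · have := H (s - 1) ⟨by linarith, by linarith [hs.2]⟩
        rw [e]
        convert this using 2
        rw [smul_neg, ← neg_smul]
        congr 1; ring

theorem le_inv (h : IsGauge Ω σ) (hx : x ∈ Ω) {d : ℝ} (hd : 0 < d)
    (hb : Metric.ball x d ⊆ Ω) (hz : ‖z‖ = 1) : σ x z ≤ d⁻¹ := by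
  by_contra! hlt
  have hσ : 0 < σ x z := lt_trans (inv_pos.2 hd) hlt
  have h1 : ¬ ((σ x z)⁻¹ * σ x z < 1) := by rw [inv_mul_cancel₀ hσ.ne']; exact lt_irrefl _
  rw [h.lt_iff x hx z _ (inv_pos.2 hσ)] at h1
  refine h1 fun s hs => hb ?_
  rw [Metric.mem_ball, dist_self_add_left, norm_smul, hz, mul_one, Real.norm_of_nonneg hs.1]
  exact lt_of_le_of_lt hs.2 (inv_lt_of_inv_lt₀ hd hlt)

end IsGauge

/-- The symmetric truncation at level `V` of the pairs of points of `Ω` which see each other. -/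
def truncRegion (Ω : Set E) (σ : E → E → ℝ) (V : ℝ) : Set (E × E) :=
  {q | q.1 ∈ Ω ∧ σ q.1 (q.2 - q.1) < 1 ∧
    2 + σ q.1 (q.1 - q.2) - σ q.1 (q.2 - q.1) ≤ V * (σ q.1 (q.2 - q.1) + σ q.1 (q.1 - q.2))}

/-- The quotient of the ground states at `y` and at `x` along the line through `x` and `y`. -/
noncomputable def groundRatio (σ : E → E → ℝ) (α : ℝ) (q : E × E) : ℝ :=
  ((1 - σ q.1 (q.2 - q.1)) * (1 + σ q.1 (q.1 - q.2))) ^ ((α - 1) / 2)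

variable {Ω : Set E} {σ : E → E → ℝ} {V α : ℝ}

theorem swap_gauge (h : IsGauge Ω σ) {x y : E} (hq : (x, y) ∈ truncRegion Ω σ V) :
    σ y (x - y) = σ x (x - y) / (1 + σ x (x - y)) ∧
      σ y (y - x) = σ x (y - x) / (1 - σ x (y - x)) := by
  obtain ⟨hx, h1, -⟩ := hq
  have e1 := h.add_left_neg hx h1
  have e2 := h.add_left hx h1
  rw [neg_sub, add_sub_cancel] at e1
  rw [add_sub_cancel] at e2
  exact ⟨e1, e2⟩

theorem snd_mem_of_mem_truncRegion (h : IsGauge Ω σ) {x y : E}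
    (hq : (x, y) ∈ truncRegion Ω σ V) : y ∈ Ω := by
  simpa using h.add_mem hq.1 hq.2.1

/-- Write `s`, `s'` for the gauges at `x` in the directions `y - x` and `x - y`. Exchanging the
points divides both sides of the truncation inequality by `(1-s)(1+s')`. The invariant
`(2+s'-s)/(s+s')` is `coth(d/2)` for the Hilbert distance `d = log((1+s')/(1-s))` on the chord. -/
theorem swap_mem_truncRegion (h : IsGauge Ω σ) {x y : E} (hq : (x, y) ∈ truncRegion Ω σ V) :
    (y, x) ∈ truncRegion Ω σ V := by
  obtain ⟨e1, e2⟩ := swap_gauge h hq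
  have hy := snd_mem_of_mem_truncRegion h hq
  obtain ⟨hx, h1, h2⟩ := hq
  simp only at hx h1 h2
  have hs := h.nonneg x (x - y)
  refine ⟨hy, ?_, ?_⟩
  · simp only
    rw [e1, div_lt_one (by linarith)]
    linarith
  · simp only
    rw [e1, e2]
    set s := σ x (y - x)
    set s' := σ x (x - y)
    have p1 : 0 < 1 - s := by linarith
    have p2 : 0 < 1 + s' := by linarith
    have e3 : 2 + s / (1 - s) - s' / (1 + s') = (2 + s' - s) / ((1 - s) * (1 + s')) := by
      field_simp; ring
    have e4 : V * (s' / (1 + s') + s / (1 - s)) = (V * (s + s')) / ((1 - s) * (1 + s')) := by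
      field_simp; ring
    rw [e3, e4]
    exact div_le_div_of_nonneg_right h2 (by positivity)

theorem groundRatio_pos (h : IsGauge Ω σ) {q : E × E} (hq : q ∈ truncRegion Ω σ V) :
    0 < groundRatio σ α q := by
  have := h.nonneg q.1 (q.1 - q.2)
  exact Real.rpow_pos_of_pos (mul_pos (by linarith [hq.2.1]) (by linarith)) _

/-- The change of base point sends `1 - s` to `1/(1-s)` and `1 + s'` to `1/(1+s')`, in exchanged
roles. -/
theorem groundRatio_swap (h : IsGauge Ω σ) {q : E × E} (hq : q ∈ truncRegion Ω σ V) :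
    groundRatio σ α q.swap = (groundRatio σ α q)⁻¹ := by
  obtain ⟨x, y⟩ := q
  obtain ⟨e1, e2⟩ := swap_gauge h hq
  obtain ⟨hx, h1, h2⟩ := hq
  simp only at hx h1 h2
  have hs := h.nonneg x (x - y)
  have p1 : 0 < 1 - σ x (y - x) := by linarith
  have p2 : 0 < 1 + σ x (x - y) := by linarith
  simp only [groundRatio, Prod.swap_prod_mk]
  rw [e1, e2, ← Real.inv_rpow (by positivity)]
  congr 1
  field_simp
  ring

theorem measurable_gauge_sub [BorelSpace E] [SecondCountableTopology E] (h : IsGauge Ω σ) :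
    Measurable (fun q : E × E => σ q.1 (q.2 - q.1)) ∧
      Measurable (fun q : E × E => σ q.1 (q.1 - q.2)) :=
  ⟨h.measurable.comp (by fun_prop : Measurable fun q : E × E => (q.1, q.2 - q.1)),
    h.measurable.comp (by fun_prop : Measurable fun q : E × E => (q.1, q.1 - q.2))⟩

theorem measurableSet_truncRegion [BorelSpace E] [SecondCountableTopology E] (hΩ : MeasurableSet Ω)
    (h : IsGauge Ω σ) : MeasurableSet (truncRegion Ω σ V) := by
  obtain ⟨m1, m2⟩ := measurable_gauge_sub h
  have h1 : MeasurableSet {q : E × E | q.1 ∈ Ω} := measurable_fst hΩ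
  have h2 : MeasurableSet {q : E × E | σ q.1 (q.2 - q.1) < 1} := measurableSet_lt m1 (by fun_prop)
  have h3 : MeasurableSet {q : E × E | 2 + σ q.1 (q.1 - q.2) - σ q.1 (q.2 - q.1) ≤
      V * (σ q.1 (q.2 - q.1) + σ q.1 (q.1 - q.2))} :=
    measurableSet_le ((measurable_const.add m2).sub m1) ((m1.add m2).const_mul V)
  exact h1.inter (h2.inter h3)

theorem measurable_groundRatio [BorelSpace E] [SecondCountableTopology E] (h : IsGauge Ω σ) :
    Measurable (groundRatio σ α) := by
  obtain ⟨m1, m2⟩ := measurable_gauge_sub h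
  exact ((measurable_const.sub m1).mul (measurable_const.add m2)).pow_const _

end Gauge

/-! ### The abstract ground state identity -/

section GroundState

variable {X : Type*} [MeasurableSpace X]

/-- Pointwise, `(a-b)² + ρa² + ρ⁻¹b² = a² + b² + (ρa² - 2ab + ρ⁻¹b²)`, where the last bracket is
`ρ⁻¹(ρa-b)² ≥ 0`. Symmetry of `K` and inversion of `ρ` under the swap merge the terms in `a` and in
`b`. Both sides are sums, so that no difference of possibly infinite integrals occurs. -/
theorem ground_state_identity (μ : Measure X) [SFinite μ] {K : X × X → ℝ≥0∞} (hK : Measurable K)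
    (hsymm : ∀ q, K q.swap = K q) {ρ : X × X → ℝ} (hρ : Measurable ρ)
    (hpos : ∀ q, K q ≠ 0 → 0 < ρ q ∧ ρ q.swap = (ρ q)⁻¹) {u : X → ℝ} (hu : Measurable u) :
    (1 / 2) * ∫⁻ q, ENNReal.ofReal ((u q.1 - u q.2) ^ 2) * K q ∂μ.prod μ +
        ∫⁻ q, ENNReal.ofReal (u q.1 ^ 2) * (ENNReal.ofReal (ρ q) * K q) ∂μ.prod μ =
      ∫⁻ q, ENNReal.ofReal (u q.1 ^ 2) * K q ∂μ.prod μ +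
        (1 / 2) * ∫⁻ q, ENNReal.ofReal (ρ q * u q.1 ^ 2 - 2 * u q.1 * u q.2 +
          (ρ q)⁻¹ * u q.2 ^ 2) * K q ∂μ.prod μ := by
  have hA : ∫⁻ q, ENNReal.ofReal (u q.2 ^ 2) * (ENNReal.ofReal (ρ q)⁻¹ * K q) ∂μ.prod μ =
      ∫⁻ q, ENNReal.ofReal (u q.1 ^ 2) * (ENNReal.ofReal (ρ q) * K q) ∂μ.prod μ := by
    rw [← lintegral_prod_swap]
    refine lintegral_congr fun q => ?_
    rw [hsymm, Prod.snd_swap]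
    by_cases h : K q = 0
    · simp [h]
    · rw [(hpos q h).2, inv_inv]
  have hB : ∫⁻ q, ENNReal.ofReal (u q.2 ^ 2) * K q ∂μ.prod μ =
      ∫⁻ q, ENNReal.ofReal (u q.1 ^ 2) * K q ∂μ.prod μ := by
    rw [← lintegral_prod_swap]
    refine lintegral_congr fun q => ?_
    rw [hsymm, Prod.snd_swap]
  have key : ∫⁻ q, ENNReal.ofReal ((u q.1 - u q.2) ^ 2) * K q ∂μ.prod μ +
      (∫⁻ q, ENNReal.ofReal (u q.1 ^ 2) * (ENNReal.ofReal (ρ q) * K q) ∂μ.prod μ +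
        ∫⁻ q, ENNReal.ofReal (u q.2 ^ 2) * (ENNReal.ofReal (ρ q)⁻¹ * K q) ∂μ.prod μ) =
      (∫⁻ q, ENNReal.ofReal (u q.1 ^ 2) * K q ∂μ.prod μ +
        ∫⁻ q, ENNReal.ofReal (u q.2 ^ 2) * K q ∂μ.prod μ) +
        ∫⁻ q, ENNReal.ofReal (ρ q * u q.1 ^ 2 - 2 * u q.1 * u q.2 +
          (ρ q)⁻¹ * u q.2 ^ 2) * K q ∂μ.prod μ := by
    rw [← lintegral_add_left (by fun_prop), ← lintegral_add_left (by fun_prop),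
      ← lintegral_add_left (by fun_prop), ← lintegral_add_left (by fun_prop)]
    refine lintegral_congr fun q => ?_
    by_cases h : K q = 0
    · simp [h]
    · have h0 := (hpos q h).1
      have e : ρ q * u q.1 ^ 2 - 2 * u q.1 * u q.2 + (ρ q)⁻¹ * u q.2 ^ 2 =
          (ρ q)⁻¹ * (ρ q * u q.1 - u q.2) ^ 2 := by field_simp; ring
      have h1 : 0 ≤ ρ q * u q.1 ^ 2 - 2 * u q.1 * u q.2 + (ρ q)⁻¹ * u q.2 ^ 2 := by
        rw [e]; positivity
      rw [← mul_assoc, ← mul_assoc, ← add_mul, ← add_mul, ← add_mul, ← add_mul,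
        ← ENNReal.ofReal_mul (by positivity), ← ENNReal.ofReal_mul (by positivity),
        ← ENNReal.ofReal_add (by positivity) (by positivity),
        ← ENNReal.ofReal_add (by positivity) (by positivity),
        ← ENNReal.ofReal_add (by positivity) (by positivity),
        ← ENNReal.ofReal_add (by positivity) h1]
      congr 2
      ring
  rw [hA, hB, ← two_mul, ← two_mul] at key
  have key2 := congrArg (fun t => (1 / 2 : ℝ≥0∞) * t) key
  have h2 : (1 / 2 : ℝ≥0∞) * 2 = 1 := by
    rw [one_div, ENNReal.inv_mul_cancel (by simp) (by simp)]
  simpa only [mul_add, ← mul_assoc, h2, one_mul] using key2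

end GroundState

/-! ### Slicing the truncated form into rays -/

noncomputable section Slicing

variable {n : ℕ}

local notation "𝔼" => EuclideanSpace ℝ (Fin n)
local notation "𝕊" => Metric.sphere (0 : EuclideanSpace ℝ (Fin n)) 1
local notation "dS" => Measure.toSphere (volume : Measure (EuclideanSpace ℝ (Fin n)))

/-- The Riesz kernel restricted to the truncated region. -/
def truncKernel (Ω : Set 𝔼) (σ : 𝔼 → 𝔼 → ℝ) (α V : ℝ) : 𝔼 × 𝔼 → ℝ≥0∞ :=
  (truncRegion Ω σ V).indicator fun q => ENNReal.ofReal (‖q.1 - q.2‖ ^ (-((n : ℝ) + α)))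

/-- The directional integral `∫_{S^{n-1}} (σ(x, w) + σ(x, -w))^β dw`. -/
def dirIntegral (σ : 𝔼 → 𝔼 → ℝ) (β : ℝ) (x : 𝔼) : ℝ≥0∞ :=
  ∫⁻ w : 𝕊, ENNReal.ofReal ((σ x w.1 + σ x (-w.1)) ^ β) ∂dS

variable {Ω : Set (EuclideanSpace ℝ (Fin n))}
  {σ : EuclideanSpace ℝ (Fin n) → EuclideanSpace ℝ (Fin n) → ℝ} {α V : ℝ}

theorem measurable_truncKernel (hΩ : MeasurableSet Ω) (h : IsGauge Ω σ) :
    Measurable (truncKernel Ω σ α V) :=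
  (by fun_prop : Measurable fun q : 𝔼 × 𝔼 =>
    ENNReal.ofReal (‖q.1 - q.2‖ ^ (-((n : ℝ) + α)))).indicator (measurableSet_truncRegion hΩ h)

theorem truncKernel_swap (h : IsGauge Ω σ) (q : 𝔼 × 𝔼) :
    truncKernel Ω σ α V q.swap = truncKernel Ω σ α V q := by
  obtain ⟨x, y⟩ := q
  rw [Prod.swap_prod_mk, truncKernel]
  by_cases hq : (x, y) ∈ truncRegion Ω σ V
  · rw [indicator_of_mem hq, indicator_of_mem (swap_mem_truncRegion h hq), norm_sub_rev]
  · rw [indicator_of_notMem hq, indicator_of_notMem fun h' => hq (swap_mem_truncRegion h h')]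

theorem mem_of_truncKernel_ne_zero {q : 𝔼 × 𝔼} (hq : truncKernel Ω σ α V q ≠ 0) :
    q ∈ truncRegion Ω σ V := by
  by_contra h
  exact hq (indicator_of_notMem h _)

theorem gauge_ground_state_identity (hΩ : MeasurableSet Ω) (h : IsGauge Ω σ) {u : 𝔼 → ℝ}
    (hu : Measurable u) :
    (1 / 2) * (∫⁻ q : 𝔼 × 𝔼, ENNReal.ofReal ((u q.1 - u q.2) ^ 2) * truncKernel Ω σ α V q) +
        (∫⁻ q : 𝔼 × 𝔼, ENNReal.ofReal (u q.1 ^ 2) *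
          (ENNReal.ofReal (groundRatio σ α q) * truncKernel Ω σ α V q)) =
      (∫⁻ q : 𝔼 × 𝔼, ENNReal.ofReal (u q.1 ^ 2) * truncKernel Ω σ α V q) +
        (1 / 2) * ∫⁻ q : 𝔼 × 𝔼, ENNReal.ofReal (groundRatio σ α q * u q.1 ^ 2 -
          2 * u q.1 * u q.2 + (groundRatio σ α q)⁻¹ * u q.2 ^ 2) * truncKernel Ω σ α V q :=
  ground_state_identity volume (measurable_truncKernel hΩ h) (truncKernel_swap h)
    (measurable_groundRatio h)
    (fun _ hq => ⟨groundRatio_pos h (mem_of_truncKernel_ne_zero hq),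
      groundRatio_swap h (mem_of_truncKernel_ne_zero hq)⟩) hu

theorem mem_truncRegion_ray (h : IsGauge Ω σ) {x w : 𝔼} (hx : x ∈ Ω) {r : ℝ} (hr : 0 < r) :
    (x, x + r • w) ∈ truncRegion Ω σ V ↔ r ∈ raySet V (σ x w) (σ x (-w)) := by
  have e1 : σ x (r • w) = r * σ x w := h.smul hx hr
  have e2 : σ x (-(r • w)) = r * σ x (-w) := by rw [← smul_neg, h.smul hx hr]
  have e3 : x + r • w - x = r • w := by abel
  have e4 : x - (x + r • w) = -(r • w) := by abel
  change (_ ∧ _ ∧ _) ↔ _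
  simp only [e3, e4, e1, e2, hx, true_and]
  rfl

theorem groundRatio_ray (h : IsGauge Ω σ) {x w : 𝔼} (hx : x ∈ Ω) {r : ℝ} (hr : 0 < r) :
    groundRatio σ α (x, x + r • w) =
      ((1 - r * σ x w) * (1 + r * σ x (-w))) ^ ((α - 1) / 2) := by
  have e1 : σ x (r • w) = r * σ x w := h.smul hx hr
  have e2 : σ x (-(r • w)) = r * σ x (-w) := by rw [← smul_neg, h.smul hx hr]
  have e3 : x + r • w - x = r • w := by abel
  have e4 : x - (x + r • w) = -(r • w) := by abel
  simp only [groundRatio, e3, e4, e1, e2]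

/-- Polar coordinates around `x`: the volume factor `r^(n-1)` and the kernel `r^(-n-α)` combine to
the one-dimensional `r^(-1-α)`. -/
theorem lintegral_truncKernel_mul [NeZero n] (hΩ : MeasurableSet Ω) (h : IsGauge Ω σ) {x : 𝔼}
    (hx : x ∈ Ω) {g : 𝔼 → ℝ≥0∞} (hg : Measurable g) :
    ∫⁻ y, g y * truncKernel Ω σ α V (x, y) = ∫⁻ w : 𝕊, (∫⁻ r in Ioi (0 : ℝ),
      ENNReal.ofReal (r ^ (-1 - α)) * (raySet V (σ x w.1) (σ x (-w.1))).indicator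
        (fun r => g (x + r • w.1)) r) ∂dS := by
  have hn : 1 ≤ n := Nat.one_le_iff_ne_zero.2 (NeZero.ne n)
  have hK := measurable_truncKernel (α := α) (V := V) hΩ h
  rw [← lintegral_add_left_eq_self _ x, lintegral_eq_lintegral_sphere _ (by fun_prop),
    finrank_euclideanSpace_fin]
  refine lintegral_congr fun w => setLIntegral_congr_fun measurableSet_Ioi fun r hr => ?_
  have hr0 : 0 < r := hr
  have hw : ‖x - (x + r • w.1)‖ = r := by
    rw [sub_add_cancel_left, norm_neg, norm_smul, norm_eq_of_mem_sphere, mul_one,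
      Real.norm_of_nonneg hr0.le]
  by_cases hm : r ∈ raySet V (σ x w.1) (σ x (-w.1))
  · simp only [truncKernel]
    rw [indicator_of_mem hm, indicator_of_mem ((mem_truncRegion_ray h hx hr0).2 hm), hw,
      mul_left_comm, ← ENNReal.ofReal_mul (by positivity), mul_comm]
    congr 2
    rw [← Real.rpow_natCast, ← Real.rpow_add hr0, Nat.cast_sub hn]
    congr 1
    push_cast; ring
  · simp only [truncKernel]
    rw [indicator_of_notMem hm, indicator_of_notMem fun h' =>
      hm ((mem_truncRegion_ray h hx hr0).1 h')]
    simp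

theorem lintegral_truncKernel [NeZero n] (hα : 1 < α) (hV : 1 ≤ V) (hΩ : MeasurableSet Ω)
    (h : IsGauge Ω σ) {x : 𝔼} (hx : x ∈ Ω) :
    ∫⁻ y, truncKernel Ω σ α V (x, y) =
      ∫⁻ w : 𝕊, ENNReal.ofReal (rayMass α V (σ x w.1) (σ x (-w.1))) ∂dS := by
  have := lintegral_truncKernel_mul (α := α) (V := V) hΩ h hx (g := 1) measurable_one
  simp only [Pi.one_apply, one_mul] at this
  rw [this]
  refine lintegral_congr fun w => ?_
  exact lintegral_rayMass hα hV (h.nonneg _ _) (h.nonneg _ _)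

theorem lintegral_groundRatio_mul_truncKernel [NeZero n] (hα : 1 < α) (hV : 1 ≤ V)
    (hΩ : MeasurableSet Ω) (h : IsGauge Ω σ) {x : 𝔼} (hx : x ∈ Ω) :
    ∫⁻ y, ENNReal.ofReal (groundRatio σ α (x, y)) * truncKernel Ω σ α V (x, y) =
      ∫⁻ w : 𝕊, ENNReal.ofReal (rayGround α V (σ x w.1) (σ x (-w.1))) ∂dS := by
  have hm := measurable_groundRatio (α := α) h
  rw [lintegral_truncKernel_mul (α := α) (V := V) hΩ h hx (by fun_prop)]
  refine lintegral_congr fun w => ?_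
  rw [← lintegral_rayGround hα hV (h.nonneg _ _) (h.nonneg _ _)]
  refine setLIntegral_congr_fun measurableSet_Ioi fun r hr => ?_
  simp only [indicator, groundRatio_ray (α := α) h hx hr]

theorem lintegral_prod_truncKernel (hΩ : MeasurableSet Ω) (h : IsGauge Ω σ)
    {u : 𝔼 → ℝ} (hu : Measurable u) {g : 𝔼 × 𝔼 → ℝ≥0∞} (hg : Measurable g) :
    ∫⁻ q : 𝔼 × 𝔼, ENNReal.ofReal (u q.1 ^ 2) * (g q * truncKernel Ω σ α V q) =
      ∫⁻ x in Ω, ENNReal.ofReal (u x ^ 2) * ∫⁻ y, g (x, y) * truncKernel Ω σ α V (x, y) := by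
  have hK := measurable_truncKernel (α := α) (V := V) hΩ h
  rw [Measure.volume_eq_prod, lintegral_prod _ (by fun_prop), ← lintegral_indicator hΩ]
  refine lintegral_congr fun x => ?_
  simp only
  rw [lintegral_const_mul _ (by fun_prop)]
  by_cases hx : x ∈ Ω
  · rw [indicator_of_mem hx]
  · rw [indicator_of_notMem hx]
    have : ∀ y, truncKernel Ω σ α V (x, y) = 0 := fun y => by
      by_contra hne
      exact hx (mem_of_truncKernel_ne_zero hne).1
    simp [this]

theorem rayMass_nonneg {A B : ℝ} (hα : 1 < α) (hV : 1 ≤ V) (hA : 0 ≤ A) (hB : 0 ≤ B) :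
    0 ≤ rayMass α V A B := by
  have := Real.rpow_le_rpow hA (le_truncation hV hA hB) (by linarith : 0 ≤ α)
  exact div_nonneg (by linarith) (by linarith)

theorem measurable_gauge_sphere (h : IsGauge Ω σ) :
    Measurable (fun q : 𝔼 × 𝕊 => σ q.1 q.2.1) ∧ Measurable (fun q : 𝔼 × 𝕊 => σ q.1 (-q.2.1)) :=
  ⟨h.measurable.comp (by fun_prop : Measurable fun q : 𝔼 × 𝕊 => (q.1, q.2.1)),
    h.measurable.comp (by fun_prop : Measurable fun q : 𝔼 × 𝕊 => (q.1, -q.2.1))⟩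

theorem measurable_dirIntegral (h : IsGauge Ω σ) (β : ℝ) : Measurable (dirIntegral σ β) := by
  obtain ⟨m1, m2⟩ := measurable_gauge_sphere h
  exact ((m1.add m2).pow_const β).ennreal_ofReal.lintegral_prod_right'

theorem lintegral_rayGround_sphere (h : IsGauge Ω σ) (x : 𝔼) :
    ∫⁻ w : 𝕊, ENNReal.ofReal (rayGround α V (σ x w.1) (σ x (-w.1))) ∂dS =
      ENNReal.ofReal (truncInt ((α - 1) / 2) V / 2 ^ α) * dirIntegral σ α x := by
  obtain ⟨m1, m2⟩ := measurable_gauge_sphere h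
  have m3 : Measurable fun w : 𝕊 => σ x w.1 + σ x (-w.1) :=
    (m1.comp measurable_prodMk_left).add (m2.comp measurable_prodMk_left)
  rw [dirIntegral, ← lintegral_const_mul _ (m3.pow_const α).ennreal_ofReal]
  refine lintegral_congr fun w => ?_
  have h0 : 0 ≤ σ x w.1 + σ x (-w.1) := add_nonneg (h.nonneg _ _) (h.nonneg _ _)
  rw [← ENNReal.ofReal_mul' (Real.rpow_nonneg h0 _), rayGround, Real.div_rpow h0 two_pos.le]
  congr 1
  ring

theorem two_mul_lintegral_rayMass [NeZero n] (hα : 1 < α) (hV : 1 ≤ V) (h : IsGauge Ω σ) (x : 𝔼) :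
    2 * ∫⁻ w : 𝕊, ENNReal.ofReal (rayMass α V (σ x w.1) (σ x (-w.1))) ∂dS =
      ∫⁻ w : 𝕊, ENNReal.ofReal (rayMass α V (σ x w.1) (σ x (-w.1)) +
        rayMass α V (σ x (-w.1)) (σ x w.1)) ∂dS := by
  have m1 : Measurable fun w : 𝔼 => σ x w := h.measurable.comp measurable_prodMk_left
  have m2 : Measurable fun w : 𝔼 => σ x (-w) := m1.comp measurable_neg
  have m3 : Measurable fun w : 𝔼 => ENNReal.ofReal (rayMass α V (σ x w) (σ x (-w))) := by
    unfold rayMass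
    fun_prop
  have hneg := lintegral_sphere_neg (E := 𝔼) m3
  simp only [neg_neg] at hneg
  have : ∀ w : 𝕊, ENNReal.ofReal (rayMass α V (σ x w.1) (σ x (-w.1)) +
        rayMass α V (σ x (-w.1)) (σ x w.1)) = ENNReal.ofReal (rayMass α V (σ x w.1) (σ x (-w.1))) +
        ENNReal.ofReal (rayMass α V (σ x (-w.1)) (σ x w.1)) := fun w =>
    ENNReal.ofReal_add (rayMass_nonneg hα hV (h.nonneg _ _) (h.nonneg _ _))
      (rayMass_nonneg hα hV (h.nonneg _ _) (h.nonneg _ _))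
  have m4 : Measurable fun w : 𝕊 => ENNReal.ofReal (rayMass α V (σ x w.1) (σ x (-w.1))) :=
    m3.comp measurable_subtype_coe
  simp only [this]
  rw [lintegral_add_left m4, hneg, two_mul]

/-- The truncated energy, the directional integrals and the ground state remainder. -/
theorem truncated_energy_identity [NeZero n] (hα : 1 < α) (hV : 1 ≤ V) (hΩ : MeasurableSet Ω)
    (h : IsGauge Ω σ) {u : 𝔼 → ℝ} (hu : Measurable u) :
    (1 / 2) * (∫⁻ q : 𝔼 × 𝔼, ENNReal.ofReal ((u q.1 - u q.2) ^ 2) * truncKernel Ω σ α V q) +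
        ENNReal.ofReal (truncInt ((α - 1) / 2) V / 2 ^ α) *
          (∫⁻ x in Ω, ENNReal.ofReal (u x ^ 2) * dirIntegral σ α x) =
      (∫⁻ x in Ω, ENNReal.ofReal (u x ^ 2) *
          ∫⁻ w : 𝕊, ENNReal.ofReal (rayMass α V (σ x w.1) (σ x (-w.1))) ∂dS) +
        (1 / 2) * ∫⁻ q : 𝔼 × 𝔼, ENNReal.ofReal (groundRatio σ α q * u q.1 ^ 2 -
          2 * u q.1 * u q.2 + (groundRatio σ α q)⁻¹ * u q.2 ^ 2) * truncKernel Ω σ α V q := by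
  have hρ := (measurable_groundRatio (α := α) h).ennreal_ofReal
  have hid := gauge_ground_state_identity (α := α) (V := V) hΩ h hu
  have e1 := lintegral_prod_truncKernel (α := α) (V := V) hΩ h hu hρ
  have e2 := lintegral_prod_truncKernel (α := α) (V := V) hΩ h hu (g := 1) measurable_one
  simp only [Pi.one_apply, one_mul] at e2
  rw [e1, e2] at hid
  have hd := measurable_dirIntegral h α
  have e3 : ENNReal.ofReal (truncInt ((α - 1) / 2) V / 2 ^ α) *
      (∫⁻ x in Ω, ENNReal.ofReal (u x ^ 2) * dirIntegral σ α x) = ∫⁻ x in Ω,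
        ENNReal.ofReal (u x ^ 2) *
          ∫⁻ y, ENNReal.ofReal (groundRatio σ α (x, y)) * truncKernel Ω σ α V (x, y) := by
    rw [← lintegral_const_mul _ (by fun_prop)]
    refine setLIntegral_congr_fun hΩ fun x hx => ?_
    rw [lintegral_groundRatio_mul_truncKernel hα hV hΩ h hx, lintegral_rayGround_sphere h]
    ring
  have e4 : (∫⁻ x in Ω, ENNReal.ofReal (u x ^ 2) *
      ∫⁻ w : 𝕊, ENNReal.ofReal (rayMass α V (σ x w.1) (σ x (-w.1))) ∂dS) =
        ∫⁻ x in Ω, ENNReal.ofReal (u x ^ 2) * ∫⁻ y, truncKernel Ω σ α V (x, y) := by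
    refine setLIntegral_congr_fun hΩ fun x hx => ?_
    rw [lintegral_truncKernel hα hV hΩ h hx]
  rw [e3, e4]
  exact hid

theorem truncated_energy_le_regionalForm (hΩ : MeasurableSet Ω) (h : IsGauge Ω σ) {u : 𝔼 → ℝ}
    (hu : Measurable u) :
    (1 / 2) * (∫⁻ q : 𝔼 × 𝔼, ENNReal.ofReal ((u q.1 - u q.2) ^ 2) * truncKernel Ω σ α V q) ≤
      regionalForm Ω α u := by
  have hK := measurable_truncKernel (α := α) (V := V) hΩ h
  unfold regionalForm
  gcongr
  rw [Measure.volume_eq_prod, lintegral_prod _ (by fun_prop), ← lintegral_indicator hΩ]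
  refine lintegral_mono fun x => ?_
  simp only
  by_cases hx : x ∈ Ω
  · rw [indicator_of_mem hx, ← lintegral_indicator hΩ]
    refine lintegral_mono fun y => ?_
    by_cases hq : (x, y) ∈ truncRegion Ω σ V
    · rw [indicator_of_mem (snd_mem_of_mem_truncRegion h hq), truncKernel, indicator_of_mem hq,
        ← ENNReal.ofReal_mul (by positivity)]
      refine ENNReal.ofReal_le_ofReal (le_of_eq ?_)
      rw [Real.rpow_neg (norm_nonneg _), div_eq_mul_inv]
    · rw [truncKernel, indicator_of_notMem hq]
      simp
  · have : ∀ y, truncKernel Ω σ α V (x, y) = 0 := fun y => by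
      by_contra hne
      exact hx (mem_of_truncKernel_ne_zero hne).1
    simp [this]

/-- The support of `u` keeps a distance `d > 0` from the complement, so both gauges are at most
`1/d` there. This finiteness permits cancelling the divergent parts and absorbing the slack `δ`. -/
theorem lintegral_sq_mul_dirIntegral_ne_top (hΩ : IsOpen Ω) (h : IsGauge Ω σ) {u : 𝔼 → ℝ}
    (hu : IsCc Ω u) {β : ℝ} (hβ : 0 ≤ β) :
    ∫⁻ x in Ω, ENNReal.ofReal (u x ^ 2) * dirIntegral σ β x ≠ ∞ := by
  obtain ⟨d, hd, hsub⟩ := hu.hasCompactSupport.isCompact.exists_thickening_subset_open hΩ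
    hu.tsupport_subset
  have hb : ∀ x ∈ tsupport u, dirIntegral σ β x ≤
      ENNReal.ofReal ((d⁻¹ + d⁻¹) ^ β) * dS univ := by
    intro x hx
    have hball : Metric.ball x d ⊆ Ω := (Metric.ball_subset_thickening hx d).trans hsub
    rw [dirIntegral, ← lintegral_const]
    refine lintegral_mono fun w => ENNReal.ofReal_le_ofReal ?_
    have hw : ‖w.1‖ = 1 := norm_eq_of_mem_sphere w
    exact Real.rpow_le_rpow (add_nonneg (h.nonneg _ _) (h.nonneg _ _))
      (add_le_add (h.le_inv (hu.tsupport_subset hx) hd hball hw)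
        (h.le_inv (hu.tsupport_subset hx) hd hball (by rwa [norm_neg]))) hβ
  have hint : ∫⁻ x, ENNReal.ofReal (u x ^ 2) < ∞ := by
    have hc : HasCompactSupport fun x => u x ^ 2 := by
      refine hu.hasCompactSupport.mono fun x hx => ?_
      rw [Function.mem_support] at hx ⊢
      exact fun h0 => hx (by simp [h0])
    have := ((hu.continuous.pow 2).integrable_of_hasCompactSupport (μ := volume) hc).lintegral_lt_top
    exact this
  refine ne_top_of_le_ne_top (b := (∫⁻ x, ENNReal.ofReal (u x ^ 2)) *
    (ENNReal.ofReal ((d⁻¹ + d⁻¹) ^ β) * dS univ)) ?_ ?_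
  · exact ENNReal.mul_ne_top hint.ne
      (ENNReal.mul_ne_top ENNReal.ofReal_ne_top (measure_ne_top _ _))
  · rw [← lintegral_mul_const _ (hu.continuous.measurable.pow_const 2).ennreal_ofReal]
    refine (setLIntegral_le_lintegral _ _).trans (lintegral_mono fun x => ?_)
    by_cases hx : x ∈ tsupport u
    · exact mul_le_mul_right (hb x hx) _
    · simp [image_eq_zero_of_notMem_tsupport hx]

end Slicing

/-! ### Existence and measurability of the gauge of an open set -/

noncomputable section ExitGauge

open Filter Topology

variable {E : Type*} [NormedAddCommGroup E] [NormedSpace ℝ E]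

open Classical in
/-- The reciprocal of the exit time of the ray `x + t z` from `Ω`. -/
def exitGauge (Ω : Set E) (x z : E) : ℝ :=
  if x ∈ Ω then (sInf {t : ℝ | 0 ≤ t ∧ x + t • z ∉ Ω})⁻¹ else 0

theorem exitGauge_nonneg (Ω : Set E) (x z : E) : 0 ≤ exitGauge Ω x z := by
  unfold exitGauge
  split_ifs
  · exact inv_nonneg.2 (Real.sInf_nonneg fun t ht => ht.1)
  · exact le_rfl

theorem mul_exitGauge_lt_one_iff {Ω : Set E} (hΩ : IsOpen Ω) {x : E} (hx : x ∈ Ω) (z : E) (t : ℝ) :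
    t * exitGauge Ω x z < 1 ↔ ∀ s ∈ Icc 0 t, x + s • z ∈ Ω := by
  set S := {t : ℝ | 0 ≤ t ∧ x + t • z ∉ Ω} with hS
  have hσ : exitGauge Ω x z = (sInf S)⁻¹ := if_pos hx
  have hbdd : BddBelow S := ⟨0, fun t ht => ht.1⟩
  rcases S.eq_empty_or_nonempty with he | hne
  -- Since `sInf ∅ = 0` and `0⁻¹ = 0`, a ray that never leaves `Ω` has gauge `0`, as it should.
  · rw [hσ, he]
    refine iff_of_true (by simp) fun s hs => ?_
    by_contra hmem
    exact (he ▸ (show s ∈ S from ⟨hs.1, hmem⟩) : s ∈ (∅ : Set ℝ))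
  · have hcl : IsClosed S := by
      have h1 : IsClosed ((fun t : ℝ => x + t • z) ⁻¹' Ωᶜ) :=
        hΩ.isClosed_compl.preimage (by fun_prop)
      exact isClosed_Ici.inter h1
    have hmem : sInf S ∈ S := hcl.csInf_mem hne hbdd
    have hpos : 0 < sInf S := by
      refine lt_of_le_of_ne hmem.1 fun h0 => hmem.2 ?_
      rw [← h0]; simpa using hx
    rw [hσ, mul_inv_lt_iff₀ hpos, one_mul]
    constructor
    · intro hlt s hs
      by_contra hns
      have : sInf S ≤ s := csInf_le hbdd ⟨hs.1, hns⟩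
      linarith [hs.2]
    · intro H
      by_contra! hle
      exact hmem.2 (H _ ⟨hpos.le, hle⟩)

/-- For base points in `Ω`, the gauge is below `c > 0` exactly when the segment of times `[0, 1/c]`
stays in `Ω`. By compactness of that interval this is an open condition on the base point and the
direction. -/
theorem isGauge_exitGauge [MeasurableSpace E] [BorelSpace E] [SecondCountableTopology E] {Ω : Set E} (hΩ : IsOpen Ω) :
    IsGauge Ω (exitGauge Ω) := by
  refine ⟨exitGauge_nonneg Ω, measurable_of_Ici fun c => ?_,
    fun x hx z t _ => mul_exitGauge_lt_one_iff hΩ hx z t⟩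
  rcases le_or_gt c 0 with hc | hc
  · convert! MeasurableSet.univ
    exact eq_univ_of_forall fun q : E × E => mem_Ici.2 (hc.trans (exitGauge_nonneg Ω q.1 q.2))
  · have hopen : IsOpen {q : E × E | ∀ s ∈ Icc 0 c⁻¹, q.1 + s • q.2 ∈ Ω} := by
      rw [isOpen_iff_eventually]
      intro q hq
      refine isCompact_Icc.eventually_forall_of_forall_eventually
        (P := fun (q : E × E) (s : ℝ) => q.1 + s • q.2 ∈ Ω) fun s hs => ?_
      have hcont : Continuous fun p : (E × E) × ℝ => p.1.1 + p.2 • p.1.2 := by fun_prop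
      exact hcont.continuousAt.eventually (hΩ.mem_nhds (hq s hs))
    have h1 : MeasurableSet {q : E × E | q.1 ∈ Ω} := measurable_fst hΩ.measurableSet
    convert h1.inter hopen.measurableSet.compl
    ext q
    change c ≤ exitGauge Ω q.1 q.2 ↔ q.1 ∈ Ω ∧ ¬ ∀ s ∈ Icc 0 c⁻¹, q.1 + s • q.2 ∈ Ω
    by_cases hq : q.1 ∈ Ω
    · rw [← mul_exitGauge_lt_one_iff hΩ hq q.2 c⁻¹, not_lt, ← div_eq_inv_mul,
        le_div_iff₀ hc, one_mul]
      simp [hq]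
    · have : exitGauge Ω q.1 q.2 = 0 := if_neg hq
      rw [this]
      simp [hq, hc]

end ExitGauge

/-! ### Gauges of bounded sets -/

section BoundedGauge

theorem abs_le_of_isBounded {E : Type*} [NormedAddCommGroup E] [NormedSpace ℝ E] {Ω : Set E}
    (hb : Bornology.IsBounded Ω) (x : E) {w : E} (hw : ‖w‖ = 1) :
    ∃ C, ∀ t : ℝ, x + t • w ∈ Ω → |t| ≤ C := by
  obtain ⟨C, hC⟩ := hb.exists_norm_le
  refine ⟨C + ‖x‖, fun t ht => ?_⟩
  have h1 : |t| = ‖t • w‖ := by rw [norm_smul, hw, mul_one, Real.norm_eq_abs]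
  have h2 : t • w = (x + t • w) - x := by abel
  rw [h1, h2]
  exact (norm_sub_le _ _).trans (by linarith [hC _ ht])

variable {E : Type*} [NormedAddCommGroup E] [NormedSpace ℝ E] [MeasurableSpace E]
  {Ω : Set E} {σ : E → E → ℝ} {x w : E}

theorem IsGauge.mem_of_mul_lt (h : IsGauge Ω σ) (hx : x ∈ Ω) {t : ℝ} (ht : 0 ≤ t)
    (hlt : t * σ x w < 1) : x + t • w ∈ Ω := by
  rcases ht.eq_or_lt with rfl | ht
  · simpa using hx
  · exact (h.lt_iff x hx w t ht).1 hlt t ⟨ht.le, le_rfl⟩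

theorem IsGauge.pos (h : IsGauge Ω σ) (hb : Bornology.IsBounded Ω) (hx : x ∈ Ω) (hw : ‖w‖ = 1) :
    0 < σ x w := by
  refine lt_of_le_of_ne (h.nonneg _ _) fun h0 => ?_
  obtain ⟨C, hC⟩ := abs_le_of_isBounded hb x hw
  have h1 := hC (|C| + 1) (h.mem_of_mul_lt hx (by positivity) (by rw [← h0]; simp))
  rw [abs_of_pos (by positivity)] at h1
  linarith [le_abs_self C]

theorem IsGauge.inv_add_inv_le_diam (h : IsGauge Ω σ) (hb : Bornology.IsBounded Ω) (hx : x ∈ Ω)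
    (hw : ‖w‖ = 1) : 1 / σ x w + 1 / σ x (-w) ≤ Metric.diam Ω := by
  have hA := h.pos hb hx hw
  have hB := h.pos hb hx (w := -w) (by rwa [norm_neg])
  by_contra! hlt
  have hS : 0 < 1 / σ x w + 1 / σ x (-w) := by positivity
  -- The exit points need not lie in `Ω`. Scaling both exit times by `θ < 1` gives points of `Ω`
  -- still farther apart than the diameter.
  obtain ⟨θ, hθ0, hθ1⟩ := exists_between ((div_lt_one hS).2 hlt)
  have hθp : 0 ≤ θ := (div_nonneg Metric.diam_nonneg hS.le).trans hθ0.le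
  have m1 := h.mem_of_mul_lt hx (w := w) (t := θ / σ x w) (by positivity)
    (by rwa [div_mul_cancel₀ _ hA.ne'])
  have m2 := h.mem_of_mul_lt hx (w := -w) (t := θ / σ x (-w)) (by positivity)
    (by rwa [div_mul_cancel₀ _ hB.ne'])
  have h1 := Metric.dist_le_diam_of_mem hb m1 m2
  have h2 : x + (θ / σ x w) • w - (x + (θ / σ x (-w)) • -w) =
      (θ / σ x w + θ / σ x (-w)) • w := by
    rw [add_smul, smul_neg]; abel
  rw [dist_eq_norm, h2, norm_smul, hw, mul_one, Real.norm_of_nonneg (by positivity)] at h1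
  rw [div_lt_iff₀ hS] at hθ0
  have : θ * (1 / σ x w + 1 / σ x (-w)) = θ / σ x w + θ / σ x (-w) := by ring
  linarith

end BoundedGauge

/-! ### The inequality on bounded open sets -/

noncomputable section DirectionalHardy

variable {n : ℕ}

local notation "𝔼" => EuclideanSpace ℝ (Fin n)
local notation "𝕊" => Metric.sphere (0 : EuclideanSpace ℝ (Fin n)) 1
local notation "dS" => Measure.toSphere (volume : Measure (EuclideanSpace ℝ (Fin n)))

variable {Ω : Set (EuclideanSpace ℝ (Fin n))}
  {σ : EuclideanSpace ℝ (Fin n) → EuclideanSpace ℝ (Fin n) → ℝ} {α V : ℝ}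

/-- The distance `d_w` is at least the shorter exit time and the reach `δ_w` at least the longer
one. The line may re-enter a nonconvex `Ω`, so `δ_w` can be strictly larger, but only this direction
is needed. -/
theorem one_div_dirDist_add_le (h : IsGauge Ω σ) (hb : Bornology.IsBounded Ω) {x w : 𝔼}
    (hx : x ∈ Ω) (hw : ‖w‖ = 1) :
    1 / dirDist Ω w x + 1 / dirReach Ω w x ≤ σ x w + σ x (-w) := by
  have hA := h.pos hb hx hw
  have hB := h.pos hb hx (w := -w) (by rwa [norm_neg])
  obtain ⟨C, hC⟩ := abs_le_of_isBounded hb x hw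
  have hM : 0 < max (σ x w) (σ x (-w)) := lt_max_of_lt_left hA
  have hd : (max (σ x w) (σ x (-w)))⁻¹ ≤ dirDist Ω w x := by
    refine le_csInf ⟨|(|C| + 1)|, |C| + 1, rfl, fun hmem => ?_⟩ ?_
    · have := hC _ hmem
      rw [abs_of_pos (by positivity)] at this
      linarith [le_abs_self C]
    · rintro _ ⟨t, rfl, ht⟩
      by_contra! hlt
      have h1 := mul_lt_mul_of_pos_right hlt hM
      rw [inv_mul_cancel₀ hM.ne'] at h1
      rcases le_total 0 t with h0 | h0
      · rw [abs_of_nonneg h0] at h1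
        exact ht (h.mem_of_mul_lt hx h0
          (lt_of_le_of_lt (mul_le_mul_of_nonneg_left (le_max_left _ _) h0) h1))
      · rw [abs_of_nonpos h0] at h1
        have := h.mem_of_mul_lt hx (w := -w) (neg_nonneg.2 h0)
          (lt_of_le_of_lt (mul_le_mul_of_nonneg_left (le_max_right _ _) (neg_nonneg.2 h0)) h1)
        rw [smul_neg, neg_smul, neg_neg] at this
        exact ht this
  have hbdd : BddAbove {r : ℝ | ∃ t : ℝ, r = |t| ∧ x + t • w ∈ Ω} :=
    ⟨C, by rintro _ ⟨t, rfl, ht⟩; exact hC t ht⟩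
  have hr : (min (σ x w) (σ x (-w)))⁻¹ ≤ dirReach Ω w x := by
    have hm : 0 < min (σ x w) (σ x (-w)) := lt_min hA hB
    refine le_of_forall_lt fun c hc => ?_
    obtain ⟨t, hct, ht⟩ := exists_between (max_lt hc (inv_pos.2 hm))
    have ht0 : 0 < t := lt_of_le_of_lt (le_max_right _ _) hct
    refine lt_of_lt_of_le (lt_of_le_of_lt (le_max_left _ _) hct) (le_csSup hbdd ?_)
    have h1 := mul_lt_mul_of_pos_right ht hm
    rw [inv_mul_cancel₀ hm.ne'] at h1
    rcases min_choice (σ x w) (σ x (-w)) with h2 | h2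
    · rw [h2] at h1
      exact ⟨t, (abs_of_pos ht0).symm, h.mem_of_mul_lt hx ht0.le h1⟩
    · rw [h2] at h1
      have := h.mem_of_mul_lt hx ht0.le h1
      rw [smul_neg, ← neg_smul] at this
      exact ⟨-t, by rw [abs_neg, abs_of_pos ht0], this⟩
  have h1 : 1 / dirDist Ω w x ≤ max (σ x w) (σ x (-w)) := by
    rw [one_div]; exact inv_le_of_inv_le₀ hM hd
  have h2 : 1 / dirReach Ω w x ≤ min (σ x w) (σ x (-w)) := by
    rw [one_div]; exact inv_le_of_inv_le₀ (lt_min hA hB) hr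
  linarith [max_add_min (σ x w) (σ x (-w))]

theorem dirDist_nonneg (Ω : Set 𝔼) (w x : 𝔼) : 0 ≤ dirDist Ω w x :=
  Real.sInf_nonneg fun _ ⟨_, hr, _⟩ => hr ▸ abs_nonneg _

theorem dirReach_nonneg (Ω : Set 𝔼) (w x : 𝔼) : 0 ≤ dirReach Ω w x :=
  Real.sSup_nonneg fun _ ⟨_, hr, _⟩ => hr ▸ abs_nonneg _

theorem lintegral_mul_rpow_gauge (h : IsGauge Ω σ) (x : 𝔼) {c : ℝ} (β : ℝ) :
    ∫⁻ w : 𝕊, ENNReal.ofReal (c * (σ x w.1 + σ x (-w.1)) ^ β) ∂dS =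
      ENNReal.ofReal c * dirIntegral σ β x := by
  obtain ⟨m1, m2⟩ := measurable_gauge_sphere h
  have m3 : Measurable fun w : 𝕊 => σ x w.1 + σ x (-w.1) :=
    (m1.comp measurable_prodMk_left).add (m2.comp measurable_prodMk_left)
  rw [dirIntegral, ← lintegral_const_mul _ (m3.pow_const β).ennreal_ofReal]
  exact lintegral_congr fun w => ENNReal.ofReal_mul'
    (Real.rpow_nonneg (add_nonneg (h.nonneg _ _) (h.nonneg _ _)) _)

theorem two_mul_ofReal (a : ℝ) : 2 * ENNReal.ofReal a = ENNReal.ofReal (2 * a) := by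
  rw [ENNReal.ofReal_mul two_pos.le, ENNReal.ofReal_ofNat]

theorem measurable_rayMass {Y : Type*} [MeasurableSpace Y] {f g : Y → ℝ} (hf : Measurable f)
    (hg : Measurable g) : Measurable fun y => rayMass α V (f y) (g y) := by
  unfold rayMass
  fun_prop

/-- `ray_lower_bound` with `D = diam Ω`, integrated over the sphere after averaging over `w` and
`-w`. The truncation level does not depend on `Ω` or `x`. -/
theorem dirIntegral_lower_bound [NeZero n] (hα1 : 1 < α) (hα2 : α < 2) {δ : ℝ} (hδ : 0 < δ) :
    ∃ V : ℝ, 1 ≤ V ∧ ∀ {Ω : Set 𝔼} {σ : 𝔼 → 𝔼 → ℝ}, IsGauge Ω σ → Bornology.IsBounded Ω →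
      ∀ x ∈ Ω, 2 * (ENNReal.ofReal (truncInt ((α - 1) / 2) V / 2 ^ α) * dirIntegral σ α x) +
        (ENNReal.ofReal (lineKappa α) * dirIntegral σ α x +
          ENNReal.ofReal (lineLambda α * (1 / Metric.diam Ω)) * dirIntegral σ (α - 1) x) ≤
        2 * (∫⁻ w : 𝕊, ENNReal.ofReal (rayMass α V (σ x w.1) (σ x (-w.1))) ∂dS) +
          ENNReal.ofReal δ * dirIntegral σ α x := by
  obtain ⟨V, hV, H⟩ := ray_lower_bound hα1 hα2 hδ
  refine ⟨V, hV, fun {Ω σ} h hb x hx => ?_⟩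
  obtain ⟨m1, m2⟩ := measurable_gauge_sphere h
  have m3 : Measurable fun w : 𝕊 => σ x w.1 := m1.comp measurable_prodMk_left
  have m4 : Measurable fun w : 𝕊 => σ x (-w.1) := m2.comp measurable_prodMk_left
  have mq : ∀ c β : ℝ, Measurable fun w : 𝕊 =>
      ENNReal.ofReal (c * (σ x w.1 + σ x (-w.1)) ^ β) := fun c β =>
    (((m3.add m4).pow_const β).const_mul c).ennreal_ofReal
  have hs : ∀ w : 𝕊, 0 ≤ σ x w.1 + σ x (-w.1) := fun w => add_nonneg (h.nonneg _ _) (h.nonneg _ _)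
  have hT := truncInt_nonneg (p := (α - 1) / 2) hV
  have hk := lineKappa_nonneg hα1 hα2
  have hl : 0 ≤ lineLambda α * (1 / Metric.diam Ω) :=
    mul_nonneg (lineLambda_nonneg hα1) (one_div_nonneg.2 Metric.diam_nonneg)
  rw [two_mul_lintegral_rayMass hα1 hV h, ← lintegral_mul_rpow_gauge h,
    ← lintegral_mul_rpow_gauge h, ← lintegral_mul_rpow_gauge h, ← lintegral_mul_rpow_gauge h,
    ← lintegral_add_left (mq _ _), ← lintegral_const_mul _ (mq _ _),
    ← lintegral_add_left ((mq _ _).const_mul 2), ← lintegral_add_right _ (mq _ _)]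
  refine lintegral_mono fun w => ?_
  have hw : ‖w.1‖ = 1 := norm_eq_of_mem_sphere w
  have hp : ∀ β : ℝ, 0 ≤ (σ x w.1 + σ x (-w.1)) ^ β := fun β => Real.rpow_nonneg (hs w) β
  rw [two_mul_ofReal, ← ENNReal.ofReal_add (mul_nonneg hk (hp _))
    (mul_nonneg hl (hp _)), ← ENNReal.ofReal_add (mul_nonneg two_pos.le
    (mul_nonneg (by positivity) (hp _))) (add_nonneg (mul_nonneg hk (hp _))
    (mul_nonneg hl (hp _))), ← ENNReal.ofReal_add (add_nonneg
    (rayMass_nonneg hα1 hV (h.nonneg _ _) (h.nonneg _ _))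
    (rayMass_nonneg hα1 hV (h.nonneg _ _) (h.nonneg _ _))) (mul_nonneg hδ.le (hp _))]
  refine ENNReal.ofReal_le_ofReal (le_trans (le_of_eq ?_) (H (Metric.diam Ω) _ _ (h.pos hb hx hw)
    (h.pos hb hx (by rwa [norm_neg])) (h.inv_add_inv_le_diam hb hx hw)))
  rw [rayGround, Real.div_rpow (hs w) two_pos.le]
  ring

/-- The Hardy inequality with remainder in terms of the directional integrals of the gauge. -/
theorem directional_hardy [NeZero n] (hα1 : 1 < α) (hα2 : α < 2) (hΩ : IsOpen Ω)
    (hb : Bornology.IsBounded Ω) (h : IsGauge Ω σ) {u : 𝔼 → ℝ} (hu : IsCc Ω u) :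
    ENNReal.ofReal (lineKappa α) * (∫⁻ x in Ω, ENNReal.ofReal (u x ^ 2) * dirIntegral σ α x) +
        ENNReal.ofReal (lineLambda α * (1 / Metric.diam Ω)) *
          (∫⁻ x in Ω, ENNReal.ofReal (u x ^ 2) * dirIntegral σ (α - 1) x) ≤
      2 * regionalForm Ω α u := by
  have hm := hΩ.measurableSet
  have hum := hu.continuous.measurable
  have hP := lintegral_sq_mul_dirIntegral_ne_top hΩ h hu (β := α) (by linarith)
  have md := measurable_dirIntegral h α
  have md1 := measurable_dirIntegral h (α - 1)
  set P := ∫⁻ x in Ω, ENNReal.ofReal (u x ^ 2) * dirIntegral σ α x with hPdef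
  refine ENNReal.le_of_forall_pos_le_add fun ε hε _ => ?_
  -- With `P` finite, this slack contributes at most `ε` after integration.
  have hδ : 0 < (ε : ℝ) / (P.toReal + 1) := by positivity
  obtain ⟨V, hV, H⟩ := dirIntegral_lower_bound (n := n) hα1 hα2 hδ
  have hid := truncated_energy_identity hα1 hV hm h hum
  have hle := truncated_energy_le_regionalForm (α := α) (V := V) hm h hum
  rw [← hPdef] at hid
  set M := ∫⁻ x in Ω, ENNReal.ofReal (u x ^ 2) *
    ∫⁻ w : 𝕊, ENNReal.ofReal (rayMass α V (σ x w.1) (σ x (-w.1))) ∂dS with hMdef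
  set c := ENNReal.ofReal (truncInt ((α - 1) / 2) V / 2 ^ α)
  -- The ground state remainder is nonnegative and is dropped here.
  have h1 : M ≤ regionalForm Ω α u + c * P := by
    calc M ≤ _ := le_self_add
      _ = _ := hid.symm
      _ ≤ _ := by gcongr
  have mM : Measurable fun x : 𝔼 =>
      ∫⁻ w : 𝕊, ENNReal.ofReal (rayMass α V (σ x w.1) (σ x (-w.1))) ∂dS := by
    obtain ⟨m1, m2⟩ := measurable_gauge_sphere h
    exact Measurable.lintegral_prod_right' (measurable_rayMass m1 m2).ennreal_ofReal
  have h2 : 2 * (c * P) + (ENNReal.ofReal (lineKappa α) * P +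
      ENNReal.ofReal (lineLambda α * (1 / Metric.diam Ω)) *
        (∫⁻ x in Ω, ENNReal.ofReal (u x ^ 2) * dirIntegral σ (α - 1) x)) ≤
      2 * M + ENNReal.ofReal (ε / (P.toReal + 1)) * P := by
    rw [hPdef, hMdef, ← lintegral_const_mul _ (by fun_prop), ← lintegral_const_mul _ (by fun_prop),
      ← lintegral_const_mul _ (by fun_prop), ← lintegral_const_mul _ (by fun_prop),
      ← lintegral_const_mul _ (by fun_prop), ← lintegral_const_mul _ (by fun_prop),
      ← lintegral_add_left (by fun_prop), ← lintegral_add_left (by fun_prop),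
      ← lintegral_add_left (by fun_prop)]
    refine setLIntegral_mono' hm fun x hx => ?_
    calc _ = ENNReal.ofReal (u x ^ 2) * (2 * (c * dirIntegral σ α x) +
        (ENNReal.ofReal (lineKappa α) * dirIntegral σ α x +
          ENNReal.ofReal (lineLambda α * (1 / Metric.diam Ω)) * dirIntegral σ (α - 1) x)) := by ring
      _ ≤ _ := mul_le_mul_right (H h hb x hx) _
      _ = _ := by ring
  have hδP : ENNReal.ofReal (ε / (P.toReal + 1)) * P ≤ ε := by
    calc _ = ENNReal.ofReal (ε / (P.toReal + 1)) * ENNReal.ofReal P.toReal := by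
          rw [ENNReal.ofReal_toReal hP]
      _ ≤ ε := ?_
    rw [← ENNReal.ofReal_mul hδ.le, ← ENNReal.ofReal_coe_nnreal]
    refine ENNReal.ofReal_le_ofReal ?_
    rw [div_mul_eq_mul_div, div_le_iff₀ (by positivity)]
    nlinarith [ε.2, ENNReal.toReal_nonneg (a := P)]
  -- The coefficient `c` grows with `V`, but the same finite term stands on both sides and cancels.
  have hfin : 2 * (c * P) ≠ ∞ :=
    ENNReal.mul_ne_top (by simp) (ENNReal.mul_ne_top ENNReal.ofReal_ne_top hP)
  refine (ENNReal.add_le_add_iff_left hfin).1 (h2.trans ?_)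
  calc 2 * M + ENNReal.ofReal (ε / (P.toReal + 1)) * P
      ≤ 2 * (regionalForm Ω α u + c * P) + ε := by gcongr
    _ = _ := by ring

theorem lossSloaneM_rpow [NeZero n] {β : ℝ} (hβ : 0 < β) (x : 𝔼) :
    lossSloaneM Ω β x ^ β = ENNReal.ofReal (2 * Real.pi ^ (((n : ℝ) - 1) / 2) *
        Real.Gamma ((1 + β) / 2) / Real.Gamma (((n : ℝ) + β) / 2)) /
      ∫⁻ w : 𝕊, ENNReal.ofReal ((1 / dirDist Ω w.1 x + 1 / dirReach Ω w.1 x) ^ β) ∂dS := by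
  rw [lossSloaneM, ← ENNReal.rpow_mul, one_div_mul_cancel hβ.ne', ENNReal.rpow_one,
    lintegral_sphere_abs_rpow hβ]

theorem sphereMoment_pos [NeZero n] {β : ℝ} (hβ : 0 < β) :
    0 < 2 * Real.pi ^ (((n : ℝ) - 1) / 2) * Real.Gamma ((1 + β) / 2) /
      Real.Gamma (((n : ℝ) + β) / 2) := by
  have h1 := Real.Gamma_pos_of_pos (show 0 < (1 + β) / 2 by linarith)
  have h2 := Real.Gamma_pos_of_pos (show 0 < ((n : ℝ) + β) / 2 by positivity)
  have := Real.pi_pos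
  positivity

theorem mul_weightedInt_lossSloaneM_le [NeZero n] {β c : ℝ} (hβ : 0 < β) (hΩ : IsOpen Ω)
    (hb : Bornology.IsBounded Ω) (h : IsGauge Ω σ) (u : 𝔼 → ℝ) :
    ENNReal.ofReal (2 * Real.pi ^ (((n : ℝ) - 1) / 2) * Real.Gamma ((1 + β) / 2) /
        Real.Gamma (((n : ℝ) + β) / 2) * c) * weightedInt Ω (lossSloaneM Ω β) β u ≤
      ENNReal.ofReal c * ∫⁻ x in Ω, ENNReal.ofReal (u x ^ 2) * dirIntegral σ β x := by
  have hN := sphereMoment_pos (n := n) hβ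
  set N := 2 * Real.pi ^ (((n : ℝ) - 1) / 2) * Real.Gamma ((1 + β) / 2) /
    Real.Gamma (((n : ℝ) + β) / 2) with hNdef
  have hN0 : ENNReal.ofReal N ≠ 0 := by simpa using hN
  rw [mul_comm N c, ENNReal.ofReal_mul' hN.le, mul_assoc, weightedInt,
    ← lintegral_const_mul' _ _ ENNReal.ofReal_ne_top]
  gcongr ENNReal.ofReal c * ?_
  refine setLIntegral_mono' hΩ.measurableSet fun x hx => ?_
  rw [lossSloaneM_rpow hβ, ← hNdef, div_eq_mul_inv, ENNReal.inv_div (Or.inr ENNReal.ofReal_ne_top)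
    (Or.inr hN0), mul_left_comm, ENNReal.mul_div_cancel hN0 ENNReal.ofReal_ne_top]
  gcongr
  refine lintegral_mono fun w => ENNReal.ofReal_le_ofReal ?_
  exact Real.rpow_le_rpow (add_nonneg (one_div_nonneg.2 (dirDist_nonneg _ _ _))
    (one_div_nonneg.2 (dirReach_nonneg _ _ _)))
    (one_div_dirDist_add_le h hb hx (norm_eq_of_mem_sphere w)) hβ.le

/-- The first factor is the sphere moment in the numerator of `M_α^α`. The half comes from
`directional_hardy`, whose right-hand side is twice the form because opposite directions were added.
-/
theorem hardyKappa_eq (n : ℕ) (α : ℝ) : hardyKappa n α = 2 * Real.pi ^ (((n : ℝ) - 1) / 2) *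
    Real.Gamma ((1 + α) / 2) / Real.Gamma (((n : ℝ) + α) / 2) * (lineKappa α / 2) := by
  unfold hardyKappa lineKappa
  ring

theorem hardyLambda_eq (n : ℕ) (α : ℝ) : hardyLambda n α = 2 * Real.pi ^ (((n : ℝ) - 1) / 2) *
    Real.Gamma ((1 + (α - 1)) / 2) / Real.Gamma (((n : ℝ) + (α - 1)) / 2) *
      (lineLambda α / 2) := by
  unfold hardyLambda lineLambda
  rw [add_sub_cancel, add_sub_assoc]
  field_simp

theorem hardy_lossSloane [NeZero n] (hα1 : 1 < α) (hα2 : α < 2) (hΩ : IsOpen Ω)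
    (hb : Bornology.IsBounded Ω) {u : 𝔼 → ℝ} (hu : IsCc Ω u) :
    ENNReal.ofReal (hardyKappa n α) * weightedInt Ω (lossSloaneM Ω α) α u +
      ENNReal.ofReal (hardyLambda n α * (1 / Metric.diam Ω)) *
        weightedInt Ω (lossSloaneM Ω (α - 1)) (α - 1) u ≤ regionalForm Ω α u := by
  have h : IsGauge Ω (exitGauge Ω) := isGauge_exitGauge hΩ
  have h1 := mul_weightedInt_lossSloaneM_le (β := α) (c := lineKappa α / 2) (by linarith) hΩ hb h u
  have h2 := mul_weightedInt_lossSloaneM_le (β := α - 1)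
    (c := lineLambda α / 2 * (1 / Metric.diam Ω)) (by linarith) hΩ hb h u
  rw [← hardyKappa_eq] at h1
  rw [← mul_assoc, ← hardyLambda_eq] at h2
  have h3 := directional_hardy hα1 hα2 hΩ hb h hu
  have e : ∀ a : ℝ, ENNReal.ofReal a = 2 * ENNReal.ofReal (a / 2) := fun a => by
    rw [two_mul_ofReal, mul_div_cancel₀ _ two_ne_zero]
  rw [e (lineKappa α), e (lineLambda α * (1 / Metric.diam Ω)), mul_assoc, mul_assoc, ← mul_add,
    ENNReal.mul_le_mul_iff_right (by simp) (by simp)] at h3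
  refine (add_le_add h1 h2).trans (le_trans (le_of_eq ?_) h3)
  congr 3
  ring

end DirectionalHardy

/-! ### Supporting hyperplanes -/

section ConvexGeometry

variable {F : Type*} [NormedAddCommGroup F] [InnerProductSpace ℝ F] [CompleteSpace F]

theorem exists_unit_inner_pos_of_notMem {Ω : Set F} (hΩ : IsOpen Ω) (hne : Ω.Nonempty)
    (hc : Convex ℝ Ω) {y : F} (hy : y ∉ Ω) :
    ∃ e : F, ‖e‖ = 1 ∧ ∀ a ∈ Ω, 0 < inner ℝ e (a - y) := by
  obtain ⟨f, hf⟩ := geometric_hahn_banach_open_point hc hΩ hy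
  set g := (InnerProductSpace.toDual ℝ F).symm f
  have hg : ∀ a, inner ℝ g a = f a := fun a => InnerProductSpace.toDual_symm_apply
  have hg0 : g ≠ 0 := by
    obtain ⟨a, ha⟩ := hne
    intro h0
    have := hf a ha
    rw [← hg, ← hg, h0, inner_zero_left, inner_zero_left] at this
    exact lt_irrefl _ this
  have hn : 0 < ‖g‖ := norm_pos_iff.2 hg0
  refine ⟨-(‖g‖⁻¹ • g), by rw [norm_neg, norm_smul, norm_inv, norm_norm,
    inv_mul_cancel₀ hn.ne'], fun a ha => ?_⟩
  rw [inner_neg_left, real_inner_smul_left, inner_sub_right, hg, hg, ← mul_neg, neg_sub]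
  exact mul_pos (inv_pos.2 hn) (by linarith [hf a ha])

end ConvexGeometry

/-! ### The inequality on convex domains -/

noncomputable section ConvexHardy

variable {n : ℕ}

local notation "𝔼" => EuclideanSpace ℝ (Fin n)
local notation "𝕊" => Metric.sphere (0 : EuclideanSpace ℝ (Fin n)) 1
local notation "dS" => Measure.toSphere (volume : Measure (EuclideanSpace ℝ (Fin n)))

variable {Ω : Set (EuclideanSpace ℝ (Fin n))} {α : ℝ}

theorem compl_nonempty_of_isBounded [NeZero n] (hb : Bornology.IsBounded Ω) : Ωᶜ.Nonempty := by
  rw [nonempty_compl]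
  rintro rfl
  exact NormedSpace.unbounded_univ ℝ 𝔼 hb

/-- The distance to the complement is attained. -/
theorem exists_nearest_point [NeZero n] (hΩ : IsOpen Ω) (hb : Bornology.IsBounded Ω) {x : 𝔼}
    (hx : x ∈ Ω) : ∃ y ∉ Ω, 0 < dist x y ∧ distCompl Ω x = ENNReal.ofReal (dist x y) ∧
      Metric.ball x (dist x y) ⊆ Ω := by
  have hne := compl_nonempty_of_isBounded hb
  obtain ⟨y, hy, he⟩ := hΩ.isClosed_compl.exists_infDist_eq_dist hne x
  refine ⟨y, hy, dist_pos.2 fun h => hy (h ▸ hx), ?_, ?_⟩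
  · rw [← he, Metric.infDist, ENNReal.ofReal_toReal (Metric.infEDist_ne_top hne), distCompl]
  · intro z hz
    by_contra hzΩ
    rw [← he, Metric.mem_ball, dist_comm] at hz
    exact absurd (Metric.infDist_le_dist_of_mem (show z ∈ Ωᶜ from hzΩ)) (not_le.2 hz)

/-- The line in direction `w` meets the supporting hyperplane at the parameter `⟨e, y - x⟩/⟨e, w⟩`,
a point outside `Ω`; and `|⟨e, y - x⟩|` is at most `dist x y`. -/
theorem inner_div_le_one_div_dirDist {x y e w : 𝔼} (he : ‖e‖ = 1) (hw : ‖w‖ = 1)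
    (hpos : ∀ a ∈ Ω, 0 < inner ℝ e (a - y)) (hr : 0 < dist x y)
    (hball : Metric.ball x (dist x y) ⊆ Ω) :
    |inner ℝ e w| / dist x y ≤ 1 / dirDist Ω w x := by
  rcases eq_or_ne (inner ℝ e w) 0 with h0 | h0
  · rw [h0, abs_zero, zero_div]
    exact one_div_nonneg.2 (dirDist_nonneg _ _ _)
  · set t := inner ℝ e (y - x) / inner ℝ e w with ht
    have hmem : x + t • w ∉ Ω := by
      intro hm
      have h1 := hpos _ hm
      rw [show x + t • w - y = t • w - (y - x) by abel, inner_sub_right, real_inner_smul_right, ht,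
        div_mul_cancel₀ _ h0, sub_self] at h1
      exact lt_irrefl _ h1
    have hd1 : dirDist Ω w x ≤ |t| := csInf_le ⟨0, fun _ ⟨_, hs, _⟩ => hs ▸ abs_nonneg _⟩
      ⟨t, rfl, hmem⟩
    -- The inner ball makes `dirDist` positive, which is needed to clear denominators.
    have hd0 : dist x y ≤ dirDist Ω w x := by
      refine le_csInf ⟨|t|, t, rfl, hmem⟩ ?_
      rintro _ ⟨s, rfl, hs⟩
      by_contra! hlt
      refine hs (hball ?_)
      rwa [Metric.mem_ball, dist_self_add_left, norm_smul, hw, mul_one, Real.norm_eq_abs]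
    have hd2 : |t| * |inner ℝ e w| ≤ dist x y := by
      rw [← abs_mul, ht, div_mul_cancel₀ _ h0, dist_comm, dist_eq_norm]
      have := abs_real_inner_le_norm e (y - x)
      rwa [he, one_mul] at this
    rw [div_le_div_iff₀ hr (hr.trans_le hd0), one_mul, mul_comm]
    exact (mul_le_mul_of_nonneg_right hd1 (abs_nonneg _)).trans hd2

/-- Integrate the hyperplane bound over `w`. By rotation invariance the moment of `⟨e, w⟩` equals
that of a coordinate, which cancels the normalisation of `M_β`. -/
theorem lossSloaneM_rpow_le [NeZero n] {β : ℝ} (hβ : 0 < β) (hΩ : IsOpen Ω)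
    (hc : Convex ℝ Ω) (hb : Bornology.IsBounded Ω) {x : 𝔼} (hx : x ∈ Ω) :
    lossSloaneM Ω β x ^ β ≤ distCompl Ω x ^ β := by
  obtain ⟨y, hy, hr, hd, hball⟩ := exists_nearest_point hΩ hb hx
  obtain ⟨e, he, hpos⟩ := exists_unit_inner_pos_of_notMem hΩ ⟨x, hx⟩ hc hy
  have hN := sphereMoment_pos (n := n) hβ
  rw [lossSloaneM_rpow hβ, hd, ENNReal.ofReal_rpow_of_pos hr]
  have i : Fin n := ⟨0, Nat.pos_of_ne_zero (NeZero.ne n)⟩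
  have hmom := (lintegral_sphere_inner he i β).trans (lintegral_sphere_abs_rpow hβ i)
  rw [← hmom]
  refine ENNReal.div_le_of_le_mul' ?_
  rw [← lintegral_mul_const' _ _ ENNReal.ofReal_ne_top]
  refine lintegral_mono fun w => ?_
  have hw : ‖w.1‖ = 1 := norm_eq_of_mem_sphere w
  have h1 := inner_div_le_one_div_dirDist he hw hpos hr hball
  have h2 := one_div_nonneg.2 (dirReach_nonneg Ω w.1 x)
  have h3 := one_div_nonneg.2 (dirDist_nonneg Ω w.1 x)
  rw [← ENNReal.ofReal_mul (by positivity), ← Real.mul_rpow (by positivity) dist_nonneg]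
  refine ENNReal.ofReal_le_ofReal (Real.rpow_le_rpow (abs_nonneg _) ?_ hβ.le)
  rw [div_le_iff₀ hr] at h1
  exact h1.trans (mul_le_mul_of_nonneg_right (by linarith) dist_nonneg)

theorem weightedInt_distCompl_le [NeZero n] {β : ℝ} (hβ : 0 < β) (hΩ : IsOpen Ω)
    (hc : Convex ℝ Ω) (hb : Bornology.IsBounded Ω) (u : 𝔼 → ℝ) :
    weightedInt Ω (distCompl Ω) β u ≤ weightedInt Ω (lossSloaneM Ω β) β u :=
  setLIntegral_mono' hΩ.measurableSet fun _ hx =>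
    ENNReal.div_le_div_left (lossSloaneM_rpow_le hβ hΩ hc hb hx) _

theorem hardy_convex [NeZero n] (hα1 : 1 < α) (hα2 : α < 2) (hΩ : IsOpen Ω)
    (hc : Convex ℝ Ω) (hb : Bornology.IsBounded Ω) {u : 𝔼 → ℝ} (hu : IsCc Ω u) :
    ENNReal.ofReal (hardyKappa n α) * weightedInt Ω (distCompl Ω) α u +
      ENNReal.ofReal (hardyLambda n α * (1 / Metric.diam Ω)) *
        weightedInt Ω (distCompl Ω) (α - 1) u ≤ regionalForm Ω α u := by
  have h1 := weightedInt_distCompl_le (β := α) (by linarith) hΩ hc hb u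
  have h2 := weightedInt_distCompl_le (β := α - 1) (by linarith) hΩ hc hb u
  refine le_trans ?_ (hardy_lossSloane hα1 hα2 hΩ hb hu)
  gcongr

end ConvexHardy

/-! ### The half-space, where the inequality is asymptotically an equality -/

noncomputable section HalfSpace

open Filter Topology

variable {n : ℕ}

local notation "𝔼" => EuclideanSpace ℝ (Fin n)
local notation "𝕊" => Metric.sphere (0 : EuclideanSpace ℝ (Fin n)) 1
local notation "dS" => Measure.toSphere (volume : Measure (EuclideanSpace ℝ (Fin n)))

/-- The open half-space with inner unit normal `e` and `p` on its boundary. -/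
def halfSpace (e p : 𝔼) : Set 𝔼 := {x | 0 < inner ℝ e (x - p)}

/-- The reciprocal exit time from the half-space. -/
def halfGauge (e p x z : 𝔼) : ℝ := max 0 (-inner ℝ e z / inner ℝ e (x - p))

variable {e p : EuclideanSpace ℝ (Fin n)} {α : ℝ}

theorem isOpen_halfSpace (e p : 𝔼) : IsOpen (halfSpace e p) :=
  isOpen_lt continuous_const (by fun_prop)

theorem isGauge_halfGauge (e p : 𝔼) : IsGauge (halfSpace e p) (halfGauge e p) := by
  refine ⟨fun x z => le_max_left _ _, ?_, fun x hx z t ht => ?_⟩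
  · unfold halfGauge
    fun_prop
  · have hx' : 0 < inner ℝ e (x - p) := hx
    have hmem : ∀ s : ℝ, x + s • z ∈ halfSpace e p ↔ 0 < inner ℝ e (x - p) + s * inner ℝ e z := by
      intro s
      change 0 < inner ℝ e (x + s • z - p) ↔ _
      rw [add_sub_right_comm, inner_add_right, real_inner_smul_right]
    simp only [hmem]
    set c : ℝ := inner ℝ e z
    set h : ℝ := inner ℝ e (x - p)
    constructor
    · intro H s hs
      have h1 : t * (-c / h) < 1 := lt_of_le_of_lt
        (mul_le_mul_of_nonneg_left (le_max_right _ _) ht.le) H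
      rw [mul_div_assoc', div_lt_one hx'] at h1
      rcases le_total 0 c with h0 | h0
      · have := mul_nonneg hs.1 h0
        linarith
      · nlinarith [hs.2]
    · intro H
      have h1 := H t ⟨ht.le, le_rfl⟩
      rw [halfGauge, mul_max_of_nonneg _ _ ht.le, mul_zero, mul_div_assoc']
      exact max_lt one_pos ((div_lt_one hx').2 (by linarith))

theorem halfGauge_add (e p x : 𝔼) (hx : x ∈ halfSpace e p) (z : 𝔼) :
    halfGauge e p x z + halfGauge e p x (-z) = |inner ℝ e z| / inner ℝ e (x - p) := by
  have hx' : 0 < inner ℝ e (x - p) := hx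
  unfold halfGauge
  rw [inner_neg_right, neg_neg, neg_div]
  set c : ℝ := inner ℝ e z
  rcases le_total 0 c with h0 | h0
  · have : 0 ≤ c / inner ℝ e (x - p) := by positivity
    rw [max_eq_left (by linarith), max_eq_right this, abs_of_nonneg h0, zero_add]
  · have : c / inner ℝ e (x - p) ≤ 0 := div_nonpos_of_nonpos_of_nonneg h0 hx'.le
    rw [max_eq_right (by linarith), max_eq_left this, abs_of_nonpos h0, add_zero, neg_div]

theorem halfGauge_eq_zero_or (e p x z : 𝔼) :
    halfGauge e p x z = 0 ∨ halfGauge e p x (-z) = 0 := by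
  unfold halfGauge
  rw [inner_neg_right, neg_neg, neg_div]
  rcases le_total 0 (inner ℝ e z / inner ℝ e (x - p)) with h0 | h0
  · exact Or.inl (max_eq_left (by linarith))
  · exact Or.inr (max_eq_left h0)

theorem halfSpace_dirIntegral [NeZero n] (he : ‖e‖ = 1) {β : ℝ} (hβ : 0 < β) {x : 𝔼}
    (hx : x ∈ halfSpace e p) :
    dirIntegral (halfGauge e p) β x = ENNReal.ofReal (2 * Real.pi ^ (((n : ℝ) - 1) / 2) *
        Real.Gamma ((1 + β) / 2) / Real.Gamma (((n : ℝ) + β) / 2)) *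
      ENNReal.ofReal (inner ℝ e (x - p) ^ (-β)) := by
  have hx' : 0 < inner ℝ e (x - p) := hx
  have i : Fin n := ⟨0, Nat.pos_of_ne_zero (NeZero.ne n)⟩
  rw [← lintegral_sphere_abs_rpow hβ i, ← lintegral_sphere_inner he i β,
    ← lintegral_mul_const' _ _ ENNReal.ofReal_ne_top, dirIntegral]
  refine lintegral_congr fun w => ?_
  rw [halfGauge_add e p x hx, ← ENNReal.ofReal_mul (by positivity),
    Real.div_rpow (abs_nonneg _) hx'.le, Real.rpow_neg hx'.le, div_eq_mul_inv]

theorem groundRatio_halfGauge {x y : 𝔼} (hx : x ∈ halfSpace e p) :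
    groundRatio (halfGauge e p) α (x, y) =
      (inner ℝ e (y - p) / inner ℝ e (x - p)) ^ ((α - 1) / 2) := by
  have hx' : 0 < inner ℝ e (x - p) := hx
  have hy : inner ℝ e (y - p) = inner ℝ e (x - p) + inner ℝ e (y - x) := by
    rw [← inner_add_right]; congr 1; abel
  have hz : inner ℝ e (x - y) = -inner ℝ e (y - x) := by rw [← inner_neg_right, neg_sub]
  simp only [groundRatio, halfGauge]
  congr 1
  rw [hy, hz, neg_neg]
  set c : ℝ := inner ℝ e (y - x)
  set h : ℝ := inner ℝ e (x - p)
  rcases le_total 0 c with h0 | h0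
  · have : 0 ≤ c / h := by positivity
    rw [neg_div, max_eq_left (by linarith), max_eq_right this]
    field_simp
    ring
  · have : c / h ≤ 0 := div_nonpos_of_nonpos_of_nonneg h0 hx'.le
    rw [neg_div, max_eq_right (by linarith), max_eq_left this]
    field_simp
    ring

/-- The ground state energy of `f` on the half-space. -/
def groundEnergy (e p : 𝔼) (α : ℝ) (f : 𝔼 → ℝ) : ℝ≥0∞ :=
  ∫⁻ x in halfSpace e p, ∫⁻ y in halfSpace e p,
    ENNReal.ofReal ((inner ℝ e (x - p) * inner ℝ e (y - p)) ^ ((α - 1) / 2) * (f x - f y) ^ 2) *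
      ENNReal.ofReal (‖x - y‖ ^ (-((n : ℝ) + α)))

/-- With `u = h^((α-1)/2) f` the remainder `ρu(x)² - 2u(x)u(y) + ρ⁻¹u(y)²` becomes
`(h(x)h(y))^((α-1)/2) (f(x) - f(y))²`. Equality is lost only because the truncated kernel omits
pairs. -/
theorem halfSpace_remainder_le {V : ℝ} {u f : 𝔼 → ℝ} (hu : Measurable u)
    (huf : ∀ x ∈ halfSpace e p, u x = inner ℝ e (x - p) ^ ((α - 1) / 2) * f x) :
    ∫⁻ q : 𝔼 × 𝔼, ENNReal.ofReal (groundRatio (halfGauge e p) α q * u q.1 ^ 2 -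
        2 * u q.1 * u q.2 + (groundRatio (halfGauge e p) α q)⁻¹ * u q.2 ^ 2) *
          truncKernel (halfSpace e p) (halfGauge e p) α V q ≤ groundEnergy e p α f := by
  have h := isGauge_halfGauge e p
  have hΩ := (isOpen_halfSpace e p).measurableSet
  have hK := measurable_truncKernel (α := α) (V := V) hΩ h
  have hρ := measurable_groundRatio (α := α) h
  unfold groundEnergy
  rw [Measure.volume_eq_prod, lintegral_prod _ (by fun_prop), ← lintegral_indicator hΩ]
  refine lintegral_mono fun x => ?_
  simp only
  by_cases hx : x ∈ halfSpace e p
  · rw [indicator_of_mem hx, ← lintegral_indicator hΩ]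
    refine lintegral_mono fun y => ?_
    by_cases hq : (x, y) ∈ truncRegion (halfSpace e p) (halfGauge e p) V
    · have hy := snd_mem_of_mem_truncRegion h hq
      have hx' : 0 < inner ℝ e (x - p) := hx
      have hy' : 0 < inner ℝ e (y - p) := hy
      rw [indicator_of_mem hy, truncKernel, indicator_of_mem hq]
      refine mul_le_mul_left (ENNReal.ofReal_le_ofReal (le_of_eq ?_)) _
      rw [groundRatio_halfGauge hx, huf x hx, huf y hy, Real.div_rpow hy'.le hx'.le,
        Real.mul_rpow hx'.le hy'.le]
      have h1 : 0 < inner ℝ e (x - p) ^ ((α - 1) / 2) := by positivity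
      have h2 : 0 < inner ℝ e (y - p) ^ ((α - 1) / 2) := by positivity
      field_simp
      ring
    · rw [truncKernel, indicator_of_notMem hq]
      simp
  · have : ∀ y, truncKernel (halfSpace e p) (halfGauge e p) α V (x, y) = 0 := fun y => by
      by_contra hne
      exact hx (mem_of_truncKernel_ne_zero hne).1
    simp [this]

/-- The same identity read in the other direction: one of the two gauges on each line vanishes, so
`ray_upper_bound` applies to every ray and the remainder is kept. -/
theorem halfSpace_truncated_energy_le [NeZero n] (hα1 : 1 < α) (hα2 : α < 2) {δ : ℝ} (hδ : 0 < δ) :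
    ∀ᶠ V : ℝ in atTop, ∀ {e p : 𝔼} {u f : 𝔼 → ℝ}, IsCc (halfSpace e p) u →
      (∀ x ∈ halfSpace e p, u x = inner ℝ e (x - p) ^ ((α - 1) / 2) * f x) →
      (1 / 2) * (∫⁻ q : 𝔼 × 𝔼, ENNReal.ofReal ((u q.1 - u q.2) ^ 2) *
          truncKernel (halfSpace e p) (halfGauge e p) α V q) ≤
        ENNReal.ofReal ((lineKappa α + δ) / 2) * (∫⁻ x in halfSpace e p,
          ENNReal.ofReal (u x ^ 2) * dirIntegral (halfGauge e p) α x) +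
            (1 / 2) * groundEnergy e p α f := by
  filter_upwards [eventually_ge_atTop 1, ray_upper_bound hα1 hα2 hδ] with V hV H e p u f hu huf
  have hΩo := isOpen_halfSpace e p
  have hΩ := hΩo.measurableSet
  have h := isGauge_halfGauge e p
  have hum := hu.continuous.measurable
  have hP := lintegral_sq_mul_dirIntegral_ne_top hΩo h hu (β := α) (by linarith)
  have hid := truncated_energy_identity hα1 hV hΩ h hum
  have hrem := halfSpace_remainder_le (α := α) (V := V) hum huf
  have md := measurable_dirIntegral h α
  have hT := truncInt_nonneg (p := (α - 1) / 2) hV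
  set c := ENNReal.ofReal (truncInt ((α - 1) / 2) V / 2 ^ α) with hc
  have hk := lineKappa_nonneg hα1 hα2
  have hM : (∫⁻ x in halfSpace e p, ENNReal.ofReal (u x ^ 2) *
      ∫⁻ w : 𝕊, ENNReal.ofReal (rayMass α V (halfGauge e p x w.1) (halfGauge e p x (-w.1))) ∂dS) ≤
      c * (∫⁻ x in halfSpace e p, ENNReal.ofReal (u x ^ 2) * dirIntegral (halfGauge e p) α x) +
        ENNReal.ofReal ((lineKappa α + δ) / 2) * (∫⁻ x in halfSpace e p,
          ENNReal.ofReal (u x ^ 2) * dirIntegral (halfGauge e p) α x) := by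
    rw [← add_mul, ← lintegral_const_mul _ (by fun_prop)]
    refine setLIntegral_mono' hΩ fun x hx => ?_
    rw [mul_left_comm]
    refine mul_le_mul_right ?_ _
    rw [← ENNReal.mul_le_mul_iff_right (a := 2) (by simp) (by simp),
      two_mul_lintegral_rayMass hα1 hV h, hc, ← ENNReal.ofReal_add (by positivity) (by positivity),
      ← mul_assoc, two_mul_ofReal, ← lintegral_mul_rpow_gauge h]
    refine lintegral_mono fun w => ENNReal.ofReal_le_ofReal ?_
    have key : ∀ A B : ℝ, 0 ≤ A → 0 ≤ B → A = 0 ∨ B = 0 → rayMass α V A B + rayMass α V B A ≤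
        2 * (truncInt ((α - 1) / 2) V / 2 ^ α + (lineKappa α + δ) / 2) * (A + B) ^ α := by
      intro A B hA hB hAB
      have hq := add_nonneg hA hB
      refine le_trans ?_ ((H (A + B) hq).trans (le_of_eq ?_))
      · rcases hAB with h0 | h0 <;> subst h0 <;> simp [add_comm]
      · rw [rayGround, add_zero, Real.div_rpow hq two_pos.le]
        ring
    exact key _ _ (h.nonneg _ _) (h.nonneg _ _) (halfGauge_eq_zero_or e p x w.1)
  refine (ENNReal.add_le_add_iff_right (ENNReal.mul_ne_top ENNReal.ofReal_ne_top hP)).1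
    (hid.le.trans ((add_le_add hM (mul_le_mul_right hrem _)).trans (le_of_eq ?_)))
  ring

theorem volume_hyperplane (he : ‖e‖ = 1) (x : 𝔼) :
    volume {y : 𝔼 | inner ℝ e (y - x) = 0} = 0 := by
  have h1 : (innerSL ℝ e).ker ≠ ⊤ := by
    intro htop
    have : e ∈ (innerSL ℝ e).ker := htop ▸ Submodule.mem_top
    rw [LinearMap.mem_ker] at this
    simp [he] at this
  have h2 := Measure.addHaar_submodule (volume : Measure 𝔼) _ h1
  rw [← measure_preimage_add_right volume (-x)] at h2
  convert h2 using 2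
  ext y
  simp [sub_eq_add_neg]

/-- Monotone convergence in `V`: the truncated regions exhaust the pairs in the half-space up to a
null set, while the upper bound does not depend on `V`. -/
theorem halfSpace_energy_le [NeZero n] (hα1 : 1 < α) (hα2 : α < 2) {δ : ℝ} (hδ : 0 < δ)
    (he : ‖e‖ = 1) {u f : 𝔼 → ℝ} (hu : IsCc (halfSpace e p) u)
    (huf : ∀ x ∈ halfSpace e p, u x = inner ℝ e (x - p) ^ ((α - 1) / 2) * f x) :
    regionalForm (halfSpace e p) α u ≤
      ENNReal.ofReal ((lineKappa α + δ) / 2) * (∫⁻ x in halfSpace e p,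
        ENNReal.ofReal (u x ^ 2) * dirIntegral (halfGauge e p) α x) +
          (1 / 2) * groundEnergy e p α f := by
  have h := isGauge_halfGauge e p
  have hΩ := (isOpen_halfSpace e p).measurableSet
  have hum := hu.continuous.measurable
  obtain ⟨V₀, hV₀⟩ := eventually_atTop.1 (halfSpace_truncated_energy_le (n := n) hα1 hα2 hδ)
  set V : ℕ → ℝ := fun k => V₀ + k with hVdef
  have hmeas : ∀ k, Measurable fun q : 𝔼 × 𝔼 => ENNReal.ofReal ((u q.1 - u q.2) ^ 2) *
      truncKernel (halfSpace e p) (halfGauge e p) α (V k) q := fun k => by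
    have := measurable_truncKernel (α := α) (V := V k) hΩ h
    fun_prop
  have hmono : Monotone fun k => fun q : 𝔼 × 𝔼 => ENNReal.ofReal ((u q.1 - u q.2) ^ 2) *
      truncKernel (halfSpace e p) (halfGauge e p) α (V k) q := by
    intro k l hkl q
    refine mul_le_mul_right ?_ _
    have hV : V k ≤ V l := by simp [hVdef, hkl]
    have hsub : truncRegion (halfSpace e p) (halfGauge e p) (V k) ⊆
        truncRegion (halfSpace e p) (halfGauge e p) (V l) := fun q hq => ⟨hq.1, hq.2.1,
      hq.2.2.trans (mul_le_mul_of_nonneg_right hV (add_nonneg (h.nonneg _ _) (h.nonneg _ _)))⟩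
    exact indicator_le_indicator_of_subset hsub (fun _ => zero_le) q
  have hsup : regionalForm (halfSpace e p) α u ≤ (1 / 2) * ⨆ k, ∫⁻ q : 𝔼 × 𝔼,
      ENNReal.ofReal ((u q.1 - u q.2) ^ 2) *
        truncKernel (halfSpace e p) (halfGauge e p) α (V k) q := by
    unfold regionalForm
    gcongr
    rw [← lintegral_iSup hmeas hmono, Measure.volume_eq_prod,
      lintegral_prod _ (Measurable.iSup hmeas).aemeasurable, ← lintegral_indicator hΩ]
    refine lintegral_mono fun x => ?_
    by_cases hx : x ∈ halfSpace e p
    · rw [indicator_of_mem hx, ← lintegral_indicator hΩ]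
      refine lintegral_mono_ae ?_
      -- If `y - x` is parallel to the boundary, both gauges vanish and the pair lies in no
      -- truncated region; such `y` form a hyperplane.
      have hnull : ∀ᵐ y : 𝔼, inner ℝ e (y - x) ≠ 0 := by
        rw [ae_iff]
        simpa using volume_hyperplane he x
      filter_upwards [hnull] with y hy
      by_cases hyH : y ∈ halfSpace e p
      · rw [indicator_of_mem hyH]
        have hx' : 0 < inner ℝ e (x - p) := hx
        have hy' : 0 < inner ℝ e (y - p) := hyH
        have hsum := halfGauge_add e p x hx (y - x)
        rw [neg_sub] at hsum
        have hpos : 0 < halfGauge e p x (y - x) + halfGauge e p x (x - y) := by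
          rw [hsum]
          exact div_pos (abs_pos.2 hy) hx'
        have hlt : halfGauge e p x (y - x) < 1 := by
          have e1 : inner ℝ e (y - x) = inner ℝ e (y - p) - inner ℝ e (x - p) := by
            rw [← inner_sub_right]; congr 1; abel
          rw [halfGauge, e1]
          exact max_lt one_pos ((div_lt_one hx').2 (by linarith))
        obtain ⟨k, hk⟩ := exists_nat_ge ((2 + halfGauge e p x (x - y) - halfGauge e p x (y - x)) /
          (halfGauge e p x (y - x) + halfGauge e p x (x - y)) - V₀)
        have hq : (x, y) ∈ truncRegion (halfSpace e p) (halfGauge e p) (V k) := by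
          refine ⟨hx, hlt, ?_⟩
          simp only
          rw [← div_le_iff₀ hpos]
          simp only [hVdef]
          linarith
        refine le_trans (le_of_eq ?_) (le_iSup _ k)
        rw [truncKernel, indicator_of_mem hq, ← ENNReal.ofReal_mul (by positivity),
          Real.rpow_neg (norm_nonneg _), div_eq_mul_inv]
      · rw [indicator_of_notMem hyH]
        exact zero_le
    · rw [indicator_of_notMem hx]
      exact zero_le
  refine hsup.trans ?_
  rw [ENNReal.mul_iSup]
  exact iSup_le fun k => hV₀ (V k) (by simp [hVdef]) hu huf

end HalfSpace

/-! ### A radial majorant for the ground state energy density -/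

noncomputable section RadialBound

/-- A radial majorant for the ground state energy density of a function with logarithmic
oscillation `k` at height `h`. -/
def radialBound (α k h r : ℝ) : ℝ :=
  if r ≤ h / 2 then 2 * k ^ 2 * h ^ (α - 3) * r ^ (2 : ℝ) else k ^ (α - 1) * r ^ (α - 1)

/-- The size of the energy produced by a logarithmic oscillation `k`. -/
def oscConst (α k : ℝ) : ℝ := 2 * k ^ 2 / (2 - α) + 2 * k ^ (α - 1)

theorem radialBound_nonneg {α k h r : ℝ} (hk : 0 ≤ k) (hh : 0 ≤ h) (hr : 0 ≤ r) :
    0 ≤ radialBound α k h r := by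
  unfold radialBound
  split_ifs <;> positivity

theorem oscConst_nonneg {α k : ℝ} (hα2 : α < 2) (hk : 0 ≤ k) : 0 ≤ oscConst α k := by
  have : 0 < 2 - α := by linarith
  unfold oscConst
  positivity

theorem measurable_radialBound (α k : ℝ) : Measurable fun q : ℝ × ℝ => radialBound α k q.1 q.2 := by
  unfold radialBound
  exact Measurable.ite (measurableSet_le (by fun_prop) (by fun_prop)) (by fun_prop) (by fun_prop)

/-- The near part is integrable at `0` because it behaves like `r^(1-α)` with `α < 2`; the far part
is `r^(-2)`. Both scale like `1/h`. -/
theorem lintegral_radialBound_le {α k h : ℝ} (hα2 : α < 2) (hk : 0 ≤ k)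
    (hh : 0 < h) : ∫⁻ r in Ioi (0 : ℝ), ENNReal.ofReal (radialBound α k h r * r ^ (-1 - α)) ≤
      ENNReal.ofReal (oscConst α k / h) := by
  have hh2 : 0 < h / 2 := by positivity
  have h2α : 0 < 2 - α := by linarith
  have i1 : IntervalIntegrable (fun r : ℝ => r ^ (1 - α)) volume 0 (h / 2) :=
    intervalIntegral.intervalIntegrable_rpow' (by linarith)
  have i2 := integrableOn_Ioi_rpow_of_lt (a := -2) (by norm_num) hh2
  have e1 : ∫⁻ r in Ioc 0 (h / 2), ENNReal.ofReal (radialBound α k h r * r ^ (-1 - α)) =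
      ENNReal.ofReal (2 * k ^ 2 * h ^ (α - 3) * ((h / 2) ^ (2 - α) / (2 - α))) := by
    have : ∫ r in Ioc 0 (h / 2), 2 * k ^ 2 * h ^ (α - 3) * r ^ (1 - α) =
        2 * k ^ 2 * h ^ (α - 3) * ((h / 2) ^ (2 - α) / (2 - α)) := by
      rw [integral_const_mul, ← intervalIntegral.integral_of_le hh2.le,
        integral_rpow (Or.inl (by linarith)), show 1 - α + 1 = 2 - α by ring,
        Real.zero_rpow h2α.ne', sub_zero]
    rw [← this, ofReal_integral_eq_lintegral_ofReal]
    · refine setLIntegral_congr_fun measurableSet_Ioc fun r hr => ?_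
      rw [radialBound, if_pos hr.2, mul_assoc, ← Real.rpow_add hr.1,
        show 2 + (-1 - α) = 1 - α by ring]
    · exact (i1.1.const_mul _ : _)
    · filter_upwards [ae_restrict_mem measurableSet_Ioc] with r hr
      have := hr.1
      simp only [Pi.zero_apply]
      positivity
  have e2 : ∫⁻ r in Ioi (h / 2), ENNReal.ofReal (radialBound α k h r * r ^ (-1 - α)) =
      ENNReal.ofReal (k ^ (α - 1) * (2 / h)) := by
    have : ∫ r in Ioi (h / 2), k ^ (α - 1) * r ^ (-2 : ℝ) = k ^ (α - 1) * (2 / h) := by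
      rw [integral_const_mul, integral_Ioi_rpow_of_lt (by norm_num) hh2,
        show (-2 : ℝ) + 1 = -1 by norm_num, Real.rpow_neg_one]
      field_simp
    rw [← this, ofReal_integral_eq_lintegral_ofReal]
    · refine setLIntegral_congr_fun measurableSet_Ioi fun r hr => ?_
      have hr' : h / 2 < r := hr
      rw [radialBound, if_neg (not_le.2 hr'), mul_assoc, ← Real.rpow_add (hh2.trans hr'),
        show α - 1 + (-1 - α) = -2 by ring]
    · exact i2.const_mul _
    · filter_upwards [ae_restrict_mem measurableSet_Ioi] with r hr
      have : 0 < r := hh2.trans hr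
      simp only [Pi.zero_apply]
      positivity
  rw [← Ioc_union_Ioi_eq_Ioi hh2.le]
  refine (lintegral_union_le _ _ _).trans ?_
  rw [e1, e2, ← ENNReal.ofReal_add (by positivity) (by positivity)]
  refine ENNReal.ofReal_le_ofReal ?_
  have h3 : (h / 2) ^ (2 - α) ≤ h ^ (2 - α) :=
    Real.rpow_le_rpow hh2.le (by linarith) h2α.le
  have h4 : h ^ (α - 3) * h ^ (2 - α) = h⁻¹ := by
    rw [← Real.rpow_add hh, show α - 3 + (2 - α) = -1 by ring, Real.rpow_neg_one]
  calc 2 * k ^ 2 * h ^ (α - 3) * ((h / 2) ^ (2 - α) / (2 - α)) + k ^ (α - 1) * (2 / h)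
      ≤ 2 * k ^ 2 * h ^ (α - 3) * (h ^ (2 - α) / (2 - α)) + k ^ (α - 1) * (2 / h) := by gcongr
    _ = 2 * k ^ 2 * (h ^ (α - 3) * h ^ (2 - α)) / (2 - α) + k ^ (α - 1) * (2 / h) := by ring
    _ = oscConst α k / h := by rw [h4, oscConst]; ring

/-- The pointwise bound of the ground state energy density. -/
theorem density_le_radialBound {α k s t d r : ℝ} (hα1 : 1 < α) (hα2 : α < 2) (hk : 0 ≤ k)
    (hs : 0 < s) (ht : 0 < t) (hr : 0 ≤ r) (hst : |s - t| ≤ r) (hd1 : d ^ 2 ≤ 1)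
    (hd2 : d ^ 2 * (s * t) ≤ k ^ 2 * r ^ 2) :
    (s * t) ^ ((α - 1) / 2) * d ^ 2 ≤ radialBound α k s r := by
  have hst0 : 0 < s * t := mul_pos hs ht
  unfold radialBound
  split_ifs with h
  -- Close points have comparable heights. The negative power `(st)^((α-3)/2)` is then at most `2
  -- s^(α-3)`, and the remaining factor `st` is absorbed by `hd2`.
  · have ht2 : s / 2 ≤ t := by linarith [(abs_le.1 hst).2]
    have h1 : (s * t) ^ ((α - 1) / 2) = (s * t) ^ ((α - 3) / 2) * (s * t) := by
      rw [← Real.rpow_add_one hst0.ne']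
      congr 1; ring
    have h2 : (s * t) ^ ((α - 3) / 2) ≤ (s * (s / 2)) ^ ((α - 3) / 2) :=
      Real.rpow_le_rpow_of_nonpos (by positivity) (by gcongr) (by linarith)
    have h3 : (s * (s / 2)) ^ ((α - 3) / 2) = s ^ (α - 3) * 2 ^ (-((α - 3) / 2)) := by
      rw [show s * (s / 2) = s ^ (2 : ℝ) * 2⁻¹ by rw [Real.rpow_two]; ring,
        Real.mul_rpow (by positivity) (by positivity), ← Real.rpow_mul hs.le,
        Real.inv_rpow (by positivity), ← Real.rpow_neg (by positivity)]
      congr 2; ring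
    have h4 : (2 : ℝ) ^ (-((α - 3) / 2)) ≤ 2 := by
      conv_rhs => rw [← Real.rpow_one 2]
      exact Real.rpow_le_rpow_of_exponent_le (by norm_num) (by linarith)
    calc (s * t) ^ ((α - 1) / 2) * d ^ 2
        = (s * t) ^ ((α - 3) / 2) * (d ^ 2 * (s * t)) := by rw [h1]; ring
      _ ≤ (s ^ (α - 3) * 2) * (k ^ 2 * r ^ 2) := by
          refine mul_le_mul (h2.trans ?_) hd2 (by positivity) (by positivity)
          rw [h3]
          gcongr
      _ = _ := by rw [Real.rpow_two]; ring
  -- For distant points, lowering the exponent of `d² ≤ 1` to `(α-1)/2` matches that of `st`, so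
  -- `hd2` can be raised to this power.
  · have h1 : d ^ 2 ≤ (d ^ 2) ^ ((α - 1) / 2) :=
      Real.self_le_rpow_of_le_one (sq_nonneg _) hd1 (by linarith)
    calc (s * t) ^ ((α - 1) / 2) * d ^ 2
        ≤ (s * t) ^ ((α - 1) / 2) * (d ^ 2) ^ ((α - 1) / 2) := by gcongr
      _ = (d ^ 2 * (s * t)) ^ ((α - 1) / 2) := by
          rw [Real.mul_rpow (sq_nonneg _) hst0.le, mul_comm]
      _ ≤ (k ^ 2 * r ^ 2) ^ ((α - 1) / 2) :=
          Real.rpow_le_rpow (by positivity) hd2 (by linarith)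
      _ = _ := by
          rw [← Real.rpow_two, ← Real.rpow_two, Real.mul_rpow (by positivity) (by positivity),
            ← Real.rpow_mul hk, ← Real.rpow_mul hr]
          congr 2 <;> ring

end RadialBound

/-! ### The ground state energy of a slowly varying cutoff -/

noncomputable section GroundEnergyBound

variable {n : ℕ}

local notation "𝔼" => EuclideanSpace ℝ (Fin n)
local notation "dS" => Measure.toSphere (volume : Measure (EuclideanSpace ℝ (Fin n)))

variable {e p : EuclideanSpace ℝ (Fin n)} {α : ℝ}

theorem lintegral_radialBound_norm_le [NeZero n] (hα2 : α < 2) {k h : ℝ}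
    (hk : 0 ≤ k) (hh : 0 < h) (x : 𝔼) :
    ∫⁻ y : 𝔼, ENNReal.ofReal (radialBound α k h ‖x - y‖) *
        ENNReal.ofReal (‖x - y‖ ^ (-((n : ℝ) + α))) ≤
      ENNReal.ofReal (oscConst α k / h) * dS univ := by
  have hm : Measurable fun r => radialBound α k h r :=
    (measurable_radialBound α k).comp (by fun_prop : Measurable fun r : ℝ => (h, r))
  rw [lintegral_sub_left_eq_self (fun y : 𝔼 => ENNReal.ofReal (radialBound α k h ‖y‖) *
        ENNReal.ofReal (‖y‖ ^ (-((n : ℝ) + α)))) x,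
    lintegral_eq_lintegral_sphere volume (by fun_prop)]
  refine (lintegral_mono fun w => (le_of_eq ?_).trans
    (lintegral_radialBound_le hα2 hk hh)).trans (by rw [lintegral_const])
  refine setLIntegral_congr_fun measurableSet_Ioi fun r (hr : 0 < r) => ?_
  have h1 : ‖r • w.1‖ = r := by
    rw [norm_smul, Real.norm_of_nonneg hr.le, norm_eq_of_mem_sphere, mul_one]
  simp only [h1, finrank_euclideanSpace, Fintype.card_fin]
  have h0 := radialBound_nonneg (α := α) hk hh.le hr.le
  rw [← ENNReal.ofReal_mul h0, ← ENNReal.ofReal_mul (by positivity), mul_left_comm,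
    ← Real.rpow_natCast, ← Real.rpow_add hr, Nat.cast_sub (NeZero.one_le), Nat.cast_one,
    show (n : ℝ) - 1 + -((n : ℝ) + α) = -1 - α by ring]

theorem abs_inner_sub_le (he : ‖e‖ = 1) (x y : 𝔼) :
    |inner ℝ e (x - p) - inner ℝ e (y - p)| ≤ ‖x - y‖ := by
  rw [← inner_sub_right, sub_sub_sub_cancel_right]
  simpa [he] using abs_real_inner_le_norm e (x - y)

/-- A pair contributes only if one of its points lies in `S`. It is charged to that point, whence
the factor `2`, and the radial majorant around it integrates to `oscConst / h`. -/
theorem groundEnergy_le [NeZero n] (hα1 : 1 < α) (hα2 : α < 2) (he : ‖e‖ = 1) {k : ℝ} (hk : 0 ≤ k)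
    {f : 𝔼 → ℝ} {S : Set 𝔼} (hS : MeasurableSet S) (hSH : S ⊆ halfSpace e p)
    (hf0 : ∀ x ∈ halfSpace e p, x ∉ S → f x = 0)
    (hf1 : ∀ x ∈ halfSpace e p, ∀ y ∈ halfSpace e p, (f x - f y) ^ 2 ≤ 1)
    (hf2 : ∀ x ∈ halfSpace e p, ∀ y ∈ halfSpace e p,
      (f x - f y) ^ 2 * (inner ℝ e (x - p) * inner ℝ e (y - p)) ≤ k ^ 2 * ‖x - y‖ ^ 2) :
    groundEnergy e p α f ≤ 2 * (ENNReal.ofReal (oscConst α k) * dS univ *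
      ∫⁻ x in S, ENNReal.ofReal (inner ℝ e (x - p))⁻¹) := by
  set G : 𝔼 → 𝔼 → ℝ≥0∞ := fun x y => S.indicator 1 x *
    (ENNReal.ofReal (radialBound α k (inner ℝ e (x - p)) ‖x - y‖) *
        ENNReal.ofReal (‖x - y‖ ^ (-((n : ℝ) + α)))) with hG
  have hGm : Measurable fun q : 𝔼 × 𝔼 => G q.1 q.2 := by
    have h1 : Measurable (S.indicator (1 : 𝔼 → ℝ≥0∞)) := measurable_one.indicator hS
    have h2 : Measurable fun q : 𝔼 × 𝔼 => radialBound α k (inner ℝ e (q.1 - p)) ‖q.1 - q.2‖ :=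
      (measurable_radialBound α k).comp
        (by fun_prop : Measurable fun q : 𝔼 × 𝔼 => (inner ℝ e (q.1 - p), ‖q.1 - q.2‖))
    exact (h1.comp measurable_fst).mul (h2.ennreal_ofReal.mul (by fun_prop))
  have hGm' : Measurable fun q : 𝔼 × 𝔼 => G q.2 q.1 := hGm.comp measurable_swap
  have hGint : ∫⁻ x, ∫⁻ y, G x y ≤ ENNReal.ofReal (oscConst α k) * dS univ *
      ∫⁻ x in S, ENNReal.ofReal (inner ℝ e (x - p))⁻¹ := by
    rw [← lintegral_const_mul _ (by fun_prop), ← lintegral_indicator hS]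
    refine lintegral_mono fun x => ?_
    by_cases hx : x ∈ S
    · have hx' : 0 < inner ℝ e (x - p) := hSH hx
      simp only [hG, indicator_of_mem hx, Pi.one_apply, one_mul]
      refine (lintegral_radialBound_norm_le hα2 hk hx' x).trans (le_of_eq ?_)
      rw [div_eq_mul_inv, ENNReal.ofReal_mul (oscConst_nonneg hα2 hk)]
      ring
    · simp [hG, indicator_of_notMem hx]
  have hle : groundEnergy e p α f ≤ ∫⁻ x, ∫⁻ y, (G x y + G y x) := by
    unfold groundEnergy
    refine (setLIntegral_mono' (isOpen_halfSpace e p).measurableSet fun x hx =>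
      (setLIntegral_mono' (isOpen_halfSpace e p).measurableSet fun y hy => ?_).trans
        (setLIntegral_le_lintegral _ _)).trans (setLIntegral_le_lintegral _ _)
    have hx' : 0 < inner ℝ e (x - p) := hx
    have hy' : 0 < inner ℝ e (y - p) := hy
    by_cases hxS : x ∈ S
    · refine le_trans ?_ le_self_add
      simp only [hG, indicator_of_mem hxS, Pi.one_apply, one_mul]
      gcongr
      exact density_le_radialBound hα1 hα2 hk hx' hy' (norm_nonneg _) (abs_inner_sub_le he x y)
        (hf1 x hx y hy) (hf2 x hx y hy)
    by_cases hyS : y ∈ S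
    · refine le_trans ?_ le_add_self
      simp only [hG, indicator_of_mem hyS, Pi.one_apply, one_mul, norm_sub_rev y x]
      gcongr
      rw [mul_comm (inner ℝ e (x - p)), sub_sq_comm]
      refine density_le_radialBound hα1 hα2 hk hy' hx' (norm_nonneg _) ?_
        (hf1 y hy x hx) (by rw [norm_sub_rev]; exact hf2 y hy x hx)
      rw [norm_sub_rev]
      exact abs_inner_sub_le he y x
    · simp [hf0 x hx hxS, hf0 y hy hyS]
  refine hle.trans ?_
  have h1 : ∀ x, ∫⁻ y, (G x y + G y x) = (∫⁻ y, G x y) + ∫⁻ y, G y x := fun x =>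
    lintegral_add_left (hGm.comp measurable_prodMk_left) _
  simp only [h1]
  rw [lintegral_add_left hGm.lintegral_prod_right', two_mul]
  refine add_le_add hGint ((le_of_eq ?_).trans hGint)
  exact lintegral_lintegral_swap hGm'.aemeasurable

end GroundEnergyBound

/-! ### Logarithmic oscillation -/

section LogOscillation

/-- The geometric mean is at most the logarithmic mean. With `s = e^A`, `t = e^B` this is `|z| ≤
|sinh z|` at `z = (A-B)/2`. -/
theorem sq_log_sub_log_mul_le {s t : ℝ} (hs : 0 < s) (ht : 0 < t) :
    (Real.log s - Real.log t) ^ 2 * (s * t) ≤ (s - t) ^ 2 := by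
  obtain ⟨A, rfl⟩ : ∃ A, Real.exp A = s := ⟨_, Real.exp_log hs⟩
  obtain ⟨B, rfl⟩ : ∃ B, Real.exp B = t := ⟨_, Real.exp_log ht⟩
  rw [Real.log_exp, Real.log_exp]
  have h1 : Real.exp A - Real.exp B =
      Real.exp ((A + B) / 2) * (2 * Real.sinh ((A - B) / 2)) := by
    rw [Real.sinh_eq, mul_div_cancel₀ _ two_ne_zero, mul_sub, ← Real.exp_add, ← Real.exp_add]
    congr 2 <;> ring
  have h2 : Real.exp A * Real.exp B = Real.exp ((A + B) / 2) ^ 2 := by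
    rw [← Real.exp_add, sq, ← Real.exp_add]
    congr 1; ring
  have h3 : ((A - B) / 2) ^ 2 ≤ Real.sinh ((A - B) / 2) ^ 2 := by
    rcases le_total 0 ((A - B) / 2) with h | h
    · exact pow_le_pow_left₀ h (Real.self_le_sinh_iff.2 h) 2
    · have := Real.sinh_le_self_iff.2 h
      nlinarith
  rw [h1, h2, mul_pow, mul_pow, mul_comm]
  gcongr
  linarith

theorem abs_log_max_sub_log_max_le {s t a : ℝ} (hs : 0 < s) (ht : 0 < t) (ha : 0 < a) :
    |Real.log (max s a) - Real.log (max t a)| ≤ |Real.log s - Real.log t| := by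
  have h : ∀ {x : ℝ}, 0 < x → Real.log (max x a) = max (Real.log x) (Real.log a) := fun hx =>
    Real.strictMonoOn_log.monotoneOn.map_max hx ha
  rw [h hs, h ht]
  exact abs_max_sub_max_le_abs _ _ _

end LogOscillation

/-! ### The logarithmic cutoff -/

noncomputable section LogCutoff

/-- The cutoff at height `h` and distance `N`: logarithmic around `m` in `h`, linear in `N`. -/
def logCutoff (m L R h N : ℝ) : ℝ :=
  max 0 (1 - |Real.log (max h (m * Real.exp (-L))) - Real.log m| / L - N / R)

variable {m L R : ℝ}

theorem logCutoff_nonneg (m L R h N : ℝ) : 0 ≤ logCutoff m L R h N := le_max_left _ _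

theorem logCutoff_le_one (hL : 0 < L) (hR : 0 < R) {h N : ℝ} (hN : 0 ≤ N) :
    logCutoff m L R h N ≤ 1 := by
  refine max_le zero_le_one ?_
  have : 0 ≤ |Real.log (max h (m * Real.exp (-L))) - Real.log m| / L := by positivity
  have : 0 ≤ N / R := by positivity
  linarith

theorem abs_log_lt_of_logCutoff_pos (hL : 0 < L) (hR : 0 < R) {h N : ℝ} (hN : 0 ≤ N)
    (hpos : 0 < logCutoff m L R h N) :
    |Real.log (max h (m * Real.exp (-L))) - Real.log m| < L ∧ N < R := by
  have h1 := (lt_max_iff.1 hpos).resolve_left (lt_irrefl _)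
  have h2 : 0 ≤ |Real.log (max h (m * Real.exp (-L))) - Real.log m| / L := by positivity
  have h3 : 0 ≤ N / R := by positivity
  constructor
  · rw [← div_lt_one hL]; linarith
  · rw [← div_lt_one hR]; linarith

theorem mem_of_logCutoff_pos (hm : 0 < m) (hL : 0 < L) (hR : 0 < R) {h N : ℝ} (hN : 0 ≤ N)
    (hpos : 0 < logCutoff m L R h N) :
    m * Real.exp (-L) < h ∧ h < m * Real.exp L ∧ N < R := by
  obtain ⟨h1, h2⟩ := abs_log_lt_of_logCutoff_pos hL hR hN hpos
  have ha : 0 < m * Real.exp (-L) := by positivity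
  have hla : Real.log (m * Real.exp (-L)) = Real.log m - L := by
    rw [Real.log_mul hm.ne' (Real.exp_pos _).ne', Real.log_exp]; ring
  have hlb : Real.log (m * Real.exp L) = Real.log m + L := by
    rw [Real.log_mul hm.ne' (Real.exp_pos _).ne', Real.log_exp]
  obtain ⟨h3, h4⟩ := abs_lt.1 h1
  -- At or below the floor `m e^(-L)` the logarithmic term already equals `1`, so the cutoff
  -- vanishes there.
  have h5 : m * Real.exp (-L) < h := by
    by_contra! hle
    rw [max_eq_right hle, hla] at h3
    linarith
  refine ⟨h5, ?_, h2⟩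
  rw [max_eq_left h5.le] at h4
  rw [← Real.log_lt_log_iff (ha.trans h5) (by positivity), hlb]
  linarith

/-- The part in the height is `1/L`-Lipschitz in `log h`, which `sq_log_sub_log_mul_le` converts to
`r/L`. The part in the distance has slope `1/R`, and `√(st) ≤ m e^L ≤ R/L` on the support. Hence the
oscillation constant `2/L`. -/
theorem logCutoff_sub_le (hm : 0 < m) (hL : 0 < L) (hR : m * Real.exp L * L ≤ R)
    {s t M N r : ℝ} (hs : 0 < s) (ht : 0 < t) (hM : 0 ≤ M) (hst : |s - t| ≤ r)
    (hMN : |M - N| ≤ r) :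
    (logCutoff m L R s M - logCutoff m L R t N) * Real.sqrt (s * t) ≤ 2 / L * r := by
  have hr : 0 ≤ r := (abs_nonneg _).trans hst
  have hb : 0 < m * Real.exp L := by positivity
  have hR0 : 0 < R := lt_of_lt_of_le (by positivity) hR
  have hq : 0 ≤ Real.sqrt (s * t) := Real.sqrt_nonneg _
  have hN0 := logCutoff_nonneg m L R t N
  rcases (logCutoff_nonneg m L R s M).eq_or_lt with h0 | h0
  · rw [← h0, zero_sub, neg_mul]
    have : 0 ≤ logCutoff m L R t N * Real.sqrt (s * t) := by positivity
    have : 0 ≤ 2 / L * r := by positivity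
    linarith
  have ha : 0 < m * Real.exp (-L) := by positivity
  obtain ⟨hsa, hsb, -⟩ := mem_of_logCutoff_pos hm hL hR0 hM h0
  have hlog : |Real.log s - Real.log t| * Real.sqrt (s * t) ≤ r := by
    refine le_trans ?_ hst
    rw [← abs_of_nonneg hq, ← abs_mul]
    refine sq_le_sq.1 ?_
    rw [mul_pow, Real.sq_sqrt (by positivity)]
    exact sq_log_sub_log_mul_le hs ht
  have hlmax := abs_log_max_sub_log_max_le hs ht ha
  set g := |Real.log s - Real.log t|
  set X := Real.log (max s (m * Real.exp (-L)))
  set Y := Real.log (max t (m * Real.exp (-L)))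
  have hXY : |Y - Real.log m| ≤ |X - Real.log m| + g := by
    have := abs_sub_abs_le_abs_sub (Y - Real.log m) (X - Real.log m)
    rw [sub_sub_sub_cancel_right, abs_sub_comm Y X] at this
    linarith
  have hfs : logCutoff m L R s M = 1 - |X - Real.log m| / L - M / R :=
    max_eq_right ((lt_max_iff.1 h0).resolve_left (lt_irrefl _)).le
  have hft : 1 - |Y - Real.log m| / L - N / R ≤ logCutoff m L R t N := le_max_right _ _
  have hdiv : |Y - Real.log m| / L ≤ |X - Real.log m| / L + g / L := by
    rw [← add_div]; gcongr
  have hgL : g / L * Real.sqrt (s * t) ≤ 1 / L * r := by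
    rw [div_mul_eq_mul_div, one_div_mul_eq_div]
    gcongr
  rcases le_or_gt t (m * Real.exp L) with htb | htb
  · have hq2 : Real.sqrt (s * t) ≤ m * Real.exp L := by
      rw [Real.sqrt_le_left hb.le, sq]
      gcongr
    have h1 : logCutoff m L R s M - logCutoff m L R t N ≤ g / L + r / R := by
      have h2 : (N - M) / R ≤ r / R := by
        gcongr
        linarith [(abs_le.1 hMN).1]
      rw [sub_div] at h2
      linarith
    have h3 : r / R * Real.sqrt (s * t) ≤ 1 / L * r := by
      rw [div_mul_eq_mul_div, one_div_mul_eq_div, div_le_div_iff₀ hR0 hL, mul_assoc]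
      gcongr
      exact (mul_le_mul_of_nonneg_right hq2 hL.le).trans hR
    calc _ ≤ (g / L + r / R) * Real.sqrt (s * t) := mul_le_mul_of_nonneg_right h1 hq
      _ ≤ 1 / L * r + 1 / L * r := by rw [add_mul]; exact add_le_add hgL h3
      _ = _ := by ring
  -- Above height `m e^L` the bound on `√(st)` fails, but the cutoff at `t` vanishes and the
  -- logarithmic part alone controls the difference.
  · have hYL : L ≤ |Y - Real.log m| := by
      refine le_trans ?_ (le_abs_self _)
      have h1 : Real.log (m * Real.exp L) ≤ Y :=
        Real.log_le_log hb (htb.le.trans (le_max_left _ _))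
      rw [Real.log_mul hm.ne' (Real.exp_pos _).ne', Real.log_exp] at h1
      linarith
    have h1 : 1 ≤ |Y - Real.log m| / L := (one_le_div hL).2 hYL
    have h2 : 0 ≤ M / R := by positivity
    have h3 : logCutoff m L R s M - logCutoff m L R t N ≤ g / L := by linarith
    calc _ ≤ g / L * Real.sqrt (s * t) := mul_le_mul_of_nonneg_right h3 hq
      _ ≤ 1 / L * r := hgL
      _ ≤ _ := by gcongr; norm_num

theorem sq_logCutoff_sub_mul_le (hm : 0 < m) (hL : 0 < L) (hR : m * Real.exp L * L ≤ R)
    {s t M N r : ℝ} (hs : 0 < s) (ht : 0 < t) (hM : 0 ≤ M) (hN : 0 ≤ N) (hst : |s - t| ≤ r)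
    (hMN : |M - N| ≤ r) :
    (logCutoff m L R s M - logCutoff m L R t N) ^ 2 * (s * t) ≤ (2 / L) ^ 2 * r ^ 2 := by
  have h1 := logCutoff_sub_le hm hL hR hs ht hM hst hMN
  have h2 := logCutoff_sub_le hm hL hR ht hs hN ((abs_sub_comm t s).le.trans hst)
    ((abs_sub_comm N M).le.trans hMN)
  rw [mul_comm t s] at h2
  rw [← Real.sq_sqrt (show 0 ≤ s * t by positivity), ← mul_pow, ← mul_pow]
  exact sq_le_sq' (by linarith) h1

theorem logCutoff_ge (hm : 0 < m) (hL : 0 < L) (hR : 0 < R) {h N : ℝ}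
    (h1 : m * Real.exp (-(L / 2)) < h) (h2 : h < m * Real.exp (L / 2)) (hN : N ≤ R / 4) :
    1 / 4 ≤ logCutoff m L R h N := by
  have hh : 0 < h := lt_trans (by positivity) h1
  have ha : m * Real.exp (-L) ≤ h := by
    refine le_trans ?_ h1.le
    gcongr
    linarith
  refine le_trans ?_ (le_max_right _ _)
  rw [max_eq_left ha]
  have h3 : |Real.log h - Real.log m| ≤ L / 2 := by
    have e1 := Real.log_lt_log (by positivity) h1
    have e2 := Real.log_lt_log hh h2
    rw [Real.log_mul hm.ne' (Real.exp_pos _).ne', Real.log_exp] at e1 e2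
    exact abs_le.2 ⟨by linarith, by linarith⟩
  have h4 : |Real.log h - Real.log m| / L ≤ 1 / 2 := by
    rw [div_le_iff₀ hL]; linarith
  have h5 : N / R ≤ 1 / 4 := by
    rw [div_le_iff₀ hR]; linarith
  linarith

theorem continuous_logCutoff (hm : 0 < m) :
    Continuous fun q : ℝ × ℝ => logCutoff m L R q.1 q.2 := by
  unfold logCutoff
  have : ∀ q : ℝ × ℝ, max q.1 (m * Real.exp (-L)) ≠ 0 := fun q =>
    (lt_of_lt_of_le (by positivity : 0 < m * Real.exp (-L)) (le_max_right _ _)).ne'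
  have h : Continuous fun q : ℝ × ℝ => Real.log (max q.1 (m * Real.exp (-L))) :=
    Continuous.log (by fun_prop) this
  fun_prop

end LogCutoff

/-! ### Integrals of the inverse height over boxes -/

section Boxes

variable {n : ℕ}

local notation "𝔼" => EuclideanSpace ℝ (Fin n)

/-- Integrals of functions of the height over a hyperplane and of the distance from a point of it. -/
theorem lintegral_height_norm {e p : 𝔼} (he : ‖e‖ = 1) (i : Fin n) (F : ℝ → ℝ → ℝ≥0∞) :
    ∫⁻ x : 𝔼, F (inner ℝ e (x - p)) ‖x - p‖ = ∫⁻ z : 𝔼, F (z i) ‖z‖ := by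
  obtain ⟨Φ, hΦ⟩ := exists_isometry_map_eq (v := EuclideanSpace.single i (1 : ℝ)) (w := e)
    (by simp [he])
  rw [lintegral_sub_right_eq_self (fun x : 𝔼 => F (inner ℝ e x) ‖x‖) p,
    ← Φ.measurePreserving.lintegral_comp_emb Φ.toHomeomorph.measurableEmbedding]
  refine lintegral_congr fun z => ?_
  rw [← hΦ, Φ.inner_map_map, Φ.norm_map, EuclideanSpace.inner_single_left]
  simp

/-- The box of points with `i`-th coordinate between `a` and `b` and the others smaller than `ρ`. -/
def heightBox (i : Fin n) (a b ρ : ℝ) : Set (EuclideanSpace ℝ (Fin n)) :=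
  {z | z i ∈ Ioo a b ∧ ∀ j ≠ i, z j ∈ Ioo (-ρ) ρ}

theorem measurableSet_heightBox (i : Fin n) (a b ρ : ℝ) : MeasurableSet (heightBox i a b ρ) := by
  have : heightBox i a b ρ = (fun z : 𝔼 => z i) ⁻¹' Ioo a b ∩
      ⋂ j, ⋂ _ : j ≠ i, (fun z : 𝔼 => z j) ⁻¹' Ioo (-ρ) ρ := by
    ext z
    simp [heightBox]
  rw [this]
  exact (measurableSet_Ioo.preimage (by fun_prop)).inter (MeasurableSet.iInter fun j =>
    MeasurableSet.iInter fun _ => measurableSet_Ioo.preimage (by fun_prop))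

theorem lintegral_heightBox (i : Fin n) {a b ρ : ℝ} (ha : 0 < a) (hab : a ≤ b) (hρ : 0 ≤ ρ) :
    ∫⁻ z in heightBox i a b ρ, ENNReal.ofReal (z i)⁻¹ =
      ENNReal.ofReal ((2 * ρ) ^ (n - 1) * Real.log (b / a)) := by
  set f : Fin n → ℝ → ℝ := fun j => if j = i then (Ioo a b).indicator (fun t => t⁻¹) else
    (Ioo (-ρ) ρ).indicator 1 with hf
  have hb : 0 < b := ha.trans_le hab
  have hint : IntegrableOn (fun t : ℝ => t⁻¹) (Ioo a b) := by
    have : IntervalIntegrable (fun t : ℝ => t⁻¹) volume a b :=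
      intervalIntegral.intervalIntegrable_inv (fun t ht h0 => by
        rw [uIcc_of_le hab] at ht
        linarith [ht.1]) continuousOn_id
    exact this.1.mono_set Ioo_subset_Ioc_self
  have hfi : ∀ j, Integrable (f j) := by
    intro j
    by_cases h : j = i
    · simpa [hf, h] using (integrable_indicator_iff measurableSet_Ioo).2 hint
    · simp only [hf, h, if_false]
      exact (integrable_indicator_iff measurableSet_Ioo).2 (by
        rw [Pi.one_def]
        exact integrableOn_const (by simp))
  have hf0 : ∀ j t, 0 ≤ f j t := by
    intro j t
    by_cases h : j = i
    · simp only [hf, h, if_true]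
      exact indicator_nonneg (fun t ht => inv_nonneg.2 (ha.trans ht.1).le) t
    · simp only [hf, h, if_false]
      exact indicator_nonneg (fun t _ => zero_le_one) t
  have hval : ∫ x : Fin n → ℝ, ∏ j, f j (x j) = (2 * ρ) ^ (n - 1) * Real.log (b / a) := by
    rw [integral_fintype_prod_volume_eq_prod]
    have e1 : ∀ j, ∫ t, f j t = if j = i then Real.log (b / a) else 2 * ρ := by
      intro j
      by_cases h : j = i
      · simp only [hf, h, if_true]
        rw [integral_indicator measurableSet_Ioo, ← integral_Ioc_eq_integral_Ioo,
          ← intervalIntegral.integral_of_le hab, integral_inv_of_pos ha hb]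
      · simp only [hf, h, if_false]
        rw [integral_indicator_one measurableSet_Ioo, measureReal_def, Real.volume_Ioo,
          ENNReal.toReal_ofReal (by linarith)]
        ring
    simp only [e1]
    rw [Finset.prod_ite, Finset.filter_eq' Finset.univ i]
    simp only [Finset.mem_univ, if_true, Finset.prod_const, Finset.card_singleton, pow_one]
    rw [Finset.filter_ne' Finset.univ i, Finset.card_erase_of_mem (Finset.mem_univ i),
      Finset.card_univ, Fintype.card_fin, mul_comm]
  have hprod : ∀ z : 𝔼, (heightBox i a b ρ).indicator (fun z => ENNReal.ofReal (z i)⁻¹) z =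
      ENNReal.ofReal (∏ j, f j (z j)) := by
    intro z
    by_cases hz : z ∈ heightBox i a b ρ
    · rw [indicator_of_mem hz, Finset.prod_eq_single i]
      · simp only [hf, if_true]
        rw [indicator_of_mem hz.1]
      · intro j _ hj
        simp only [hf, hj, if_false]
        rw [indicator_of_mem (hz.2 j hj), Pi.one_apply]
      · simp
    · rw [indicator_of_notMem hz]
      have : ∃ j, f j (z j) = 0 := by
        by_contra! hne
        refine hz ⟨?_, fun j hj => ?_⟩
        · have := hne i
          simp only [hf, if_true] at this
          exact mem_of_indicator_ne_zero this
        · have := hne j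
          simp only [hf, hj, if_false] at this
          exact mem_of_indicator_ne_zero this
      obtain ⟨j, hj⟩ := this
      rw [Finset.prod_eq_zero (Finset.mem_univ j) hj, ENNReal.ofReal_zero]
  rw [← lintegral_indicator (measurableSet_heightBox i a b ρ), lintegral_congr hprod, ← hval]
  refine Eq.trans ?_ (ofReal_integral_eq_lintegral_ofReal (Integrable.fintype_prod hfi)
    (Filter.Eventually.of_forall fun x => Finset.prod_nonneg fun j _ => hf0 j _)).symm
  exact (EuclideanSpace.volume_preserving_symm_measurableEquiv_toLp (Fin n)).lintegral_comp_emb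
    (MeasurableEquiv.measurableEmbedding _) fun x => ENNReal.ofReal (∏ j, f j (x j))

end Boxes

/-! ### Sharpness on a half-space -/

noncomputable section Sharpness

open Filter Topology

variable {n : ℕ}

local notation "𝔼" => EuclideanSpace ℝ (Fin n)
local notation "dS" => Measure.toSphere (volume : Measure (EuclideanSpace ℝ (Fin n)))

variable {e p : EuclideanSpace ℝ (Fin n)} {α m L R : ℝ}

/-- The part of the half-space where the cutoff may be positive. -/
def cutoffRegion (e p : 𝔼) (m L R : ℝ) : Set 𝔼 :=
  {x | m * Real.exp (-L) < inner ℝ e (x - p) ∧ inner ℝ e (x - p) < m * Real.exp L ∧ ‖x - p‖ < R}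

theorem measurableSet_cutoffRegion (e p : 𝔼) (m L R : ℝ) :
    MeasurableSet (cutoffRegion e p m L R) := by
  have h1 : MeasurableSet {x : 𝔼 | m * Real.exp (-L) < inner ℝ e (x - p)} :=
    measurableSet_lt (by fun_prop) (by fun_prop)
  have h2 : MeasurableSet {x : 𝔼 | inner ℝ e (x - p) < m * Real.exp L} :=
    measurableSet_lt (by fun_prop) (by fun_prop)
  have h3 : MeasurableSet {x : 𝔼 | ‖x - p‖ < R} := measurableSet_lt (by fun_prop) (by fun_prop)
  exact h1.inter (h2.inter h3)

/-- The Hardy integral of the cutoff. -/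
def cutoffMass (e p : 𝔼) (m L R : ℝ) : ℝ≥0∞ :=
  ∫⁻ x in halfSpace e p,
    ENNReal.ofReal (logCutoff m L R (inner ℝ e (x - p)) ‖x - p‖ ^ 2 * (inner ℝ e (x - p))⁻¹)

theorem log_mul_exp_div (hm : 0 < m) (s : ℝ) :
    Real.log (m * Real.exp s / (m * Real.exp (-s))) = 2 * s := by
  rw [mul_div_mul_left _ _ hm.ne', ← Real.exp_sub, Real.log_exp]
  ring

theorem lintegral_cutoffRegion_le (he : ‖e‖ = 1) (i : Fin n) (hm : 0 < m) (hL : 0 < L)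
    (hR : 0 ≤ R) : ∫⁻ x in cutoffRegion e p m L R, ENNReal.ofReal (inner ℝ e (x - p))⁻¹ ≤
      ENNReal.ofReal ((2 * R) ^ (n - 1) * (2 * L)) := by
  have h1 : m * Real.exp (-L) ≤ m * Real.exp L := by gcongr; linarith
  rw [← log_mul_exp_div hm L, ← lintegral_heightBox i (by positivity) h1 hR,
    ← lintegral_indicator (measurableSet_cutoffRegion e p m L R),
    ← lintegral_indicator (measurableSet_heightBox i _ _ _)]
  have h2 := lintegral_height_norm (p := p) he i fun s N =>
    if m * Real.exp (-L) < s ∧ s < m * Real.exp L ∧ N < R then ENNReal.ofReal s⁻¹ else 0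
  refine le_of_eq_of_le ((lintegral_congr fun x => ?_).trans h2) (lintegral_mono fun z => ?_)
  · by_cases hx : x ∈ cutoffRegion e p m L R
    · rw [indicator_of_mem hx]
      exact (if_pos hx).symm
    · rw [indicator_of_notMem hx]
      exact (if_neg hx).symm
  · simp only
    split_ifs with h
    · rw [indicator_of_mem]
      refine ⟨⟨h.1, h.2.1⟩, fun j _ => abs_lt.1 (lt_of_le_of_lt ?_ h.2.2)⟩
      exact PiLp.norm_apply_le z j
    · exact zero_le

/-- On the box with heights between `m e^(-L/2)` and `m e^(L/2)` and half-width `R/(4n)`, the norm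
is at most `R/4`. The cutoff is then at least `1 - 1/2 - 1/4`, and the inverse height integrates to
`L` times the base. -/
theorem le_cutoffMass (he : ‖e‖ = 1) (i : Fin n) (hm : 0 < m) (hL : 0 < L) (hR : 0 < R)
    (hmR : m * Real.exp (L / 2) * (4 * n) ≤ R) :
    ENNReal.ofReal (1 / 16 * ((2 * (R / (4 * n))) ^ (n - 1) * L)) ≤ cutoffMass e p m L R := by
  have hn : (0 : ℝ) < n := by exact_mod_cast Fin.pos i
  have hρ : 0 < R / (4 * n) := by positivity
  have h1 : m * Real.exp (-(L / 2)) ≤ m * Real.exp (L / 2) := by gcongr; linarith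
  have hbR : m * Real.exp (L / 2) ≤ R / (4 * n) := (le_div_iff₀ (by positivity)).2 hmR
  have hH := (isOpen_halfSpace e p).measurableSet
  have hbox := lintegral_heightBox i (by positivity) h1 hρ.le
  rw [log_mul_exp_div hm, mul_div_cancel₀ _ two_ne_zero] at hbox
  rw [ENNReal.ofReal_mul (by norm_num), ← hbox,
    ← lintegral_indicator (measurableSet_heightBox i _ _ _),
    ← lintegral_const_mul' _ _ ENNReal.ofReal_ne_top]
  have h2 := lintegral_height_norm (p := p) he i fun s N =>
    if 0 < s then ENNReal.ofReal (logCutoff m L R s N ^ 2 * s⁻¹) else 0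
  have h3 : cutoffMass e p m L R = ∫⁻ x, if 0 < inner ℝ e (x - p) then
      ENNReal.ofReal (logCutoff m L R (inner ℝ e (x - p)) ‖x - p‖ ^ 2 * (inner ℝ e (x - p))⁻¹)
        else 0 := by
    rw [cutoffMass, ← lintegral_indicator hH]
    refine lintegral_congr fun x => ?_
    by_cases hx : x ∈ halfSpace e p
    · rw [indicator_of_mem hx]
      exact (if_pos hx).symm
    · rw [indicator_of_notMem hx]
      exact (if_neg hx).symm
  rw [h3, h2]
  refine lintegral_mono fun z => ?_
  by_cases hz : z ∈ heightBox i (m * Real.exp (-(L / 2))) (m * Real.exp (L / 2)) (R / (4 * n))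
  · have hz0 : 0 < z i := lt_trans (by positivity) hz.1.1
    have hzn : ‖z‖ ≤ R / 4 := by
      have hj : ∀ j, ‖z j‖ ^ 2 ≤ (R / (4 * n)) ^ 2 := by
        intro j
        rw [Real.norm_eq_abs, sq_abs]
        by_cases h : j = i
        · rw [h]
          exact pow_le_pow_left₀ hz0.le (hz.1.2.le.trans hbR) 2
        · exact sq_le_sq' (hz.2 j h).1.le (hz.2 j h).2.le
      have hsum : ‖z‖ ^ 2 ≤ (R / 4) ^ 2 := by
        rw [EuclideanSpace.norm_sq_eq]
        refine (Finset.sum_le_sum fun j _ => hj j).trans ?_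
        rw [Finset.sum_const, Finset.card_univ, Fintype.card_fin, nsmul_eq_mul]
        have hn1 : (1 : ℝ) ≤ n := by exact_mod_cast Fin.pos i
        have : (n : ℝ) * (R / (4 * n)) ^ 2 = (R / 4) ^ 2 / n := by field_simp
        rw [this]
        exact div_le_self (by positivity) hn1
      exact le_of_sq_le_sq hsum (by positivity)
    rw [indicator_of_mem hz, if_pos hz0, ← ENNReal.ofReal_mul (by norm_num)]
    refine ENNReal.ofReal_le_ofReal (mul_le_mul_of_nonneg_right ?_ (inv_nonneg.2 hz0.le))
    have := logCutoff_ge hm hL hR hz.1.1 hz.1.2 hzn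
    nlinarith
  · rw [indicator_of_notMem hz, mul_zero]
    exact zero_le

/-- Both quantities are of order `R^(n-1) L`, so their ratio is bounded independently of `m`, `L`
and `R`. The factor `oscConst α (2/L)` then makes the energy negligible. -/
theorem lintegral_cutoffRegion_le_cutoffMass [NeZero n] (he : ‖e‖ = 1) (hm : 0 < m) (hL : 0 < L)
    (hR : 0 < R) (hmR : m * Real.exp (L / 2) * (4 * n) ≤ R) :
    ∫⁻ x in cutoffRegion e p m L R, ENNReal.ofReal (inner ℝ e (x - p))⁻¹ ≤
      ENNReal.ofReal (32 * (4 * n) ^ (n - 1)) * cutoffMass e p m L R := by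
  have i : Fin n := ⟨0, Nat.pos_of_ne_zero (NeZero.ne n)⟩
  have hn : (0 : ℝ) < n := by exact_mod_cast Fin.pos i
  refine (lintegral_cutoffRegion_le he i hm hL hR.le).trans
    (le_trans (le_of_eq ?_) (mul_le_mul_right (le_cutoffMass he i hm hL hR hmR) _))
  rw [← ENNReal.ofReal_mul (by positivity)]
  congr 1
  have : (4 * (n : ℝ)) ^ (n - 1) * (2 * (R / (4 * n))) ^ (n - 1) = (2 * R) ^ (n - 1) := by
    rw [← mul_pow]
    congr 1
    field_simp
  rw [← this]
  ring

theorem cutoffMass_ne_zero [NeZero n] (he : ‖e‖ = 1) (hm : 0 < m) (hL : 0 < L) (hR : 0 < R)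
    (hmR : m * Real.exp (L / 2) * (4 * n) ≤ R) : cutoffMass e p m L R ≠ 0 := by
  have i : Fin n := ⟨0, Nat.pos_of_ne_zero (NeZero.ne n)⟩
  have hn : (0 : ℝ) < n := by exact_mod_cast Fin.pos i
  exact (lt_of_lt_of_le (ENNReal.ofReal_pos.2 (by positivity))
    (le_cutoffMass he i hm hL hR hmR)).ne'

theorem cutoffMass_ne_top [NeZero n] (he : ‖e‖ = 1) (hm : 0 < m) (hL : 0 < L) (hR : 0 < R) :
    cutoffMass e p m L R ≠ ∞ := by
  have i : Fin n := ⟨0, Nat.pos_of_ne_zero (NeZero.ne n)⟩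
  refine ne_top_of_le_ne_top ENNReal.ofReal_ne_top (le_trans ?_
    (lintegral_cutoffRegion_le (p := p) he i hm hL hR.le))
  have hH := (isOpen_halfSpace e p).measurableSet
  rw [cutoffMass, ← lintegral_indicator hH,
    ← lintegral_indicator (measurableSet_cutoffRegion e p m L R)]
  refine lintegral_mono fun x => ?_
  by_cases hx : x ∈ halfSpace e p
  · have hx' : 0 < inner ℝ e (x - p) := hx
    rw [indicator_of_mem hx]
    rcases (logCutoff_nonneg m L R (inner ℝ e (x - p)) ‖x - p‖).eq_or_lt with h0 | h0
    · simp [← h0]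
    · have hS : x ∈ cutoffRegion e p m L R := mem_of_logCutoff_pos hm hL hR (norm_nonneg _) h0
      rw [indicator_of_mem hS]
      refine ENNReal.ofReal_le_ofReal (mul_le_of_le_one_left (inv_nonneg.2 hx'.le) ?_)
      exact pow_le_one₀ h0.le (logCutoff_le_one hL hR (norm_nonneg _))
  · rw [indicator_of_notMem hx]
    exact zero_le

/-- The ground state of the half-space, cut off near the boundary point `p`. -/
def cutoffGroundState (e p : 𝔼) (α m L R : ℝ) (x : 𝔼) : ℝ :=
  max 0 (inner ℝ e (x - p)) ^ ((α - 1) / 2) * logCutoff m L R (inner ℝ e (x - p)) ‖x - p‖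

theorem IsCc.mono {Ω Ω' : Set 𝔼} {u : 𝔼 → ℝ} (hu : IsCc Ω u) (h : Ω ⊆ Ω') : IsCc Ω' u :=
  ⟨hu.continuous, hu.hasCompactSupport, hu.tsupport_subset.trans h⟩

/-- With `h = ⟨e, x - p⟩`, `|x - p - re|² = |x - p|² - 2rh + r²`. On the support `|x - p| ≤ R` and
`h ≥ m e^(-L)`, so the hypothesis on `R` puts it inside the ball. -/
theorem isCc_cutoffGroundState (hα1 : 1 < α) (he : ‖e‖ = 1) (hm : 0 < m) (hL : 0 < L)
    (hR : 0 < R) {r : ℝ} (hRr : R ^ 2 < 2 * r * (m * Real.exp (-L))) :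
    IsCc (Metric.ball (p + r • e) r) (cutoffGroundState e p α m L R) := by
  set K : Set 𝔼 := {x | m * Real.exp (-L) ≤ inner ℝ e (x - p) ∧ ‖x - p‖ ≤ R} with hK
  have ha : 0 < m * Real.exp (-L) := by positivity
  have hr : 0 < r := by
    by_contra! h
    nlinarith [sq_nonneg R]
  have hKc : IsClosed K := by
    have h1 : IsClosed {x : 𝔼 | m * Real.exp (-L) ≤ inner ℝ e (x - p)} :=
      isClosed_le (by fun_prop) (by fun_prop)
    have h2 : IsClosed {x : 𝔼 | ‖x - p‖ ≤ R} := isClosed_le (by fun_prop) (by fun_prop)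
    exact h1.inter h2
  have hKb : Bornology.IsBounded K := (Metric.isBounded_closedBall (x := p) (r := R)).subset
    fun x hx => by rw [Metric.mem_closedBall, dist_eq_norm]; exact hx.2
  have hsupp : Function.support (cutoffGroundState e p α m L R) ⊆ K := by
    intro x hx
    have h0 := (logCutoff_nonneg m L R (inner ℝ e (x - p)) ‖x - p‖).lt_of_ne'
      (right_ne_zero_of_mul hx)
    obtain ⟨h1, -, h2⟩ := mem_of_logCutoff_pos hm hL hR (norm_nonneg _) h0
    exact ⟨h1.le, h2.le⟩
  have htsupp : tsupport (cutoffGroundState e p α m L R) ⊆ K := closure_minimal hsupp hKc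
  refine ⟨?_, ?_, htsupp.trans fun x hx => ?_⟩
  · have h1 : Continuous fun x : 𝔼 => max 0 (inner ℝ e (x - p)) := by fun_prop
    have h2 : Continuous fun x : 𝔼 => ((inner ℝ e (x - p) : ℝ), ‖x - p‖) := by fun_prop
    have h3 : Continuous fun x : 𝔼 => max 0 (inner ℝ e (x - p)) ^ ((α - 1) / 2) :=
      h1.rpow_const fun _ => Or.inr (by linarith)
    have h4 := (continuous_logCutoff (L := L) (R := R) hm).comp h2
    simp only [Function.comp_def] at h4
    have h5 := h3.mul h4
    exact h5
  · have hKcp : IsCompact K := Metric.isCompact_of_isClosed_isBounded hKc hKb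
    exact hKcp.of_isClosed_subset (isClosed_tsupport _) htsupp
  · have hx1 : m * Real.exp (-L) ≤ inner ℝ e (x - p) := hx.1
    have hx2 : ‖x - p‖ ≤ R := hx.2
    rw [Metric.mem_ball, dist_eq_norm, ← sub_sub]
    refine lt_of_pow_lt_pow_left₀ 2 hr.le ?_
    rw [norm_sub_sq_real, norm_smul, he, mul_one, Real.norm_of_nonneg hr.le,
      real_inner_smul_right, real_inner_comm]
    have h1 : ‖x - p‖ ^ 2 ≤ R ^ 2 := pow_le_pow_left₀ (norm_nonneg _) hx2 2
    have h2 : r * (m * Real.exp (-L)) ≤ r * inner ℝ e (x - p) :=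
      mul_le_mul_of_nonneg_left hx1 hr.le
    linarith

theorem tendsto_oscConst (hα1 : 1 < α) : Tendsto (fun L => oscConst α (2 / L)) atTop (𝓝 0) := by
  have h0 : Tendsto (fun L : ℝ => 2 / L) atTop (𝓝 0) := tendsto_const_nhds.div_atTop tendsto_id
  have h1 := h0.rpow_const (p := α - 1) (Or.inr (by linarith))
  have h2 := (((h0.pow 2).const_mul 2).div_const (2 - α)).add (h1.const_mul 2)
  rw [Real.zero_rpow (by linarith)] at h2
  simpa [oscConst] using h2

theorem ball_subset_halfSpace (he : ‖e‖ = 1) (r : ℝ) :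
    Metric.ball (p + r • e) r ⊆ halfSpace e p := by
  intro x hx
  rw [Metric.mem_ball, dist_eq_norm] at hx
  have h1 := (abs_lt.1 ((abs_real_inner_le_norm e (x - (p + r • e))).trans_lt
    (by rwa [he, one_mul]))).1
  rw [← sub_sub, inner_sub_right, real_inner_smul_right, real_inner_self_eq_norm_sq, he] at h1
  change 0 < inner ℝ e (x - p)
  linarith

/-- The constant in the Hardy inequality on a half-space is sharp, even for functions supported in
a ball touching the boundary. -/
theorem halfSpace_sharp [NeZero n] (hα1 : 1 < α) (hα2 : α < 2) (he : ‖e‖ = 1) {r C : ℝ}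
    (hr : 0 < r) (hC : hardyKappa n α < C) :
    ∃ u : 𝔼 → ℝ, IsCc (Metric.ball (p + r • e) r) u ∧ regionalForm (halfSpace e p) α u <
      ENNReal.ofReal C * ∫⁻ x in halfSpace e p,
        ENNReal.ofReal (u x ^ 2) * ENNReal.ofReal (inner ℝ e (x - p) ^ (-α)) := by
  have hn : (0 : ℝ) < n := by exact_mod_cast Nat.pos_of_ne_zero (NeZero.ne n)
  set c : ℝ := 2 * Real.pi ^ (((n : ℝ) - 1) / 2) * Real.Gamma ((1 + α) / 2) /
    Real.Gamma (((n : ℝ) + α) / 2) with hc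
  have hc0 : 0 < c := by
    have h1 := Real.Gamma_pos_of_pos (s := (1 + α) / 2) (by linarith)
    have h2 := Real.Gamma_pos_of_pos (s := ((n : ℝ) + α) / 2) (by linarith)
    positivity
  have hκ : hardyKappa n α = c * (lineKappa α / 2) := hardyKappa_eq n α
  have hlk := lineKappa_nonneg hα1 hα2
  set σ : ℝ := (dS univ).toReal with hσ
  have hσ0 : 0 ≤ σ := ENNReal.toReal_nonneg
  have hσe : dS univ = ENNReal.ofReal σ := (ENNReal.ofReal_toReal (measure_ne_top _ _)).symm
  -- This makes the truncation loss `δc/2` equal to half the gap `C - κ`; the ground state energy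
  -- must fit strictly into the other half, which determines `L`.
  set δ : ℝ := (C - hardyKappa n α) / c with hδ
  have hδ0 : 0 < δ := div_pos (by linarith) hc0
  obtain ⟨L, hL4, hLsmall⟩ : ∃ L : ℝ, 4 * n ≤ L ∧
      oscConst α (2 / L) * σ * (32 * (4 * n) ^ (n - 1)) < (C - hardyKappa n α) / 2 := by
    have h1 : Tendsto (fun L => oscConst α (2 / L) * σ * (32 * (4 * (n : ℝ)) ^ (n - 1))) atTop
        (𝓝 0) := by
      simpa using ((tendsto_oscConst hα1).mul_const σ).mul_const (32 * (4 * (n : ℝ)) ^ (n - 1))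
    exact ((eventually_ge_atTop (4 * (n : ℝ))).and
      (h1.eventually_lt_const (by linarith : (0 : ℝ) < (C - hardyKappa n α) / 2))).exists
  have hL : 0 < L := lt_of_lt_of_le (by positivity) hL4
  -- The choices of `R` and `m` give `m e^L L = R`, for the oscillation bound, and `r m e^(-L) =
  -- R²`, for the support in the ball.
  set R : ℝ := r * Real.exp (-L) ^ 2 / L with hRdef
  have hR : 0 < R := by positivity
  set m : ℝ := R * Real.exp (-L) / L with hmdef
  have hm : 0 < m := by positivity
  have hexp : Real.exp (-L) * Real.exp L = 1 := by rw [← Real.exp_add]; simp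
  have hmL : m * Real.exp L * L ≤ R := by
    rw [hmdef, div_mul_eq_mul_div, div_mul_cancel₀ _ hL.ne', mul_assoc, hexp, mul_one]
  have hmR : m * Real.exp (L / 2) * (4 * n) ≤ R := by
    refine le_trans ?_ hmL
    gcongr
    linarith
  have hRr : R ^ 2 < 2 * r * (m * Real.exp (-L)) := by
    have h1 : 2 * r * (m * Real.exp (-L)) = 2 * R ^ 2 := by
      rw [hmdef, sq R]
      nth_rw 3 [hRdef]
      ring
    rw [h1]
    have : 0 < R ^ 2 := by positivity
    linarith
  set u := cutoffGroundState e p α m L R with hu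
  set f : 𝔼 → ℝ := fun x => logCutoff m L R (inner ℝ e (x - p)) ‖x - p‖ with hf
  have hball := isCc_cutoffGroundState (p := p) hα1 he hm hL hR hRr
  have huf : ∀ x ∈ halfSpace e p, u x = inner ℝ e (x - p) ^ ((α - 1) / 2) * f x := by
    intro x hx
    have hx' : 0 < inner ℝ e (x - p) := hx
    rw [hu, cutoffGroundState, max_eq_right hx'.le]
  have hmass : ∫⁻ x in halfSpace e p, ENNReal.ofReal (u x ^ 2) *
      ENNReal.ofReal (inner ℝ e (x - p) ^ (-α)) = cutoffMass e p m L R := by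
    refine setLIntegral_congr_fun (isOpen_halfSpace e p).measurableSet fun x hx => ?_
    have hx' : 0 < inner ℝ e (x - p) := hx
    rw [← ENNReal.ofReal_mul (sq_nonneg _), huf x hx, mul_pow, ← Real.rpow_mul_natCast hx'.le,
      mul_right_comm, ← Real.rpow_add hx', ← Real.rpow_neg_one, mul_comm]
    congr 3
    push_cast
    ring
  have hmass0 := cutoffMass_ne_zero (p := p) he hm hL hR hmR
  have hmassT := cutoffMass_ne_top (p := p) he hm hL hR
  have hdir : ∫⁻ x in halfSpace e p, ENNReal.ofReal (u x ^ 2) * dirIntegral (halfGauge e p) α x =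
      ENNReal.ofReal c * cutoffMass e p m L R := by
    rw [← hmass, ← lintegral_const_mul' _ _ ENNReal.ofReal_ne_top]
    refine setLIntegral_congr_fun (isOpen_halfSpace e p).measurableSet fun x hx => ?_
    rw [halfSpace_dirIntegral he (by linarith) hx]
    ring
  have hosc := oscConst_nonneg hα2 (k := 2 / L) (by positivity)
  have hf01 : ∀ x, 0 ≤ f x ∧ f x ≤ 1 := fun x =>
    ⟨logCutoff_nonneg _ _ _ _ _, logCutoff_le_one hL hR (norm_nonneg _)⟩
  have hground := groundEnergy_le hα1 hα2 he (k := 2 / L) (by positivity) (f := f)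
    (measurableSet_cutoffRegion e p m L R)
    (fun x hx => lt_trans (by positivity) hx.1)
    (fun x _ hxS => by
      by_contra hne
      exact hxS (mem_of_logCutoff_pos hm hL hR (norm_nonneg _) ((hf01 x).1.lt_of_ne' hne)))
    (fun x _ y _ => by
      obtain ⟨h1, h2⟩ := hf01 x
      obtain ⟨h3, h4⟩ := hf01 y
      rw [sq_le_one_iff_abs_le_one]
      exact abs_le.2 ⟨by linarith, by linarith⟩)
    (fun x hx y hy => sq_logCutoff_sub_mul_le hm hL hmL hx hy (norm_nonneg _) (norm_nonneg _)
      (abs_inner_sub_le he x y) (by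
        have := abs_norm_sub_norm_le (x - p) (y - p)
        rwa [sub_sub_sub_cancel_right] at this))
  have henergy := halfSpace_energy_le hα1 hα2 hδ0 he
    (hball.mono (ball_subset_halfSpace he r)) huf
  refine ⟨u, hball, ?_⟩
  rw [hmass]
  have hhalf : (1 / 2 : ℝ≥0∞) * 2 = 1 := by
    rw [one_div, ENNReal.inv_mul_cancel (by simp) (by simp)]
  calc regionalForm (halfSpace e p) α u
      ≤ ENNReal.ofReal ((lineKappa α + δ) / 2) * (ENNReal.ofReal c * cutoffMass e p m L R) +
          (1 / 2) * (2 * (ENNReal.ofReal (oscConst α (2 / L)) * ENNReal.ofReal σ *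
            (ENNReal.ofReal (32 * (4 * n) ^ (n - 1)) * cutoffMass e p m L R))) := by
        rw [hdir] at henergy
        rw [hσe] at hground
        refine henergy.trans (add_le_add le_rfl (mul_le_mul_right (hground.trans ?_) _))
        gcongr
        exact lintegral_cutoffRegion_le_cutoffMass he hm hL hR hmR
    _ = ENNReal.ofReal ((lineKappa α + δ) / 2 * c +
          oscConst α (2 / L) * σ * (32 * (4 * n) ^ (n - 1))) * cutoffMass e p m L R := by
        rw [← mul_assoc (1 / 2 : ℝ≥0∞), hhalf, one_mul,
          ENNReal.ofReal_add (by positivity) (by positivity), add_mul,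
          ENNReal.ofReal_mul (p := (lineKappa α + δ) / 2) (by positivity),
          ENNReal.ofReal_mul (p := oscConst α (2 / L) * σ) (by positivity),
          ENNReal.ofReal_mul (p := oscConst α (2 / L)) hosc]
        ring
    _ < ENNReal.ofReal C * cutoffMass e p m L R := by
        refine ENNReal.mul_lt_mul_left hmass0 hmassT ((ENNReal.ofReal_lt_ofReal_iff ?_).2 ?_)
        · have : 0 ≤ hardyKappa n α := by rw [hκ]; positivity
          linarith
        · have : (lineKappa α + δ) / 2 * c = hardyKappa n α + (C - hardyKappa n α) / 2 := by
            rw [hκ, hδ, hκ]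
            field_simp
          linarith

end Sharpness

/-! ### Sharpness on convex domains -/

section ConvexSharpness

variable {n : ℕ}

local notation "𝔼" => EuclideanSpace ℝ (Fin n)

/-- A convex bounded open set has an inner touching ball at some boundary point, and lies on one
side of the hyperplane tangent to this ball. -/
theorem exists_touching_ball [NeZero n] {Ω : Set 𝔼} (hΩ : IsOpen Ω) (hne : Ω.Nonempty)
    (hc : Convex ℝ Ω) (hb : Bornology.IsBounded Ω) :
    ∃ e p : 𝔼, ∃ r : ℝ, ‖e‖ = 1 ∧ 0 < r ∧ Ω ⊆ halfSpace e p ∧ Metric.ball (p + r • e) r ⊆ Ω := by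
  obtain ⟨c, hcΩ⟩ := hne
  obtain ⟨y, hy, hr, -, hball⟩ := exists_nearest_point hΩ hb hcΩ
  obtain ⟨e, he, hpos⟩ := exists_unit_inner_pos_of_notMem hΩ ⟨c, hcΩ⟩ hc hy
  set r := dist c y with hrdef
  refine ⟨e, y, r, he, hr, fun a ha => hpos a ha, ?_⟩
  -- Otherwise the foot of the perpendicular from `c` to the hyperplane would lie in the ball, hence
  -- in `Ω`, which avoids the hyperplane.
  have hin : r ≤ inner ℝ e (c - y) := by
    by_contra! hlt
    have h0 := hpos c hcΩ
    have hmem : c - (inner ℝ e (c - y) : ℝ) • e ∈ Ω := by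
      refine hball ?_
      rwa [Metric.mem_ball, dist_eq_norm, sub_sub_cancel_left, norm_neg, norm_smul, he, mul_one,
        Real.norm_of_nonneg h0.le]
    have := hpos _ hmem
    rw [sub_right_comm, inner_sub_right, real_inner_smul_right, real_inner_self_eq_norm_sq, he,
      one_pow, mul_one, sub_self] at this
    exact lt_irrefl _ this
  -- Equality case of Cauchy-Schwarz: `|c - y| = r ≤ ⟨e, c - y⟩` with `|e| = 1`.
  have hce : c = y + r • e := by
    rw [← sub_eq_iff_eq_add', ← sub_eq_zero, ← norm_le_zero_iff]
    refine le_of_sq_le_sq ?_ le_rfl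
    rw [norm_sub_sq_real, norm_smul, he, mul_one, Real.norm_of_nonneg hr.le,
      real_inner_smul_right, real_inner_comm, ← dist_eq_norm, ← hrdef]
    nlinarith
  rwa [← hce]

theorem distCompl_le_of_subset_halfSpace {Ω : Set 𝔼} {e p x : 𝔼} (he : ‖e‖ = 1)
    (hsub : Ω ⊆ halfSpace e p) (hx : x ∈ halfSpace e p) :
    distCompl Ω x ≤ ENNReal.ofReal (inner ℝ e (x - p)) := by
  have hx' : 0 < inner ℝ e (x - p) := hx
  have hmem : x - (inner ℝ e (x - p) : ℝ) • e ∈ Ωᶜ := by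
    intro hm
    have h1 : 0 < inner ℝ e (x - (inner ℝ e (x - p) : ℝ) • e - p) := hsub hm
    rw [sub_right_comm, inner_sub_right, real_inner_smul_right, real_inner_self_eq_norm_sq, he,
      one_pow, mul_one, sub_self] at h1
    exact lt_irrefl _ h1
  refine (Metric.infEDist_le_edist_of_mem hmem).trans (le_of_eq ?_)
  rw [edist_dist, dist_eq_norm, sub_sub_cancel, norm_smul, he, mul_one, Real.norm_of_nonneg hx'.le]

theorem regionalForm_mono {Ω Ω' : Set 𝔼} (h : Ω ⊆ Ω') (α : ℝ) (u : 𝔼 → ℝ) :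
    regionalForm Ω α u ≤ regionalForm Ω' α u :=
  mul_le_mul_right ((lintegral_mono_set h).trans
    (lintegral_mono fun _ => lintegral_mono_set h)) _

/-- The constant `hardyKappa n α` is optimal on every bounded convex domain. -/
theorem hardy_convex_sharp [NeZero n] {α : ℝ} (hα1 : 1 < α) (hα2 : α < 2) {Ω : Set 𝔼}
    (hΩ : IsOpen Ω) (hne : Ω.Nonempty) (hc : Convex ℝ Ω) (hb : Bornology.IsBounded Ω) {C : ℝ}
    (hC : hardyKappa n α < C) :
    ∃ u : 𝔼 → ℝ, IsCc Ω u ∧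
      regionalForm Ω α u < ENNReal.ofReal C * weightedInt Ω (distCompl Ω) α u := by
  obtain ⟨e, p, r, he, hr, hsub, hball⟩ := exists_touching_ball hΩ hne hc hb
  obtain ⟨u, hu, hlt⟩ := halfSpace_sharp (p := p) hα1 hα2 he hr hC
  have huΩ := hu.mono hball
  refine ⟨u, huΩ, (regionalForm_mono hsub α u).trans_lt (hlt.trans_le (mul_le_mul_right ?_ _))⟩
  rw [weightedInt, ← lintegral_indicator (isOpen_halfSpace e p).measurableSet,
    ← lintegral_indicator hΩ.measurableSet]
  refine lintegral_mono fun x => ?_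
  by_cases hx : x ∈ Ω
  · have hx' : 0 < inner ℝ e (x - p) := hsub hx
    rw [indicator_of_mem hx, indicator_of_mem (hsub hx), div_eq_mul_inv,
      Real.rpow_neg hx'.le, ENNReal.ofReal_inv_of_pos (by positivity),
      ← ENNReal.ofReal_rpow_of_pos hx']
    gcongr
    exact distCompl_le_of_subset_halfSpace he hsub (hsub hx)
  · have h0 : u x = 0 := by
      by_contra h
      exact hx (huΩ.tsupport_subset (subset_tsupport u h))
    rw [indicator_of_notMem hx]
    refine indicator_apply_le' (fun _ => ?_) fun _ => le_rfl
    simp [h0]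

end ConvexSharpness

theorem theorem1p3 (n : ℕ) [NeZero n] (α : ℝ) (hα1 : 1 < α) (hα2 : α < 2) :
    -- the inequality on bounded domains
    (∀ Ω : Set (EuclideanSpace ℝ (Fin n)), IsOpen Ω → IsConnected Ω → Bornology.IsBounded Ω →
      ∀ u : EuclideanSpace ℝ (Fin n) → ℝ, IsCc Ω u →
        ENNReal.ofReal (hardyKappa n α) * weightedInt Ω (lossSloaneM Ω α) α u +
          ENNReal.ofReal (hardyLambda n α * (1 / Metric.diam Ω)) *
            weightedInt Ω (lossSloaneM Ω (α - 1)) (α - 1) u ≤ regionalForm Ω α u) ∧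
    -- the inequality on bounded convex domains
    (∀ Ω : Set (EuclideanSpace ℝ (Fin n)), IsOpen Ω → Ω.Nonempty → Convex ℝ Ω →
      Bornology.IsBounded Ω →
      ∀ u : EuclideanSpace ℝ (Fin n) → ℝ, IsCc Ω u →
        ENNReal.ofReal (hardyKappa n α) * weightedInt Ω (distCompl Ω) α u +
          ENNReal.ofReal (hardyLambda n α * (1 / Metric.diam Ω)) *
            weightedInt Ω (distCompl Ω) (α - 1) u ≤ regionalForm Ω α u) ∧
    -- on every bounded convex domain, no constant larger than `κ` is possible in either one
    (∀ Ω : Set (EuclideanSpace ℝ (Fin n)), IsOpen Ω → Ω.Nonempty → Convex ℝ Ω →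
      Bornology.IsBounded Ω →
      ∀ C : ℝ, hardyKappa n α < C →
        (∃ u : EuclideanSpace ℝ (Fin n) → ℝ, IsCc Ω u ∧
          regionalForm Ω α u <
            ENNReal.ofReal C * weightedInt Ω (lossSloaneM Ω α) α u +
              ENNReal.ofReal (hardyLambda n α * (1 / Metric.diam Ω)) *
                weightedInt Ω (lossSloaneM Ω (α - 1)) (α - 1) u) ∧
        (∃ u : EuclideanSpace ℝ (Fin n) → ℝ, IsCc Ω u ∧
          regionalForm Ω α u <
            ENNReal.ofReal C * weightedInt Ω (distCompl Ω) α u +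
              ENNReal.ofReal (hardyLambda n α * (1 / Metric.diam Ω)) *
                weightedInt Ω (distCompl Ω) (α - 1) u)) := by
  refine ⟨fun Ω hΩ _ hb u hu => hardy_lossSloane hα1 hα2 hΩ hb hu,
    fun Ω hΩ _ hc hb u hu => hardy_convex hα1 hα2 hΩ hc hb hu, fun Ω hΩ hne hc hb C hC => ?_⟩
  obtain ⟨u, hu, hlt⟩ := hardy_convex_sharp hα1 hα2 hΩ hne hc hb hC
  -- One function refutes both: the leading term with `dist` already exceeds the form, the remainder
  -- terms are nonnegative, and replacing `dist` by the smaller `M_α` only increases the weight.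
  refine ⟨⟨u, hu, hlt.trans_le ?_⟩, u, hu, hlt.trans_le le_self_add⟩
  exact (mul_le_mul_right (weightedInt_distCompl_le (by linarith) hΩ hc hb u) _).trans le_self_add
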